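/- Let $\beta_*>1$, $L_*>0$, $\rho>0$, $T<1/4$ and $\Theta\subset(-T,T]$. For $f:\mathbb R\to\mathbb R$ put $f_k=\sqrt2\int_{-1/2}^{1/2}\cos(2\pi kt)f(t)\,dt$ and $\|f'\|^2=\sum_{k\ge1}(2\pi k)^2f_k^2$, and let $\mathcal F(\beta_*,L_*,\rho)$ be the set of locally square integrable, even, $1$-periodic $f$ with $\big|\int_{-1/2}^{1/2}f(t)\cos(2\pi t)\,dt\big|\ge\rho$ and $\sum_{k\ge1}(2\pi k)^{2\beta_*}f_k^2\le L_*^2$. For $\theta\in\Theta$ and $f\in\mathcal F(\beta_*,L_*,\rho)$ one observes $$dx^\varepsilon(t)=f(t-\theta)\,dt+\varepsilon\,dW(t),\qquad t\in[-1/2,1/2],$$ where $W$ is a Brownian motion; ${\bf E}_{\theta,f}$ is the corresponding expectation. Put $x_k=\sqrt2\int_{-1/2}^{1/2}\cos(2\pi kt)\,dx^\varepsilon(t)$ and $x_k^*=\sqrt2\int_{-1/2}^{1/2}\sin(2\pi kt)\,dx^\varepsilon(t)$. For each $\varepsilon$, let $N_\varepsilon=5\vee\big[(\varepsilon^2\log\varepsilon^{-5})^{-1/(2\beta_*+1)}\big]$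 and let $B_1,\dots,B_J$ be a partition of $\{1,\dots,N_\varepsilon\}$ into nonempty blocks of consecutive integers. Let $T_j$ be the length of $B_j$, $T_\varepsilon=\min_jT_j$, $\sigma_j^2=\sum_{k\in B_j}(2\pi k)^2$, and suppose that $\log\varepsilon^{-1}=o(T_\varepsilon)$ as $\varepsilon\to0$. With the penalty $\varphi_j=\sqrt{24\,T_j^{-1}\log\varepsilon^{-5}}$ and $\|y'\|_{(j)}^2=\sum_{k\in B_j}(2\pi k)^2(x_k^2+x_k^{*2})$, the penalized blockwise Stein filter is $$\hat h^{JS}_k=\bigg(1-\frac{\varepsilon^2\sigma_j^2(1+\varphi_j)}{(\|y'\|_{(j)}^2-2\varepsilon^2\sigma_j^2)_++\varepsilon^2\sigma_j^2}\bigg)_+,\quad k\in B_j,\qquad \hat h^{JS}_k=0,\quad k>N_\varepsilon .$$ Let $\Phi_\varepsilon(\tau,h)=\sum_{k\ge1}h_k\big(\int_{-1/2}^{1/2}\cos[2\pi k(t-\tau)]\,dx^\varepsilon(t)\big)^2$, let $\bar\theta_\varepsilon=\frac1{2\pi}\arctan(x_1^*/x_1)$ if $x_1\ne0$ and $\bar\theta_\varepsilon=\frac14$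 if $x_1=0$, let $\delta_\varepsilon=\varepsilon\log\varepsilon^{-2}$, and let $\hat\theta_\varepsilon^{JS}$ be any (measurable) maximizer of $\Phi_\varepsilon(\cdot,\hat h^{JS})$ over $[\bar\theta_\varepsilon-\delta_\varepsilon,\bar\theta_\varepsilon+\delta_\varepsilon]$. Let $R^\varepsilon[f,h]=\sum_{k\ge1}(2\pi k)^2\big[(1-h_k)^2f_k^2+\varepsilon^2h_k^2\big]$ and let $h^*$ be the minimizer of $R^\varepsilon[f,\cdot]$ over all filters $h$ with values in $[0,1]$ that are constant on each block $B_j$ and vanish for $k>N_\varepsilon$. Then there is a function $\alpha_\varepsilon$, not depending on $f$ and $\theta$, with $\alpha_\varepsilon\to0$ as $\varepsilon\to0$, such that for all sufficiently small $\varepsilon>0$, all $f\in\mathcal F(\beta_*,L_*,\rho)$ and all $\theta\in\Theta$, $$\varepsilon^{-2}\|f'\|^2\,{\bf E}_{\theta,f}\big[(\hat\theta_\varepsilon^{JS}-\theta)^2\big]\le1+(1+\alpha_\varepsilon)\frac{R^\varepsilon[f,h^*]}{\|f'\|^2}.$$ -/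

import Mathlib

open MeasureTheory ProbabilityTheory Filter Topology Asymptotics
open scoped NNReal Real

noncomputable section

namespace ShiftModel

/-! ### Signals -/

/-- The cosine coefficient `f_k = √2 ∫_{-1/2}^{1/2} cos(2πkt) f(t) dt`. -/
def coef (f : ℝ → ℝ) (k : ℕ) : ℝ :=
  √2 * ∫ t in (-1 / 2 : ℝ)..(1 / 2), Real.cos (2 * π * k * t) * f t

/-- `‖f'‖² = ∑_{k ≥ 1} (2πk)² f_k²` (the term `k = 0` of the series vanishes). -/
def derivSq (f : ℝ → ℝ) : ℝ := ∑' k : ℕ, (2 * π * k) ^ 2 * coef f k ^ 2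

/-- Locally square integrable, even, `1`-periodic functions with
`|∫_{-1/2}^{1/2} f(t) cos(2πt) dt| ≥ ρ`. -/
structure IsSignal (ρ : ℝ) (f : ℝ → ℝ) : Prop where
  memLp : ∀ K : Set ℝ, IsCompact K → MemLp f 2 (volume.restrict K)
  even : ∀ x, f (-x) = f x
  periodic : ∀ x, f (x + 1) = f x
  le_abs_integral : ρ ≤ |∫ t in (-1 / 2 : ℝ)..(1 / 2), f t * Real.cos (2 * π * t)|

/-- Signals of the previous kind with `∑_{k ≥ 1} (2πk)^{2β} f_k² ≤ L²` (for `β > 0` the term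
`k = 0` of the series vanishes). -/
structure IsSobolevSignal (β L ρ : ℝ) (f : ℝ → ℝ) : Prop extends IsSignal ρ f where
  summable : Summable fun k : ℕ => (2 * π * k) ^ (2 * β) * coef f k ^ 2
  tsum_le : ∑' k : ℕ, (2 * π * k) ^ (2 * β) * coef f k ^ 2 ≤ L ^ 2

/-! ### Observations -/

/-- The observed path on `[-1/2, 1/2]`: the solution of `dx(t) = f(t - θ) dt + ε dW(t)`,
`x(-1/2) = ε W(-1/2)`, with `W(t) = b(t + 1/2)` for a path `b` indexed by `[0, ∞)`. -/
def obsPath (ε θ : ℝ) (f : ℝ → ℝ) (b : ℝ≥0 → ℝ) (t : ℝ) : ℝ :=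
  (∫ s in (-1 / 2 : ℝ)..t, f (s - θ)) + ε * b (t + 1 / 2).toNNReal

/-- The stochastic integral `∫_{-1/2}^{1/2} φ(t) dx(t)` of a smooth deterministic function `φ`
against a continuous path `x`, given by integration by parts. -/
def pathInt (φ x : ℝ → ℝ) : ℝ :=
  φ (1 / 2) * x (1 / 2) - φ (-1 / 2) * x (-1 / 2)
    - ∫ t in (-1 / 2 : ℝ)..(1 / 2), deriv φ t * x t

/-- `x_k = √2 ∫ cos(2πkt) dx(t)`. -/
def obsCos (x : ℝ → ℝ) (k : ℕ) : ℝ := √2 * pathInt (fun t => Real.cos (2 * π * k * t)) x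

/-- `x_k^* = √2 ∫ sin(2πkt) dx(t)`. -/
def obsSin (x : ℝ → ℝ) (k : ℕ) : ℝ := √2 * pathInt (fun t => Real.sin (2 * π * k * t)) x

/-- The penalized profile log-likelihood
`Φ(τ, h) = ∑_{k = 1}^N h_k (∫ cos(2πk(t - τ)) dx(t))²` of a filter `h` supported in `{1, …, N}`. -/
def profile (N : ℕ) (x : ℝ → ℝ) (h : ℕ → ℝ) (τ : ℝ) : ℝ :=
  ∑ k ∈ Finset.Icc 1 N, h k * pathInt (fun t => Real.cos (2 * π * k * (t - τ))) x ^ 2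

/-! ### Frequencies and blocks -/

/-- The cut-off `N_ε = max(5, [(ε² log ε⁻⁵)^{-1/(2β+1)}])`. -/
def cutoff (β ε : ℝ) : ℕ :=
  max 5 ⌊(ε ^ 2 * Real.log (ε ^ (-5 : ℤ))) ^ (-(1 / (2 * β + 1)))⌋₊

/-- A partition of `{1, …, N}` into `J` consecutive nonempty blocks
`B_j = {κ_j, …, κ_{j+1} - 1}`, `1 ≤ j ≤ J`. -/
structure Blocks (N : ℕ) where
  J : ℕ
  one_le_J : 1 ≤ J
  κ : ℕ → ℕ
  κ_one : κ 1 = 1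
  κ_lt : ∀ j ∈ Finset.Icc 1 J, κ j < κ (j + 1)
  κ_last : κ (J + 1) = N + 1

namespace Blocks

variable {N : ℕ} (B : Blocks N)

/-- The block `B_j`. -/
def block (j : ℕ) : Finset ℕ := Finset.Ico (B.κ j) (B.κ (j + 1))

/-- The length `T_j` of `B_j`. -/
def len (j : ℕ) : ℕ := (B.block j).card

/-- The smallest length of the blocks. -/
def minLen : ℕ := (Finset.Icc 1 B.J).inf' (Finset.nonempty_Icc.2 B.one_le_J) B.len

/-- `σ_j² = ∑_{k ∈ B_j} (2πk)²`. -/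
def sigmaSq (j : ℕ) : ℝ := ∑ k ∈ B.block j, (2 * π * k) ^ 2

/-- The filters with values in `[0, 1]`, supported in `{1, …, N}` and constant on the blocks. -/
def filters : Set (ℕ → ℝ) :=
  {h | (∀ k, h k ∈ Set.Icc (0 : ℝ) 1) ∧ (∀ k ∉ Finset.Icc 1 N, h k = 0) ∧
    ∀ j ∈ Finset.Icc 1 B.J, ∀ k ∈ B.block j, ∀ l ∈ B.block j, h k = h l}

end Blocks

/-! ### The risk functional and the oracle -/

/-- `R^ε[f, h] = ∑_{k ≥ 1} (2πk)² ((1 - h_k)² f_k² + ε² h_k²)` (the term `k = 0` vanishes). -/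
def risk (ε : ℝ) (f : ℝ → ℝ) (h : ℕ → ℝ) : ℝ :=
  ∑' k : ℕ, (2 * π * k) ^ 2 * ((1 - h k) ^ 2 * coef f k ^ 2 + ε ^ 2 * h k ^ 2)

/-- `h` is an oracle filter: it minimizes `R^ε[f, ·]` among the blockwise constant filters. -/
def IsOracle {N : ℕ} (B : Blocks N) (ε : ℝ) (f : ℝ → ℝ) (h : ℕ → ℝ) : Prop :=
  h ∈ B.filters ∧ IsMinOn (risk ε f) B.filters h

/-! ### The penalized blockwise Stein filter -/

/-- `φ_j = √(24 T_j⁻¹ log ε⁻⁵)`. -/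
def penalty {N : ℕ} (B : Blocks N) (ε : ℝ) (j : ℕ) : ℝ :=
  √(24 * (B.len j : ℝ)⁻¹ * Real.log (ε ^ (-5 : ℤ)))

/-- `‖y'‖²_(j) = ∑_{k ∈ B_j} (2πk)² |y_k|²` with `y_k = x_k + i x_k^*`. -/
def energy {N : ℕ} (B : Blocks N) (x : ℝ → ℝ) (j : ℕ) : ℝ :=
  ∑ k ∈ B.block j, (2 * π * k) ^ 2 * (obsCos x k ^ 2 + obsSin x k ^ 2)

/-- The common value on `B_j` of the penalized Stein filter. -/
def steinValue {N : ℕ} (B : Blocks N) (ε : ℝ) (x : ℝ → ℝ) (j : ℕ) : ℝ :=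
  max 0 (1 - ε ^ 2 * B.sigmaSq j * (1 + penalty B ε j) /
    (max 0 (energy B x j - 2 * ε ^ 2 * B.sigmaSq j) + ε ^ 2 * B.sigmaSq j))

/-- The penalized blockwise Stein filter `ĥ^JS`. -/
def steinFilter {N : ℕ} (B : Blocks N) (ε : ℝ) (x : ℝ → ℝ) (k : ℕ) : ℝ :=
  ∑ j ∈ Finset.Icc 1 B.J, if k ∈ B.block j then steinValue B ε x j else 0

/-! ### The estimator -/

/-- The preliminary estimator `(2π)⁻¹ arctan(x_1^* / x_1)`, equal to `1/4` if `x_1 = 0`. -/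
def prelim (x : ℝ → ℝ) : ℝ :=
  if obsCos x 1 = 0 then 1 / 4 else 1 / (2 * π) * Real.arctan (obsSin x 1 / obsCos x 1)

/-- The search interval `[θ̄ - δ, θ̄ + δ]` with `θ̄` the preliminary estimator and
`δ = ε log ε⁻²`. -/
def searchInterval (ε : ℝ) (x : ℝ → ℝ) : Set ℝ :=
  Set.Icc (prelim x - ε * Real.log (ε ^ (-2 : ℤ))) (prelim x + ε * Real.log (ε ^ (-2 : ℤ)))

/-- `τ` is a value of the estimator `θ̂^JS` at the observed path `x`: a maximizer of `Φ(·, ĥ^JS)`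
on the search interval. -/
def IsEstimate {N : ℕ} (B : Blocks N) (ε : ℝ) (x : ℝ → ℝ) (τ : ℝ) : Prop :=
  τ ∈ searchInterval ε x ∧ IsMaxOn (profile N x (steinFilter B ε x)) (searchInterval ε x) τ

end ShiftModel

end

open ShiftModel

/-!
The error of the estimator is governed by a quadratic expansion of the profile likelihood at the
true shift `θ`, and the second-order term in the bound is the price of weighting the frequencies.

*Reduction to a Gaussian sequence.* The observations `x_k`, `x_k^*`, rotated by the angle `2πkθ`,
are `a_k = f_k + ε p_k` and `b_k = ε q_k`, where `p_k`, `q_k` are the integrals of the orthonormal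
trigonometric functions against the Brownian path. These integrals are limits of Riemann sums of
increments, so they are independent standard Gaussian variables (`hasLaw_noiseCoord`). The Stein
weights depend on `a_k² + b_k²` only, and with `u = τ - θ` the profile likelihood is
`½ ∑ g_k (a_k cos 2πku + b_k sin 2πku)²` (`IsSignal.profile_eq_trigProfile`).

*The good event.* Outside of an event of probability `O(ε^{4.1})` (Chernoff bounds,
`measureReal_not_isGood_le`) the noise in the energy of every block is below the penalty. Then the
Stein weight `g_j` of a block with signal `F_j` and noise level `S_j` is so close to the oracle weight
`h_j = F_j / (F_j + S_j)` that all resulting errors are at most a small multiple of the oracle risk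
`R_j = F_j S_j / (F_j + S_j)` of the block (`abs_steinShrink_sub_le`, `IsCloseToOracle`); the penalty
is needed where `F_j` is small compared to `S_j`. On the good event the first-order condition at the
maximizer gives `u² ≤ s² / D² + remainder` with the score `s = ∑ 2πk g_k a_k b_k` and the curvature
`D = ∑ (2πk)² g_k (a_k² - b_k²)` (`IsGood.sq_error_le`).

*The score is conditionally centered.* Everything but `s` is an even function of each `q_k`, and the
term of frequency `k` in `s` is odd in `q_k`. Hence, although the weights depend on the data,
`s²` may be replaced by the sum `V` of the squares of its terms under the expectation
(`integral_mul_sum_sq`, `integral_goodDiv_mul_score_sq_le`). Now `V / D²` is compared with its version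
for the oracle weights, for which `E V = ε² (F - R)` and `D` has mean `F - R`, where `F = ‖f'‖²` and
`R` is the total oracle risk. Expanding `1 / D²` to second order gives
`ε⁻² F E[V / D²] ≤ (1 - R / F) (1 + 2 R / F) + o(R) ≤ 1 + (1 + o(1)) R / F`
(`integral_ratioBound_le`); the correlation of `V` and `D` has the favorable sign.

*Conclusion.* `R` is at most the risk of every blockwise constant filter
(`IsSobolevSignal.oracleRisk_le_risk`), it tends to zero uniformly over the Sobolev class faster than
every power of `1 / log ε⁻¹`, and it is at least of order `ε²`, so that the contribution of the bad
event is absorbed as well (`scaled_error_le`).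
-/


namespace ShiftModel

/-! ### Path integrals of trigonometric functions -/

/-- The cosine coefficient of the path `x` with respect to the origin `θ`,
`√2 ∫ cos(2πk(t - θ)) dx(t)`. -/
noncomputable def rotCos (θ : ℝ) (x : ℝ → ℝ) (k : ℕ) : ℝ :=
  √2 * pathInt (fun t => Real.cos (2 * π * k * (t - θ))) x

/-- The sine coefficient of the path `x` with respect to the origin `θ`,
`√2 ∫ sin(2πk(t - θ)) dx(t)`. -/
noncomputable def rotSin (θ : ℝ) (x : ℝ → ℝ) (k : ℕ) : ℝ :=
  √2 * pathInt (fun t => Real.sin (2 * π * k * (t - θ))) x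

lemma pathInt_add_mul {φ ψ x : ℝ → ℝ} (hφ : ContDiff ℝ 1 φ) (hψ : ContDiff ℝ 1 ψ)
    (hx : Continuous x) (c s : ℝ) :
    pathInt (fun t => c * φ t + s * ψ t) x = c * pathInt φ x + s * pathInt ψ x := by
  have hd : ∀ t, deriv (fun t => c * φ t + s * ψ t) t = c * deriv φ t + s * deriv ψ t := by
    intro t
    have h1 := (hφ.differentiable one_ne_zero t).hasDerivAt
    have h2 := (hψ.differentiable one_ne_zero t).hasDerivAt
    exact ((h1.const_mul c).add (h2.const_mul s)).deriv
  have c1 : Continuous fun t => deriv φ t * x t := (hφ.continuous_deriv le_rfl).mul hx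
  have c2 : Continuous fun t => deriv ψ t * x t := (hψ.continuous_deriv le_rfl).mul hx
  unfold pathInt
  simp only [hd]
  have : ∀ t, (c * deriv φ t + s * deriv ψ t) * x t
      = c * (deriv φ t * x t) + s * (deriv ψ t * x t) := fun t => by ring
  simp only [this]
  rw [intervalIntegral.integral_add ((c1.intervalIntegrable _ _).const_mul _)
    ((c2.intervalIntegrable _ _).const_mul _), intervalIntegral.integral_const_mul,
    intervalIntegral.integral_const_mul]
  ring

lemma pathInt_path_add_mul {φ y z : ℝ → ℝ} (hφ : ContDiff ℝ 1 φ)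
    (hy : Continuous y) (hz : Continuous z) (ε : ℝ) :
    pathInt φ (fun t => y t + ε * z t) = pathInt φ y + ε * pathInt φ z := by
  have c1 : Continuous fun t => deriv φ t * y t := (hφ.continuous_deriv le_rfl).mul hy
  have c2 : Continuous fun t => deriv φ t * z t := (hφ.continuous_deriv le_rfl).mul hz
  unfold pathInt
  have : ∀ t, deriv φ t * (y t + ε * z t)
      = deriv φ t * y t + ε * (deriv φ t * z t) := fun t => by ring
  simp only [this]
  rw [intervalIntegral.integral_add (c1.intervalIntegrable _ _)
    ((c2.intervalIntegrable _ _).const_mul _), intervalIntegral.integral_const_mul]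
  ring

lemma contDiff_cos_freq (k : ℕ) (θ : ℝ) :
    ContDiff ℝ 1 fun t : ℝ => Real.cos (2 * π * k * (t - θ)) := by fun_prop

lemma contDiff_sin_freq (k : ℕ) (θ : ℝ) :
    ContDiff ℝ 1 fun t : ℝ => Real.sin (2 * π * k * (t - θ)) := by fun_prop

lemma pathInt_cos_shift {x : ℝ → ℝ} (hx : Continuous x) (k : ℕ) (θ u : ℝ) :
    √2 * pathInt (fun t => Real.cos (2 * π * k * (t - (θ + u)))) x
      = rotCos θ x k * Real.cos (2 * π * k * u) + rotSin θ x k * Real.sin (2 * π * k * u) := by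
  have : (fun t => Real.cos (2 * π * k * (t - (θ + u))))
      = fun t => Real.cos (2 * π * k * u) * Real.cos (2 * π * k * (t - θ))
        + Real.sin (2 * π * k * u) * Real.sin (2 * π * k * (t - θ)) := by
    funext t
    rw [show 2 * π * k * (t - (θ + u)) = 2 * π * k * (t - θ) - 2 * π * k * u by ring,
      Real.cos_sub]
    ring
  rw [this, pathInt_add_mul (contDiff_cos_freq k θ) (contDiff_sin_freq k θ) hx]
  simp only [rotCos, rotSin]
  ring

lemma obsCos_eq {x : ℝ → ℝ} (hx : Continuous x) (k : ℕ) (θ : ℝ) :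
    obsCos x k = rotCos θ x k * Real.cos (2 * π * k * θ)
      - rotSin θ x k * Real.sin (2 * π * k * θ) := by
  have := pathInt_cos_shift hx k θ (-θ)
  simp only [add_neg_cancel, sub_zero, mul_neg, Real.cos_neg, Real.sin_neg] at this
  rw [obsCos, this]
  ring

lemma obsSin_eq {x : ℝ → ℝ} (hx : Continuous x) (k : ℕ) (θ : ℝ) :
    obsSin x k = rotCos θ x k * Real.sin (2 * π * k * θ)
      + rotSin θ x k * Real.cos (2 * π * k * θ) := by
  have : (fun t => Real.sin (2 * π * k * t))
      = fun t => Real.sin (2 * π * k * θ) * Real.cos (2 * π * k * (t - θ))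
        + Real.cos (2 * π * k * θ) * Real.sin (2 * π * k * (t - θ)) := by
    funext t
    rw [show 2 * π * k * t = 2 * π * k * (t - θ) + 2 * π * k * θ by ring, Real.sin_add]
    ring
  rw [obsSin, this, pathInt_add_mul (contDiff_cos_freq k θ) (contDiff_sin_freq k θ) hx]
  simp only [rotCos, rotSin]
  ring

lemma obsCos_sq_add_obsSin_sq {x : ℝ → ℝ} (hx : Continuous x) (k : ℕ) (θ : ℝ) :
    obsCos x k ^ 2 + obsSin x k ^ 2 = rotCos θ x k ^ 2 + rotSin θ x k ^ 2 := by
  rw [obsCos_eq hx k θ, obsSin_eq hx k θ]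
  have := Real.sin_sq_add_cos_sq (2 * π * k * θ)
  linear_combination (rotCos θ x k ^ 2 + rotSin θ x k ^ 2) * this

/-- The profile in the coordinate `u = τ - θ` and the coefficients with respect to `θ`. -/
lemma profile_eq {x : ℝ → ℝ} (hx : Continuous x) (N : ℕ) (h : ℕ → ℝ) (θ u : ℝ) :
    profile N x h (θ + u) = 1 / 2 * ∑ k ∈ Finset.Icc 1 N, h k *
      (rotCos θ x k * Real.cos (2 * π * k * u) + rotSin θ x k * Real.sin (2 * π * k * u)) ^ 2 := by
  rw [profile, Finset.mul_sum]
  refine Finset.sum_congr rfl fun k _ => ?_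
  rw [← pathInt_cos_shift hx, mul_pow, Real.sq_sqrt (by norm_num)]
  ring

/-! ### The signal part of the observations -/

lemma pathInt_primitive {φ g : ℝ → ℝ} (hφ : ContDiff ℝ 1 φ)
    (hg : IntervalIntegrable g volume (-1 / 2) (1 / 2)) :
    pathInt φ (fun t => ∫ s in (-1 / 2 : ℝ)..t, g s)
      = ∫ t in (-1 / 2 : ℝ)..(1 / 2), φ t * g t := by
  have hφac : AbsolutelyContinuousOnInterval φ (-1 / 2) (1 / 2) :=
    hφ.contDiffOn.absolutelyContinuousOnInterval
  have hGac := hg.absolutelyContinuousOnInterval_intervalIntegral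
    (c := (-1 / 2 : ℝ)) (by simp)
  have hae := hg.ae_hasDerivAt_integral
  have h1 : ∫ t in (-1 / 2 : ℝ)..(1 / 2), φ t * g t
      = ∫ t in (-1 / 2 : ℝ)..(1 / 2), φ t * deriv (fun t => ∫ s in (-1 / 2 : ℝ)..t, g s) t := by
    apply intervalIntegral.integral_congr_ae
    filter_upwards [hae] with t ht hmem
    rw [(ht (Set.uIoc_subset_uIcc hmem) (-1 / 2) (by simp)).deriv]
  rw [h1, hφac.integral_mul_deriv_eq_deriv_mul hGac, pathInt]

variable {ρ : ℝ} {f : ℝ → ℝ}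

lemma IsSignal.locallyIntegrable (hf : IsSignal ρ f) : LocallyIntegrable f volume := by
  rw [locallyIntegrable_iff]
  intro K hK
  have := hf.memLp K hK
  have hfin : IsFiniteMeasure (volume.restrict K) := ⟨by simpa using hK.measure_lt_top⟩
  exact this.integrable (by norm_num)

lemma IsSignal.intervalIntegrable_shift (hf : IsSignal ρ f) (θ a b : ℝ) :
    IntervalIntegrable (fun t => f (t - θ)) volume a b := by
  have := ((hf.locallyIntegrable.integrableOn_isCompact
    (isCompact_uIcc (a := a - θ) (b := b - θ))).intervalIntegrable).comp_sub_right θ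
  simpa using this

lemma IsSignal.continuous_primitive (hf : IsSignal ρ f) (θ : ℝ) :
    Continuous fun t => ∫ s in (-1 / 2 : ℝ)..t, f (s - θ) :=
  intervalIntegral.continuous_primitive (fun a b => hf.intervalIntegrable_shift θ a b) _

lemma integral_periodic_shift {g : ℝ → ℝ} (hg : ∀ x, g (x + 1) = g x) (θ : ℝ) :
    ∫ t in (-1 / 2 : ℝ)..(1 / 2), g (t - θ) = ∫ t in (-1 / 2 : ℝ)..(1 / 2), g t := by
  rw [intervalIntegral.integral_comp_sub_right]
  have h : Function.Periodic g 1 := hg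
  have := h.intervalIntegral_add_eq (-1 / 2 - θ) (-1 / 2)
  rw [show (-1 / 2 - θ + 1 : ℝ) = 1 / 2 - θ by ring, show (-1 / 2 + 1 : ℝ) = 1 / 2 by norm_num]
    at this
  exact this

lemma IsSignal.rotCos_primitive (hf : IsSignal ρ f) (θ : ℝ) (k : ℕ) :
    rotCos θ (fun t => ∫ s in (-1 / 2 : ℝ)..t, f (s - θ)) k = coef f k := by
  rw [rotCos, pathInt_primitive (contDiff_cos_freq k θ) (hf.intervalIntegrable_shift θ _ _), coef]
  congr 1
  refine integral_periodic_shift (g := fun t => Real.cos (2 * π * k * t) * f t) (fun t => ?_) θ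
  rw [hf.periodic, show 2 * π * k * (t + 1) = 2 * π * k * t + k * (2 * π) by ring,
    Real.cos_add_nat_mul_two_pi]

lemma IsSignal.rotSin_primitive (hf : IsSignal ρ f) (θ : ℝ) (k : ℕ) :
    rotSin θ (fun t => ∫ s in (-1 / 2 : ℝ)..t, f (s - θ)) k = 0 := by
  rw [rotSin, pathInt_primitive (contDiff_sin_freq k θ) (hf.intervalIntegrable_shift θ _ _)]
  have h1 := integral_periodic_shift (g := fun t => Real.sin (2 * π * k * t) * f t) (fun t => by
    rw [hf.periodic, show 2 * π * k * (t + 1) = 2 * π * k * t + k * (2 * π) by ring,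
      Real.sin_add_nat_mul_two_pi]) θ
  rw [h1]
  have h2 := intervalIntegral.integral_comp_neg (a := -1 / 2) (b := 1 / 2)
    (fun t => Real.sin (2 * π * k * t) * f t)
  simp only [mul_neg, Real.sin_neg, hf.even, neg_mul, intervalIntegral.integral_neg] at h2
  rw [show (-(-1 / 2) : ℝ) = 1 / 2 by norm_num, show (-(1 / 2) : ℝ) = -1 / 2 by norm_num] at h2
  have h3 : ∫ t in (-1 / 2 : ℝ)..(1 / 2), Real.sin (2 * π * k * t) * f t = 0 := by linarith
  rw [h3, mul_zero]

section Observation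

variable {ε θ : ℝ} {b : ℝ≥0 → ℝ}

/-- The driving noise on `[-1/2, 1/2]` of a path `b` indexed by `[0, ∞)`. -/
noncomputable def noisePath (b : ℝ≥0 → ℝ) (t : ℝ) : ℝ := b (t + 1 / 2).toNNReal

lemma continuous_noisePath (hb : Continuous b) : Continuous (noisePath b) :=
  hb.comp (by fun_prop)

lemma IsSignal.continuous_obsPath (hf : IsSignal ρ f) (hb : Continuous b) :
    Continuous (obsPath ε θ f b) :=
  (hf.continuous_primitive θ).add (continuous_const.mul (continuous_noisePath hb))

lemma IsSignal.rotCos_obsPath (hf : IsSignal ρ f) (hb : Continuous b) (k : ℕ) :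
    rotCos θ (obsPath ε θ f b) k = coef f k + ε * rotCos θ (noisePath b) k := by
  rw [← hf.rotCos_primitive θ k]
  have := pathInt_path_add_mul (contDiff_cos_freq k θ) (hf.continuous_primitive θ)
    (continuous_noisePath hb) ε
  simp only [rotCos]
  rw [show obsPath ε θ f b = fun t => (∫ s in (-1 / 2 : ℝ)..t, f (s - θ)) + ε * noisePath b t
    from rfl, this]
  ring

lemma IsSignal.rotSin_obsPath (hf : IsSignal ρ f) (hb : Continuous b) (k : ℕ) :
    rotSin θ (obsPath ε θ f b) k = ε * rotSin θ (noisePath b) k := by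
  have h0 := hf.rotSin_primitive θ k
  have := pathInt_path_add_mul (contDiff_sin_freq k θ) (hf.continuous_primitive θ)
    (continuous_noisePath hb) ε
  simp only [rotSin] at h0 ⊢
  rw [show obsPath ε θ f b = fun t => (∫ s in (-1 / 2 : ℝ)..t, f (s - θ)) + ε * noisePath b t
    from rfl, this, mul_add, h0]
  ring

end Observation

end ShiftModel


namespace ShiftModel

/-! ### The law of Wiener integrals -/

/-- The `i`-th point of the partition of `[-1/2, 1/2]` into `n` intervals of equal length. -/
noncomputable def gridPt (n i : ℕ) : ℝ := -1 / 2 + i / n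

lemma gridPt_le_succ (n i : ℕ) : gridPt n i ≤ gridPt n (i + 1) := by
  unfold gridPt; gcongr; simp

lemma gridPt_succ_sub (n i : ℕ) : gridPt n (i + 1) - gridPt n i = 1 / n := by
  unfold gridPt; push_cast; ring

lemma gridPt_zero (n : ℕ) : gridPt n 0 = -1 / 2 := by simp [gridPt]

lemma gridPt_self {n : ℕ} (hn : n ≠ 0) : gridPt n n = 1 / 2 := by
  have : (n : ℝ) ≠ 0 := by exact_mod_cast hn
  rw [gridPt, div_self this]; norm_num

lemma gridPt_mem {n i : ℕ} (hn : n ≠ 0) (hi : i ≤ n) :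
    gridPt n i ∈ Set.Icc (-1 / 2 : ℝ) (1 / 2) := by
  have h0 : (0 : ℝ) < n := by exact_mod_cast Nat.pos_of_ne_zero hn
  have h1 : (i : ℝ) / n ≤ 1 := by
    rw [div_le_one h0]; exact_mod_cast hi
  have h2 : (0 : ℝ) ≤ (i : ℝ) / n := by positivity
  unfold gridPt
  constructor <;> linarith

/-- Convergence of Riemann sums of `∫ g m` with weights `∫ m` over the cells of the grid. -/
lemma tendsto_riemann_sum {m g : ℝ → ℝ} (hm : Continuous m) (hg : Continuous g)
    {ξ : ℕ → ℕ → ℝ} (hξ : ∀ n i, ξ n i ∈ Set.Icc (gridPt n i) (gridPt n (i + 1))) :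
    Tendsto (fun n => ∑ i ∈ Finset.range n,
        g (ξ n i) * ∫ t in gridPt n i..gridPt n (i + 1), m t) atTop
      (𝓝 (∫ t in (-1 / 2 : ℝ)..(1 / 2), m t * g t)) := by
  obtain ⟨M, hM⟩ := (isCompact_Icc (a := (-1 / 2 : ℝ)) (b := 1 / 2)).exists_bound_of_continuousOn
    hm.continuousOn
  have hM0 : 0 ≤ M := (norm_nonneg _).trans (hM 0 (by norm_num))
  have huc := (isCompact_Icc (a := (-1 / 2 : ℝ)) (b := 1 / 2)).uniformContinuousOn_of_continuous
    hg.continuousOn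
  rw [Metric.tendsto_atTop]
  intro e he
  rw [Metric.uniformContinuousOn_iff] at huc
  obtain ⟨d, hd, H⟩ := huc (e / (2 * (M + 1))) (by positivity)
  obtain ⟨n₀, hn₀⟩ := exists_nat_gt (1 / d)
  refine ⟨n₀ + 1, fun n hn => ?_⟩
  have hn0 : n ≠ 0 := by omega
  have hnpos : (0 : ℝ) < n := by exact_mod_cast Nat.pos_of_ne_zero hn0
  have hnd : 1 / (n : ℝ) < d := by
    rw [div_lt_comm₀ hnpos hd]
    exact hn₀.trans (by exact_mod_cast hn)
  have hint : ∀ k, IntervalIntegrable (fun t => m t * g t) volume (gridPt n k)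
      (gridPt n (k + 1)) := fun k => (hm.mul hg).intervalIntegrable _ _
  have hsum := intervalIntegral.sum_integral_adjacent_intervals (n := n) (a := gridPt n)
    (fun k _ => hint k)
  rw [gridPt_zero, gridPt_self hn0] at hsum
  rw [Real.dist_eq, ← hsum, ← Finset.sum_sub_distrib]
  have key : ∀ i ∈ Finset.range n, |g (ξ n i) * (∫ t in gridPt n i..gridPt n (i + 1), m t)
      - ∫ t in gridPt n i..gridPt n (i + 1), m t * g t| ≤ (M * (e / (2 * (M + 1)))) * (1 / n) := by
    intro i hi
    have hi' : i < n := Finset.mem_range.1 hi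
    rw [← intervalIntegral.integral_const_mul, ← intervalIntegral.integral_sub
      ((hm.intervalIntegrable _ _).const_mul _) (hint i)]
    have := intervalIntegral.norm_integral_le_of_norm_le_const (a := gridPt n i)
      (b := gridPt n (i + 1)) (f := fun t => g (ξ n i) * m t - m t * g t)
      (C := M * (e / (2 * (M + 1)))) ?_
    · rwa [gridPt_succ_sub, abs_of_nonneg (by positivity : (0 : ℝ) ≤ 1 / n)] at this
    · intro t ht
      rw [Set.uIoc_of_le (gridPt_le_succ n i)] at ht
      have h1 := gridPt_mem hn0 hi'.le
      have h2 := gridPt_mem hn0 (Nat.succ_le_of_lt hi')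
      have hs := gridPt_succ_sub n i
      have htm : t ∈ Set.Icc (-1 / 2 : ℝ) (1 / 2) := ⟨h1.1.trans ht.1.le, ht.2.trans h2.2⟩
      have hxm : ξ n i ∈ Set.Icc (-1 / 2 : ℝ) (1 / 2) :=
        ⟨h1.1.trans (hξ n i).1, (hξ n i).2.trans h2.2⟩
      have hdist : dist (ξ n i) t < d := by
        rw [Real.dist_eq, abs_lt]
        have := hξ n i
        constructor <;> linarith [this.1, this.2, ht.1, ht.2]
      have h3 := H _ hxm _ htm hdist
      rw [show g (ξ n i) * m t - m t * g t = m t * (g (ξ n i) - g t) by ring, norm_mul]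
      rw [Real.dist_eq] at h3
      exact mul_le_mul (hM t htm) h3.le (norm_nonneg _) hM0
  calc |∑ i ∈ Finset.range n, (g (ξ n i) * (∫ t in gridPt n i..gridPt n (i + 1), m t)
          - ∫ t in gridPt n i..gridPt n (i + 1), m t * g t)|
      ≤ ∑ i ∈ Finset.range n, (M * (e / (2 * (M + 1)))) * (1 / n) :=
        (Finset.abs_sum_le_sum_abs _ _).trans (Finset.sum_le_sum key)
    _ = M * (e / (2 * (M + 1))) := by
        rw [Finset.sum_const, Finset.card_range, nsmul_eq_mul]; field_simp
    _ < e := by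
        rw [← mul_div_assoc, div_lt_iff₀ (by positivity)]
        nlinarith

/-- The elementary Wiener sum `∑ φ(t_i) (y(t_{i+1}) - y(t_i))` along the uniform grid. -/
noncomputable def wienerSum (φ y : ℝ → ℝ) (n : ℕ) : ℝ :=
  ∑ i ∈ Finset.range n, φ (gridPt n i) * (y (gridPt n (i + 1)) - y (gridPt n i))

lemma tendsto_wienerSum {φ y : ℝ → ℝ} (hφ : ContDiff ℝ 1 φ) (hy : Continuous y) :
    Tendsto (wienerSum φ y) atTop (𝓝 (pathInt φ y)) := by
  have hc := hφ.continuous_deriv le_rfl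
  have h := (tendsto_riemann_sum hc hy (ξ := fun n i => gridPt n (i + 1))
    (fun n i => ⟨gridPt_le_succ n i, le_rfl⟩)).const_sub
      (φ (1 / 2) * y (1 / 2) - φ (-1 / 2) * y (-1 / 2))
  refine h.congr' ?_
  filter_upwards [eventually_ne_atTop 0] with n hn
  have h1 : ∀ i, ∫ t in gridPt n i..gridPt n (i + 1), deriv φ t
      = φ (gridPt n (i + 1)) - φ (gridPt n i) := fun i =>
    intervalIntegral.integral_deriv_eq_sub (fun t _ => hφ.differentiable one_ne_zero t)
      (hc.intervalIntegrable _ _)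
  simp only [h1, wienerSum]
  have h2 := Finset.sum_range_sub (fun i => φ (gridPt n i) * y (gridPt n i)) n
  rw [gridPt_zero, gridPt_self hn] at h2
  rw [← h2, ← Finset.sum_sub_distrib]
  exact Finset.sum_congr rfl fun i _ => by ring

section Brownian

variable {Ω : Type*} [MeasurableSpace Ω] {P : Measure Ω} {W : ℝ≥0 → Ω → ℝ}

lemma noisePath_gridPt (b : ℝ≥0 → ℝ) (n i : ℕ) :
    noisePath b (gridPt n i) = b ((i : ℝ≥0) / n) := by
  unfold noisePath gridPt
  congr 1
  rw [show (-1 / 2 + (i : ℝ) / n + 1 / 2) = (((i : ℝ≥0) / n : ℝ≥0) : ℝ) by push_cast; ring,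
    Real.toNNReal_coe]

lemma aemeasurable_wienerSum (hW : IsBrownianReal W P) (φ : ℝ → ℝ) (n : ℕ) :
    AEMeasurable (fun ω => wienerSum φ (noisePath (W · ω)) n) P := by
  simp only [wienerSum, noisePath_gridPt]
  refine Finset.aemeasurable_fun_sum _ fun i _ => ?_
  exact ((hW.toIsPreBrownianReal.aemeasurable _).sub
    (hW.toIsPreBrownianReal.aemeasurable _)).const_mul _

lemma charFun_wienerSum (hW : IsBrownianReal W P) (φ : ℝ → ℝ) {n : ℕ} (hn : n ≠ 0) (t : ℝ) :
    charFun (P.map fun ω => wienerSum φ (noisePath (W · ω)) n) t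
      = Complex.exp (-((∑ i ∈ Finset.range n, φ (gridPt n i) ^ 2 * (1 / n) : ℝ) : ℂ)
        * t ^ 2 / 2) := by
  have hpre := hW.toIsPreBrownianReal
  have hmono : Monotone fun i : ℕ => (i : ℝ≥0) / n := fun i j hij => by
    simp only; gcongr
  have hind := (hpre.hasIndepIncrements.nat hmono).comp (fun i x => φ (gridPt n i) * x)
    (fun i => by fun_prop)
  simp only [wienerSum, noisePath_gridPt]
  have hmeas : ∀ i ∈ Finset.range n, AEMeasurable (fun ω =>
      φ (gridPt n i) * (W (((i + 1 : ℕ) : ℝ≥0) / n) ω - W ((i : ℝ≥0) / n) ω)) P := fun i _ =>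
    ((hpre.aemeasurable _).sub (hpre.aemeasurable _)).const_mul _
  rw [iIndepFun.charFun_map_fun_finsetSum_eq_prod hmeas (hind.restrict _), Finset.prod_apply]
  have hlaw : ∀ i, charFun (P.map fun ω =>
      φ (gridPt n i) * (W (((i + 1 : ℕ) : ℝ≥0) / n) ω - W ((i : ℝ≥0) / n) ω)) t
      = Complex.exp (-((φ (gridPt n i) ^ 2 * (1 / n) : ℝ) : ℂ) * t ^ 2 / 2) := by
    intro i
    have h := gaussianReal_const_mul
      (hpre.hasLaw_sub (((i + 1 : ℕ) : ℝ≥0) / n) ((i : ℝ≥0) / n)) (φ (gridPt n i))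
    obtain ⟨v, hv⟩ : ∃ v, nndist (((i + 1 : ℕ) : ℝ≥0) / n : ℝ≥0).1 ((i : ℝ≥0) / n : ℝ≥0).1 = v :=
      ⟨_, rfl⟩
    rw [hv] at h
    have hd : (v : ℝ) = 1 / n := by
      rw [← hv, coe_nndist, Real.dist_eq]
      have e1 : (((i + 1 : ℕ) : ℝ≥0) / n : ℝ≥0).1 = ((i : ℝ) + 1) / n := by
        rw [NNReal.val_eq_coe]; push_cast; ring
      have e2 : ((i : ℝ≥0) / n : ℝ≥0).1 = (i : ℝ) / n := by
        rw [NNReal.val_eq_coe]; push_cast; ring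
      rw [e1, e2, show ((i : ℝ) + 1) / n - i / n = 1 / n by ring, abs_of_nonneg (by positivity)]
    have hd' : (v : ℂ) = 1 / n := by
      have := congrArg (fun r : ℝ => (r : ℂ)) hd
      push_cast at this
      exact this
    have h' : P.map (fun ω => φ (gridPt n i) *
        (W (((i + 1 : ℕ) : ℝ≥0) / n) ω - W ((i : ℝ≥0) / n) ω)) = _ := h.map_eq
    rw [h', charFun_gaussianReal]
    congr 1
    simp [hd']
    ring
  simp only [hlaw]
  rw [← Complex.exp_sum]
  congr 1
  push_cast
  rw [← Finset.sum_neg_distrib, Finset.sum_mul, Finset.sum_div]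

lemma ae_tendsto_wienerSum (hW : IsBrownianReal W P) {φ : ℝ → ℝ} (hφ : ContDiff ℝ 1 φ) :
    ∀ᵐ ω ∂P, Tendsto (fun n => wienerSum φ (noisePath (W · ω)) n) atTop
      (𝓝 (pathInt φ (noisePath (W · ω)))) := by
  filter_upwards [hW.cont] with ω hω
  exact tendsto_wienerSum hφ (continuous_noisePath hω)

lemma aemeasurable_pathInt (hW : IsBrownianReal W P) {φ : ℝ → ℝ} (hφ : ContDiff ℝ 1 φ) :
    AEMeasurable (fun ω => pathInt φ (noisePath (W · ω))) P :=
  aemeasurable_of_tendsto_metrizable_ae atTop (aemeasurable_wienerSum hW φ)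
    (ae_tendsto_wienerSum hW hφ)

lemma charFun_pathInt [IsProbabilityMeasure P] (hW : IsBrownianReal W P) {φ : ℝ → ℝ}
    (hφ : ContDiff ℝ 1 φ) (t : ℝ) :
    charFun (P.map fun ω => pathInt φ (noisePath (W · ω))) t
      = Complex.exp (-((∫ s in (-1 / 2 : ℝ)..(1 / 2), φ s ^ 2 : ℝ) : ℂ) * t ^ 2 / 2) := by
  have hrs := tendsto_riemann_sum (m := fun _ => 1) (g := fun s => φ s ^ 2) continuous_const
    (hφ.continuous.pow 2) (ξ := gridPt) (fun n i => ⟨le_rfl, gridPt_le_succ n i⟩)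
  simp only [intervalIntegral.integral_const, gridPt_succ_sub, smul_eq_mul, mul_one, one_mul]
    at hrs
  have hlim1 : Tendsto (fun n => charFun (P.map fun ω => wienerSum φ (noisePath (W · ω)) n) t)
      atTop (𝓝 (Complex.exp (-((∫ s in (-1 / 2 : ℝ)..(1 / 2), φ s ^ 2 : ℝ) : ℂ) * t ^ 2 / 2))) := by
    have h1 : Tendsto (fun n => Complex.exp
        (-((∑ i ∈ Finset.range n, φ (gridPt n i) ^ 2 * (1 / n) : ℝ) : ℂ) * t ^ 2 / 2)) atTop
        (𝓝 (Complex.exp (-((∫ s in (-1 / 2 : ℝ)..(1 / 2), φ s ^ 2 : ℝ) : ℂ) * t ^ 2 / 2))) := by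
      refine (Complex.continuous_exp.tendsto _).comp ?_
      exact ((((Complex.continuous_ofReal.tendsto _).comp hrs).neg).mul_const _).div_const _
    refine h1.congr' ?_
    filter_upwards [eventually_ne_atTop 0] with n hn
    rw [charFun_wienerSum hW φ hn]
  have hlim2 : Tendsto (fun n => charFun (P.map fun ω => wienerSum φ (noisePath (W · ω)) n) t)
      atTop (𝓝 (charFun (P.map fun ω => pathInt φ (noisePath (W · ω))) t)) := by
    have hmap : ∀ X : Ω → ℝ, AEMeasurable X P →
        charFun (P.map X) t = ∫ ω, Complex.exp (t * X ω * Complex.I) ∂P := by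
      intro X hX
      rw [charFun_apply_real, integral_map hX]
      exact (by fun_prop : Continuous fun x : ℝ => Complex.exp (t * x * Complex.I))
        |>.aestronglyMeasurable
    rw [hmap _ (aemeasurable_pathInt hW hφ)]
    simp only [hmap _ (aemeasurable_wienerSum hW φ _)]
    refine tendsto_integral_of_dominated_convergence (fun _ => 1) (fun n => ?_)
      (integrable_const _) (fun n => ?_) ?_
    · exact (by fun_prop : Continuous fun x : ℝ => Complex.exp (t * x * Complex.I))
        |>.measurable.comp_aemeasurable (aemeasurable_wienerSum hW φ n) |>.aestronglyMeasurable
    · refine Eventually.of_forall fun ω => ?_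
      have : (t : ℂ) * (wienerSum φ (noisePath (W · ω)) n : ℝ) * Complex.I
          = ((t * wienerSum φ (noisePath (W · ω)) n : ℝ) : ℂ) * Complex.I := by push_cast; ring
      rw [this, Complex.norm_exp_ofReal_mul_I]
    · filter_upwards [ae_tendsto_wienerSum hW hφ] with ω hω
      have hc : Continuous fun x : ℝ => Complex.exp (t * x * Complex.I) := by fun_prop
      exact (hc.tendsto _).comp hω
  exact tendsto_nhds_unique hlim2 hlim1

/-- The Wiener integral of `φ` is centred Gaussian with variance `∫ φ²`. -/
lemma hasLaw_pathInt [IsProbabilityMeasure P] (hW : IsBrownianReal W P) {φ : ℝ → ℝ}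
    (hφ : ContDiff ℝ 1 φ) {v : ℝ≥0} (hv : ∫ s in (-1 / 2 : ℝ)..(1 / 2), φ s ^ 2 = v) :
    HasLaw (fun ω => pathInt φ (noisePath (W · ω))) (gaussianReal 0 v) P where
  aemeasurable := aemeasurable_pathInt hW hφ
  map_eq := by
    have := Measure.isProbabilityMeasure_map (aemeasurable_pathInt hW hφ)
    refine Measure.ext_of_charFun (funext fun t => ?_)
    rw [charFun_pathInt hW hφ, charFun_gaussianReal, hv]
    congr 1
    push_cast
    ring

lemma pathInt_sum {ι : Type*} (s : Finset ι) {φ : ι → ℝ → ℝ} (hφ : ∀ i, ContDiff ℝ 1 (φ i))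
    {x : ℝ → ℝ} (hx : Continuous x) (c : ι → ℝ) :
    pathInt (fun t => ∑ i ∈ s, c i * φ i t) x = ∑ i ∈ s, c i * pathInt (φ i) x := by
  classical
  induction s using Finset.induction with
  | empty => simp [pathInt]
  | insert a s ha ih =>
    have h := pathInt_add_mul (hφ a) (ψ := fun t => ∑ i ∈ s, c i * φ i t)
      (ContDiff.sum fun i _ => contDiff_const.mul (hφ i)) hx (c a) 1
    simp only [one_mul] at h
    simp only [Finset.sum_insert ha, h, ih]

/-- Wiener integrals of orthogonal functions are independent. -/
lemma iIndepFun_pathInt [IsProbabilityMeasure P] (hW : IsBrownianReal W P) {ι : Type*}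
    {φ : ι → ℝ → ℝ} (hφ : ∀ i, ContDiff ℝ 1 (φ i))
    (horth : ∀ i j, i ≠ j → ∫ s in (-1 / 2 : ℝ)..(1 / 2), φ i s * φ j s = 0) :
    iIndepFun (fun i ω => pathInt (φ i) (noisePath (W · ω))) P := by
  rw [iIndepFun_iff_finset]
  intro s
  have hmeas : ∀ i : s, AEMeasurable (s.restrict
      (fun i ω => pathInt (φ i) (noisePath (W · ω))) i) P := fun i => aemeasurable_pathInt hW (hφ i)
  rw [iIndepFun_iff_charFun_pi hmeas]
  intro t
  have hΦ : ContDiff ℝ 1 (fun r => ∑ i : s, t i * φ i r) :=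
    ContDiff.sum fun i _ => contDiff_const.mul (hφ i)
  have h1 : charFun (P.map (fun ω => WithLp.toLp 2 fun i : s =>
        s.restrict (fun i ω => pathInt (φ i) (noisePath (W · ω))) i ω)) t
      = charFun (P.map fun ω =>
          pathInt (fun r => ∑ i : s, t i * φ i r) (noisePath (W · ω))) 1 := by
    rw [charFun_apply, charFun_apply, integral_map, integral_map (aemeasurable_pathInt hW hΦ)]
    · refine integral_congr_ae ?_
      filter_upwards [hW.cont] with ω hω
      rw [pathInt_sum Finset.univ (fun i : s => hφ i) (continuous_noisePath hω)]
      congr 2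
      simp [PiLp.inner_apply]
    · exact (by fun_prop : Continuous fun x : ℝ => Complex.exp ((inner ℝ x 1 : ℝ) * Complex.I))
        |>.aestronglyMeasurable
    · exact (WithLp.measurable_toLp 2 _).comp_aemeasurable (aemeasurable_pi_lambda _ hmeas)
    · exact (by fun_prop : Continuous fun x : EuclideanSpace ℝ s =>
        Complex.exp ((inner ℝ x t : ℝ) * Complex.I)) |>.aestronglyMeasurable
  rw [h1, charFun_pathInt hW hΦ]
  have h2 : ∀ i : s, charFun (P.map (s.restrict
      (fun i ω => pathInt (φ i) (noisePath (W · ω))) i)) (t i)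
      = Complex.exp (-((∫ r in (-1 / 2 : ℝ)..(1 / 2), φ i r ^ 2 : ℝ) : ℂ) * (t i) ^ 2 / 2) :=
    fun i => charFun_pathInt hW (hφ i) (t i)
  simp only [h2]
  rw [← Complex.exp_sum]
  congr 1
  have h3 : ∫ r in (-1 / 2 : ℝ)..(1 / 2), (∑ i : s, t i * φ i r) ^ 2
      = ∑ i : s, (∫ r in (-1 / 2 : ℝ)..(1 / 2), φ i r ^ 2) * t i ^ 2 := by
    have hexp : ∀ r, (∑ i : s, t i * φ i r) ^ 2
        = ∑ i : s, ∑ j : s, t i * t j * (φ i r * φ j r) := by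
      intro r
      rw [sq, Finset.sum_mul_sum]
      exact Finset.sum_congr rfl fun i _ => Finset.sum_congr rfl fun j _ => by ring
    have hci : ∀ i j : s, IntervalIntegrable (fun r => t i * t j * (φ i r * φ j r)) volume
        (-1 / 2) (1 / 2) := fun i j =>
      (continuous_const.mul ((hφ i).continuous.mul (hφ j).continuous)).intervalIntegrable _ _
    simp only [hexp]
    rw [intervalIntegral.integral_finsetSum fun i _ =>
      Continuous.intervalIntegrable (u := fun r => ∑ j : s, t i * t j * (φ i r * φ j r))
        (continuous_finsetSum _ fun j _ => continuous_const.mul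
          ((hφ i).continuous.mul (hφ j).continuous)) _ _]
    refine Finset.sum_congr rfl fun i _ => ?_
    rw [intervalIntegral.integral_finsetSum fun j _ => hci i j, Finset.sum_eq_single i]
    · rw [intervalIntegral.integral_const_mul, mul_comm]
      simp only [sq]
    · intro j _ hj
      rw [intervalIntegral.integral_const_mul,
        horth i j (fun h => hj (Subtype.ext h).symm), mul_zero]
    · simp
  rw [h3]
  push_cast
  rw [← Finset.sum_neg_distrib, Finset.sum_mul, Finset.sum_div]
  exact Finset.sum_congr rfl fun i _ => by ring

end Brownian

end ShiftModel


namespace ShiftModel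

/-! ### The Gaussian sequence of trigonometric Wiener integrals -/

lemma integral_cos_two_pi_int (m : ℤ) :
    ∫ t in (-1 / 2 : ℝ)..(1 / 2), Real.cos (2 * π * m * t) = if m = 0 then 1 else 0 := by
  split_ifs with h
  · subst h; norm_num
  · have hm : (2 * π * m : ℝ) ≠ 0 := by
      have : (m : ℝ) ≠ 0 := by exact_mod_cast h
      positivity
    rw [intervalIntegral.integral_comp_mul_left (fun x => Real.cos x) hm, integral_cos]
    have h1 : Real.sin (2 * π * m * (1 / 2)) = 0 := by
      rw [show 2 * π * m * (1 / 2) = m * π by ring]; exact Real.sin_int_mul_pi m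
    have h2 : Real.sin (2 * π * m * (-1 / 2)) = 0 := by
      rw [show 2 * π * m * (-1 / 2) = -(m * π) by ring, Real.sin_neg, Real.sin_int_mul_pi, neg_zero]
    rw [h1, h2]; simp

lemma integral_odd_eq_zero {g : ℝ → ℝ} (hg : ∀ t, g (-t) = -g t) :
    ∫ t in (-1 / 2 : ℝ)..(1 / 2), g t = 0 := by
  have h2 := intervalIntegral.integral_comp_neg (a := -1 / 2) (b := 1 / 2) g
  simp only [hg, intervalIntegral.integral_neg] at h2
  rw [show (-(-1 / 2) : ℝ) = 1 / 2 by norm_num, show (-(1 / 2) : ℝ) = -1 / 2 by norm_num] at h2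
  linarith

/-- The orthonormal trigonometric functions with origin `θ`: the cosine of frequency `k` at the
index `(k, true)`, the sine at `(k, false)`, and `0` at frequency `0`. -/
noncomputable def trigFun (θ : ℝ) (i : ℕ × Bool) (t : ℝ) : ℝ :=
  if i.1 = 0 then 0 else
    if i.2 then √2 * Real.cos (2 * π * i.1 * (t - θ)) else √2 * Real.sin (2 * π * i.1 * (t - θ))

lemma contDiff_trigFun (θ : ℝ) (i : ℕ × Bool) : ContDiff ℝ 1 (trigFun θ i) := by
  obtain ⟨k, b⟩ := i
  unfold trigFun
  by_cases hk : k = 0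
  · simp only [hk, if_true]; exact contDiff_const
  · cases b
    · simp only [hk, if_false, Bool.false_eq_true]; fun_prop
    · simp only [hk, if_false, if_true]; fun_prop

lemma integral_trigFun_mul (θ : ℝ) (i j : ℕ × Bool) :
    ∫ t in (-1 / 2 : ℝ)..(1 / 2), trigFun θ i t * trigFun θ j t
      = if i = j ∧ i.1 ≠ 0 then 1 else 0 := by
  have hs : (√2 : ℝ) * √2 = 2 := Real.mul_self_sqrt (by norm_num)
  have hshift : ∫ t in (-1 / 2 : ℝ)..(1 / 2), trigFun θ i t * trigFun θ j t
      = ∫ t in (-1 / 2 : ℝ)..(1 / 2), trigFun 0 i t * trigFun 0 j t := by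
    have hper : ∀ (i : ℕ × Bool) t, trigFun 0 i (t + 1) = trigFun 0 i t := by
      intro i t
      unfold trigFun
      rw [show 2 * π * i.1 * (t + 1 - 0) = 2 * π * i.1 * (t - 0) + i.1 * (2 * π) by ring,
        Real.cos_add_nat_mul_two_pi, Real.sin_add_nat_mul_two_pi]
    have := integral_periodic_shift (g := fun t => trigFun 0 i t * trigFun 0 j t)
      (fun t => by rw [hper, hper]) θ
    rw [← this]
    simp only [trigFun, sub_zero]
  rw [hshift]
  have hci : ∀ m : ℤ, IntervalIntegrable (fun t : ℝ => Real.cos (2 * π * m * t)) volume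
      (-1 / 2) (1 / 2) := fun m => (by fun_prop : Continuous _).intervalIntegrable _ _
  obtain ⟨k, a⟩ := i
  obtain ⟨l, b⟩ := j
  by_cases hk : k = 0
  · simp [trigFun, hk]
  by_cases hl : l = 0
  · simp +contextual [trigFun, hl]
  have hkl : ((k : ℤ) + l = 0) ↔ False := by simp only [iff_false]; omega
  have hkl' : ((k : ℤ) - l = 0) ↔ k = l := by omega
  cases a <;> cases b
  · have : ∀ t : ℝ, trigFun 0 (k, false) t * trigFun 0 (l, false) t
        = Real.cos (2 * π * ((k - l : ℤ) : ℝ) * t) - Real.cos (2 * π * ((k + l : ℤ) : ℝ) * t) := by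
      intro t
      simp only [trigFun, hk, hl, if_false, Bool.false_eq_true, sub_zero]
      push_cast
      rw [show 2 * π * ((k : ℝ) - l) * t = 2 * π * k * t - 2 * π * l * t by ring,
        show 2 * π * ((k : ℝ) + l) * t = 2 * π * k * t + 2 * π * l * t by ring,
        Real.cos_add, Real.cos_sub]
      linear_combination (Real.sin (2 * π * k * t) * Real.sin (2 * π * l * t)) * hs
    simp only [this]
    rw [intervalIntegral.integral_sub (hci _) (hci _), integral_cos_two_pi_int,
      integral_cos_two_pi_int]
    simp [hkl, hkl', hk]
  · rw [integral_odd_eq_zero]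
    · simp
    · intro t
      simp only [trigFun, hk, hl, if_false, Bool.false_eq_true, if_true, sub_zero, mul_neg,
        Real.sin_neg, Real.cos_neg, neg_mul]
  · rw [integral_odd_eq_zero]
    · simp
    · intro t
      simp only [trigFun, hk, hl, if_false, Bool.false_eq_true, if_true, sub_zero, mul_neg,
        Real.sin_neg, Real.cos_neg]
  · have : ∀ t : ℝ, trigFun 0 (k, true) t * trigFun 0 (l, true) t
        = Real.cos (2 * π * ((k - l : ℤ) : ℝ) * t) + Real.cos (2 * π * ((k + l : ℤ) : ℝ) * t) := by
      intro t
      simp only [trigFun, hk, hl, if_false, if_true, sub_zero]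
      push_cast
      rw [show 2 * π * ((k : ℝ) - l) * t = 2 * π * k * t - 2 * π * l * t by ring,
        show 2 * π * ((k : ℝ) + l) * t = 2 * π * k * t + 2 * π * l * t by ring,
        Real.cos_add, Real.cos_sub]
      linear_combination (Real.cos (2 * π * k * t) * Real.cos (2 * π * l * t)) * hs
    simp only [this]
    rw [intervalIntegral.integral_add (hci _) (hci _), integral_cos_two_pi_int,
      integral_cos_two_pi_int]
    simp [hkl, hkl', hk]

/-- The law of the noise coordinates: independent standard Gaussian variables at all frequencies
`k ≥ 1`, and `0` at frequency `0`. The index `(k, true)` is a cosine, `(k, false)` a sine. -/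
noncomputable def noiseLaw : Measure (ℕ × Bool → ℝ) :=
  Measure.infinitePi fun i : ℕ × Bool => gaussianReal 0 (if i.1 = 0 then 0 else 1)

instance : IsProbabilityMeasure noiseLaw := by unfold noiseLaw; infer_instance

/-- The noise coordinates of the path `b` with respect to the origin `θ`. -/
noncomputable def noiseCoord (θ : ℝ) (b : ℝ≥0 → ℝ) (i : ℕ × Bool) : ℝ :=
  pathInt (trigFun θ i) (noisePath b)

lemma noiseCoord_true {θ : ℝ} {b : ℝ≥0 → ℝ} (hb : Continuous b) {k : ℕ} (hk : k ≠ 0) :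
    noiseCoord θ b (k, true) = rotCos θ (noisePath b) k := by
  have h := pathInt_add_mul (contDiff_cos_freq k θ) (contDiff_sin_freq k θ)
    (continuous_noisePath hb) (√2) 0
  simp only [zero_mul, add_zero] at h
  rw [rotCos, ← h, noiseCoord]
  congr 1
  funext t
  simp [trigFun, hk]

lemma noiseCoord_false {θ : ℝ} {b : ℝ≥0 → ℝ} (hb : Continuous b) {k : ℕ} (hk : k ≠ 0) :
    noiseCoord θ b (k, false) = rotSin θ (noisePath b) k := by
  have h := pathInt_add_mul (contDiff_cos_freq k θ) (contDiff_sin_freq k θ)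
    (continuous_noisePath hb) 0 (√2)
  simp only [zero_mul, zero_add] at h
  rw [rotSin, ← h, noiseCoord]
  congr 1
  funext t
  simp [trigFun, hk]

lemma hasLaw_noiseCoord {Ω : Type*} [MeasurableSpace Ω] {P : Measure Ω} [IsProbabilityMeasure P]
    {W : ℝ≥0 → Ω → ℝ} (hW : IsBrownianReal W P) (θ : ℝ) :
    HasLaw (fun ω => noiseCoord θ (W · ω)) noiseLaw P := by
  have hind := iIndepFun_pathInt hW (contDiff_trigFun θ) (fun i j hij => by
    rw [integral_trigFun_mul]; simp [hij])
  refine hind.hasLaw_infinitePi (fun i => hasLaw_pathInt hW (contDiff_trigFun θ i) ?_)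
    (aemeasurable_pi_lambda _ fun i => aemeasurable_pathInt hW (contDiff_trigFun θ i))
  simp only [sq, integral_trigFun_mul]
  by_cases hi : i.1 = 0 <;> simp [hi]

end ShiftModel


namespace ShiftModel

/-! ### Functions with finite moments of all orders -/

/-- A measurable function all of whose absolute moments are finite. -/
def HasMoments {X : Type*} [MeasurableSpace X] (μ : Measure X) (g : X → ℝ) : Prop :=
  Measurable g ∧ ∀ n : ℕ, Integrable (fun x => |g x| ^ n) μ

namespace HasMoments

variable {X : Type*} [MeasurableSpace X] {μ : Measure X} {g h : X → ℝ}

lemma integrable (hg : HasMoments μ g) : Integrable g μ := by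
  have := hg.2 1
  simp only [pow_one] at this
  exact (integrable_norm_iff hg.1.aestronglyMeasurable).1 this

lemma of_bounded [IsFiniteMeasure μ] (hg : Measurable g) (C : ℝ) (hC : ∀ x, |g x| ≤ C) :
    HasMoments μ g := by
  refine ⟨hg, fun n => ?_⟩
  refine Integrable.of_bound ((hg.norm.pow_const n)).aestronglyMeasurable (C ^ n)
    (Eventually.of_forall fun x => ?_)
  rw [Real.norm_eq_abs, abs_of_nonneg (by positivity)]
  exact pow_le_pow_left₀ (abs_nonneg _) (hC x) n

lemma const [IsFiniteMeasure μ] (c : ℝ) : HasMoments μ fun _ => c :=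
  of_bounded measurable_const |c| fun _ => le_rfl

lemma mul (hg : HasMoments μ g) (hh : HasMoments μ h) : HasMoments μ fun x => g x * h x := by
  refine ⟨hg.1.mul hh.1, fun n => ?_⟩
  refine ((hg.2 (2 * n)).add (hh.2 (2 * n))).mono'
    ((hg.1.mul hh.1).norm.pow_const n).aestronglyMeasurable (Eventually.of_forall fun x => ?_)
  rw [Real.norm_eq_abs, abs_of_nonneg (by positivity), abs_mul, mul_pow]
  have : |g x| ^ n * |h x| ^ n ≤ |g x| ^ (2 * n) + |h x| ^ (2 * n) := by
    rw [mul_comm 2 n, pow_mul, pow_mul]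
    nlinarith [sq_nonneg (|g x| ^ n - |h x| ^ n), sq_nonneg (|g x| ^ n), sq_nonneg (|h x| ^ n)]
  exact this

lemma add (hg : HasMoments μ g) (hh : HasMoments μ h) : HasMoments μ fun x => g x + h x := by
  refine ⟨hg.1.add hh.1, fun n => ?_⟩
  refine (((hg.2 n).add (hh.2 n)).const_mul (2 ^ n)).mono'
    ((hg.1.add hh.1).norm.pow_const n).aestronglyMeasurable (Eventually.of_forall fun x => ?_)
  rw [Real.norm_eq_abs, abs_of_nonneg (by positivity)]
  have h1 : |g x + h x| ≤ 2 * max |g x| |h x| := by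
    have := abs_add_le (g x) (h x)
    linarith [le_max_left |g x| |h x|, le_max_right |g x| |h x|]
  have h2 : (max |g x| |h x|) ^ n ≤ |g x| ^ n + |h x| ^ n := by
    have h3 := pow_nonneg (abs_nonneg (g x)) n
    have h4 := pow_nonneg (abs_nonneg (h x)) n
    rcases max_cases |g x| |h x| with h | h <;> rw [h.1] <;> linarith
  calc |g x + h x| ^ n ≤ (2 * max |g x| |h x|) ^ n := pow_le_pow_left₀ (abs_nonneg _) h1 n
    _ = 2 ^ n * (max |g x| |h x|) ^ n := mul_pow _ _ _
    _ ≤ 2 ^ n * (|g x| ^ n + |h x| ^ n) := by gcongr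

lemma integral_add (hg : HasMoments μ g) (hh : HasMoments μ h) :
    ∫ x, (g x + h x) ∂μ = ∫ x, g x ∂μ + ∫ x, h x ∂μ :=
  MeasureTheory.integral_add hg.integrable hh.integrable

lemma const_mul [IsFiniteMeasure μ] (c : ℝ) (hg : HasMoments μ g) :
    HasMoments μ fun x => c * g x := (const c).mul hg

lemma sub [IsFiniteMeasure μ] (hg : HasMoments μ g) (hh : HasMoments μ h) :
    HasMoments μ fun x => g x - h x := by
  have := hg.add (hh.const_mul (-1))
  simpa [sub_eq_add_neg] using this

lemma pow [IsFiniteMeasure μ] (hg : HasMoments μ g) (n : ℕ) : HasMoments μ fun x => g x ^ n := by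
  induction n with
  | zero => simpa using const 1
  | succ n ih => simpa only [pow_succ] using ih.mul hg

lemma sum [IsFiniteMeasure μ] {ι : Type*} (s : Finset ι) {F : ι → X → ℝ}
    (hF : ∀ i ∈ s, HasMoments μ (F i)) : HasMoments μ fun x => ∑ i ∈ s, F i x := by
  classical
  induction s using Finset.induction with
  | empty => simpa using const 0
  | insert a s ha ih =>
    simp only [Finset.sum_insert ha]
    exact (hF a (by simp)).add (ih fun i hi => hF i (by simp [hi]))

end HasMoments

/-! ### Moments of the noise coordinates -/

lemma integral_pow_gaussianReal :
    (∫ x, x ∂gaussianReal 0 1 = 0) ∧ (∫ x, x ^ 2 ∂gaussianReal 0 1 = 1) ∧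
    (∫ x, x ^ 3 ∂gaussianReal 0 1 = 0) ∧ (∫ x, x ^ 4 ∂gaussianReal 0 1 = 3) ∧
    (∫ x, x ^ 5 ∂gaussianReal 0 1 = 0) ∧ (∫ x, x ^ 6 ∂gaussianReal 0 1 = 15) := by
  have hm : ∀ n, ∫ x, x ^ n ∂gaussianReal 0 1
      = iteratedDeriv n (fun t : ℝ => Real.exp (t ^ 2 / 2)) 0 := by
    intro n
    have := iteratedDeriv_mgf_zero (X := id) (μ := gaussianReal 0 1) (by simp) n
    rw [mgf_id_gaussianReal] at this
    simpa using this.symm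
  have he : ∀ t : ℝ, HasDerivAt (fun t : ℝ => Real.exp (t ^ 2 / 2))
      (t * Real.exp (t ^ 2 / 2)) t := by
    intro t
    have h := (((hasDerivAt_pow 2 t).div_const 2).exp)
    convert! h using 1
    simp; ring
  -- Derivatives of `P exp(t²/2)` have the form `(P' + t P) exp(t²/2)`.
  have step : ∀ (n : ℕ) (p p' : ℝ → ℝ), (∀ t, HasDerivAt p (p' t) t) →
      iteratedDeriv n (fun t : ℝ => Real.exp (t ^ 2 / 2)) = (fun t => p t * Real.exp (t ^ 2 / 2)) →
      iteratedDeriv (n + 1) (fun t : ℝ => Real.exp (t ^ 2 / 2))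
        = fun t => (p' t + t * p t) * Real.exp (t ^ 2 / 2) := by
    intro n p p' hp h
    rw [iteratedDeriv_succ, h]
    funext t
    have := ((hp t).mul (he t)).deriv
    simp only [Pi.mul_def] at this
    rw [this]
    ring
  have h0 : iteratedDeriv 0 (fun t : ℝ => Real.exp (t ^ 2 / 2))
      = fun t => 1 * Real.exp (t ^ 2 / 2) := by simp
  have h1 := step 0 _ (fun _ => 0) (fun t => hasDerivAt_const t 1) h0
  have h1' : iteratedDeriv 1 (fun t : ℝ => Real.exp (t ^ 2 / 2))
      = fun t => t * Real.exp (t ^ 2 / 2) := by rw [h1]; funext t; ring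
  have h2 := step 1 _ (fun _ => 1) (fun t => hasDerivAt_id' t) h1'
  have h3 := step 2 _ (fun t => 2 * t) (fun t => by
    convert! ((hasDerivAt_id t).mul (hasDerivAt_id t)).const_add 1 using 1; simp; ring) h2
  have h3' : iteratedDeriv 3 (fun t : ℝ => Real.exp (t ^ 2 / 2))
      = fun t => (3 * t + t ^ 3) * Real.exp (t ^ 2 / 2) := by rw [h3]; funext t; ring
  have h4 := step 3 _ (fun t => 3 + 3 * t ^ 2) (fun t => by
    convert! ((hasDerivAt_id t).const_mul 3).add (hasDerivAt_pow 3 t) using 1; simp) h3'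
  have h4' : iteratedDeriv 4 (fun t : ℝ => Real.exp (t ^ 2 / 2))
      = fun t => (3 + 6 * t ^ 2 + t ^ 4) * Real.exp (t ^ 2 / 2) := by rw [h4]; funext t; ring
  have h5 := step 4 _ (fun t => 12 * t + 4 * t ^ 3) (fun t => by
    convert! (((hasDerivAt_pow 2 t).const_mul 6).const_add 3).add (hasDerivAt_pow 4 t) using 1
    simp; ring) h4'
  have h5' : iteratedDeriv 5 (fun t : ℝ => Real.exp (t ^ 2 / 2))
      = fun t => (15 * t + 10 * t ^ 3 + t ^ 5) * Real.exp (t ^ 2 / 2) := by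
    rw [h5]; funext t; ring
  have h6 := step 5 _ (fun t => 15 + 30 * t ^ 2 + 5 * t ^ 4) (fun t => by
    convert! (((hasDerivAt_id t).const_mul 15).add ((hasDerivAt_pow 3 t).const_mul 10)).add
      (hasDerivAt_pow 5 t) using 1
    simp; ring) h5'
  refine ⟨?_, ?_, ?_, ?_, ?_, ?_⟩
  · have := hm 1; simp only [pow_one] at this; rw [this, h1']; simp
  · rw [hm, h2]; simp
  · rw [hm, h3']; simp
  · rw [hm, h4']; simp
  · rw [hm, h5']; simp
  · rw [hm, h6]; simp

lemma measurePreserving_coord (i : ℕ × Bool) :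
    MeasurePreserving (fun x : ℕ × Bool → ℝ => x i) noiseLaw
      (gaussianReal 0 (if i.1 = 0 then 0 else 1)) :=
  measurePreserving_eval_infinitePi _ i

lemma iIndepFun_coord : iIndepFun (fun (i : ℕ × Bool) (x : ℕ × Bool → ℝ) => x i) noiseLaw :=
  iIndepFun_infinitePi (X := fun _ y => y) fun _ => measurable_id

lemma hasMoments_coord (i : ℕ × Bool) : HasMoments noiseLaw fun x => x i := by
  refine ⟨measurable_pi_apply i, fun n => ?_⟩
  have h : Integrable (fun y : ℝ => |y| ^ n) (gaussianReal 0 (if i.1 = 0 then 0 else 1)) := by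
    have := (memLp_id_gaussianReal (μ := 0) (v := if i.1 = 0 then 0 else 1) n).integrable_norm_pow'
    simpa using this
  exact (measurePreserving_coord i).integrable_comp_of_integrable h

/-- Functions of the coordinates at the frequencies `k` and `m` are independent of those at a third
frequency. -/
lemma integral_mul_of_ne {k m l : ℕ} (hkl : k ≠ l) (hml : m ≠ l)
    {G : (ℝ × ℝ) × (ℝ × ℝ) → ℝ} {H : ℝ × ℝ → ℝ} (hG : Measurable G) (hH : Measurable H) :
    ∫ x, G ((x (k, true), x (k, false)), (x (m, true), x (m, false)))
        * H (x (l, true), x (l, false)) ∂noiseLaw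
      = (∫ x, G ((x (k, true), x (k, false)), (x (m, true), x (m, false))) ∂noiseLaw)
        * ∫ x, H (x (l, true), x (l, false)) ∂noiseLaw := by
  classical
  let S : Finset (ℕ × Bool) := {(k, true), (k, false), (m, true), (m, false)}
  let T : Finset (ℕ × Bool) := {(l, true), (l, false)}
  have hST : Disjoint S T := by
    simp [S, T, Finset.disjoint_left, hkl, hml]
  have h := iIndepFun_coord.indepFun_finset S T hST (fun i => measurable_pi_apply i)
  have mk (i : ℕ × Bool) (hi : i ∈ S) : Measurable fun y : S → ℝ => y ⟨i, hi⟩ :=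
    measurable_pi_apply _
  have mk' (i : ℕ × Bool) (hi : i ∈ T) : Measurable fun y : T → ℝ => y ⟨i, hi⟩ :=
    measurable_pi_apply _
  have mG : Measurable fun y : S → ℝ => G ((y ⟨(k, true), by simp [S]⟩, y ⟨(k, false), by simp [S]⟩),
      (y ⟨(m, true), by simp [S]⟩, y ⟨(m, false), by simp [S]⟩)) :=
    hG.comp (((mk _ _).prodMk (mk _ _)).prodMk ((mk _ _).prodMk (mk _ _)))
  have mH : Measurable fun y : T → ℝ =>
      H (y ⟨(l, true), by simp [T]⟩, y ⟨(l, false), by simp [T]⟩) :=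
    hH.comp ((mk' _ _).prodMk (mk' _ _))
  exact h.integral_fun_comp_mul_comp
    (measurable_pi_lambda _ fun i => measurable_pi_apply _).aemeasurable
    (measurable_pi_lambda _ fun i => measurable_pi_apply _).aemeasurable
    mG.aestronglyMeasurable mH.aestronglyMeasurable

lemma integral_coord_pow_mul {k : ℕ} (hk : k ≠ 0) (m n : ℕ) :
    ∫ x, x (k, true) ^ m * x (k, false) ^ n ∂noiseLaw
      = (∫ y, y ^ m ∂gaussianReal 0 1) * ∫ y, y ^ n ∂gaussianReal 0 1 := by
  have h := iIndepFun_coord.indepFun (i := (k, true)) (j := (k, false)) (by simp)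
  have h1 := h.integral_fun_comp_mul_comp (f := fun y : ℝ => y ^ m) (g := fun y : ℝ => y ^ n)
    (measurable_pi_apply _).aemeasurable (measurable_pi_apply _).aemeasurable
    (measurable_id.pow_const m).aestronglyMeasurable
    (measurable_id.pow_const n).aestronglyMeasurable
  rw [h1]
  have h2 : ∀ (b : Bool) (n : ℕ), ∫ x, x (k, b) ^ n ∂noiseLaw = ∫ y, y ^ n ∂gaussianReal 0 1 := by
    intro b n
    have := (measurePreserving_coord (k, b)).map_eq
    simp only [hk, if_false] at this
    rw [← this, integral_map (measurable_pi_apply _).aemeasurable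
      ((measurable_id' (α := ℝ)).pow_const n).aestronglyMeasurable]
  rw [h2, h2]

/-! ### Symmetrization -/

/-- The change of sign of the sine coordinate at frequency `k`. -/
noncomputable def flip (k : ℕ) (x : ℕ × Bool → ℝ) : ℕ × Bool → ℝ :=
  fun i => if i = (k, false) then -x i else x i

lemma measurePreserving_flip (k : ℕ) : MeasurePreserving (flip k) noiseLaw noiseLaw where
  measurable := measurable_pi_lambda _ fun i => by
    unfold flip
    by_cases h : i = (k, false)
    · simp only [h, if_true]; exact (measurable_pi_apply _).neg
    · simp only [h, if_false]; exact measurable_pi_apply _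
  map_eq := by
    have h := Measure.infinitePi_map_pi (fun i : ℕ × Bool => gaussianReal 0 (if i.1 = 0 then 0 else 1))
      (f := fun i y => if i = (k, false) then -y else y) (fun i => by
        by_cases h : i = (k, false)
        · simp only [h, if_true]; exact measurable_neg
        · simp only [h, if_false]; exact measurable_id)
    unfold noiseLaw
    refine h.trans ?_
    congr 1
    funext i
    by_cases h : i = (k, false)
    · simp only [h, if_true]; rw [gaussianReal_map_neg, neg_zero]
    · simp only [h, if_false]; exact Measure.map_id

lemma integral_eq_zero_of_flip {g : (ℕ × Bool → ℝ) → ℝ} (hg : Measurable g) (k : ℕ)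
    (h : ∀ x, g (flip k x) = -g x) : ∫ x, g x ∂noiseLaw = 0 := by
  have h1 : ∫ x, g (flip k x) ∂noiseLaw = ∫ x, g x ∂noiseLaw := by
    conv_rhs => rw [← (measurePreserving_flip k).map_eq]
    rw [integral_map (measurePreserving_flip k).measurable.aemeasurable hg.aestronglyMeasurable]
  simp only [h, integral_neg] at h1
  linarith

/-- Orthogonality under independent random signs: if each `c k` is odd in the sine coordinate of
frequency `k` and even in the others, and `H` is even in all of them, then the cross terms of
`(∑ c k)²` have integral zero against `H`. -/
lemma integral_mul_sum_sq (s : Finset ℕ) {c : ℕ → (ℕ × Bool → ℝ) → ℝ}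
    (hc : ∀ k ∈ s, HasMoments noiseLaw (c k))
    (hodd : ∀ k ∈ s, ∀ x, c k (flip k x) = -c k x)
    (heven : ∀ k ∈ s, ∀ l ∈ s, l ≠ k → ∀ x, c l (flip k x) = c l x)
    {H : (ℕ × Bool → ℝ) → ℝ} (hH : HasMoments noiseLaw H)
    (hHe : ∀ k ∈ s, ∀ x, H (flip k x) = H x) :
    ∫ x, H x * (∑ k ∈ s, c k x) ^ 2 ∂noiseLaw = ∫ x, H x * ∑ k ∈ s, c k x ^ 2 ∂noiseLaw := by
  classical
  induction s using Finset.induction with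
  | empty => simp
  | insert a s ha ih =>
    have ih' := ih (fun k hk => hc k (by simp [hk])) (fun k hk => hodd k (by simp [hk]))
      (fun k hk l hl => heven k (by simp [hk]) l (by simp [hl])) (fun k hk => hHe k (by simp [hk]))
    have hca := hc a (by simp)
    have hS : HasMoments noiseLaw fun x => ∑ k ∈ s, c k x :=
      HasMoments.sum s fun k hk => hc k (by simp [hk])
    have hS2 : HasMoments noiseLaw fun x => ∑ k ∈ s, c k x ^ 2 :=
      HasMoments.sum s fun k hk => (hc k (by simp [hk])).pow 2
    have e1 : ∀ x, H x * (∑ k ∈ insert a s, c k x) ^ 2 = (H x * c a x ^ 2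
        + H x * (∑ k ∈ s, c k x) ^ 2) + 2 * (H x * (c a x * ∑ k ∈ s, c k x)) := fun x => by
      rw [Finset.sum_insert ha]; ring
    have e2 : ∀ x, H x * (∑ k ∈ insert a s, c k x ^ 2) = H x * c a x ^ 2
        + H x * (∑ k ∈ s, c k x ^ 2) := fun x => by
      rw [Finset.sum_insert ha]; ring
    simp only [e1, e2]
    have i1 := hH.mul (hca.pow 2)
    have i2 := hH.mul (hS.pow 2)
    have i3 := hH.mul (hca.mul hS)
    have i4 := hH.mul hS2
    rw [(i1.add i2).integral_add (i3.const_mul 2), i1.integral_add i2,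
      i1.integral_add i4, ih', integral_const_mul, integral_eq_zero_of_flip i3.1 a, mul_zero,
      add_zero]
    intro x
    have h1 : ∑ k ∈ s, c k (flip a x) = ∑ k ∈ s, c k x := Finset.sum_congr rfl fun l hl =>
      heven a (by simp) l (by simp [hl]) (fun h => ha (h ▸ hl)) x
    rw [hHe a (by simp), hodd a (by simp), h1]
    ring

/-- The fourth moment under independent random signs (Khinchine's inequality). -/
lemma integral_mul_sum_pow_four_le (s : Finset ℕ) {c : ℕ → (ℕ × Bool → ℝ) → ℝ}
    (hc : ∀ k ∈ s, HasMoments noiseLaw (c k))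
    (hodd : ∀ k ∈ s, ∀ x, c k (flip k x) = -c k x)
    (heven : ∀ k ∈ s, ∀ l ∈ s, l ≠ k → ∀ x, c l (flip k x) = c l x)
    {H : (ℕ × Bool → ℝ) → ℝ} (hH : HasMoments noiseLaw H) (hH0 : ∀ x, 0 ≤ H x)
    (hHe : ∀ k ∈ s, ∀ x, H (flip k x) = H x) :
    ∫ x, H x * (∑ k ∈ s, c k x) ^ 4 ∂noiseLaw
      ≤ 3 * ∫ x, H x * (∑ k ∈ s, c k x ^ 2) ^ 2 ∂noiseLaw := by
  classical
  induction s using Finset.induction with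
  | empty => simp
  | insert a s ha ih =>
    have hcs : ∀ k ∈ s, HasMoments noiseLaw (c k) := fun k hk => hc k (by simp [hk])
    have hos : ∀ k ∈ s, ∀ x, c k (flip k x) = -c k x := fun k hk => hodd k (by simp [hk])
    have hes : ∀ k ∈ s, ∀ l ∈ s, l ≠ k → ∀ x, c l (flip k x) = c l x :=
      fun k hk l hl => heven k (by simp [hk]) l (by simp [hl])
    have ih' := ih hcs hos hes (fun k hk => hHe k (by simp [hk]))
    have hca := hc a (by simp)
    have hS : HasMoments noiseLaw fun x => ∑ k ∈ s, c k x := HasMoments.sum s hcs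
    have hS2 : HasMoments noiseLaw fun x => ∑ k ∈ s, c k x ^ 2 :=
      HasMoments.sum s fun k hk => (hcs k hk).pow 2
    have hcross := integral_mul_sum_sq s hcs hos hes (hH.mul (hca.pow 2)) (fun k hk x => by
      rw [hHe k (by simp [hk]), heven k (by simp [hk]) a (by simp) (fun h => ha (h ▸ hk))])
    have e1 : ∀ x, H x * (∑ k ∈ insert a s, c k x) ^ 4 = (H x * c a x ^ 4
        + (H x * (∑ k ∈ s, c k x) ^ 4 + 6 * (H x * c a x ^ 2 * (∑ k ∈ s, c k x) ^ 2)))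
        + 4 * (H x * (c a x * (∑ k ∈ s, c k x) * (c a x ^ 2 + (∑ k ∈ s, c k x) ^ 2))) :=
      fun x => by rw [Finset.sum_insert ha]; ring
    have e2 : ∀ x, H x * (∑ k ∈ insert a s, c k x ^ 2) ^ 2 = H x * c a x ^ 4
        + (H x * (∑ k ∈ s, c k x ^ 2) ^ 2 + 2 * (H x * c a x ^ 2 * ∑ k ∈ s, c k x ^ 2)) :=
      fun x => by rw [Finset.sum_insert ha]; ring
    simp only [e1, e2]
    have i1 := hH.mul (hca.pow 4)
    have i2 := hH.mul (hS.pow 4)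
    have i3 := (hH.mul (hca.pow 2)).mul (hS.pow 2)
    have i4 := hH.mul ((hca.mul hS).mul ((hca.pow 2).add (hS.pow 2)))
    have i5 := hH.mul (hS2.pow 2)
    have i6 := (hH.mul (hca.pow 2)).mul hS2
    rw [(i1.add (i2.add (i3.const_mul 6))).integral_add (i4.const_mul 4),
      i1.integral_add (i2.add (i3.const_mul 6)), i2.integral_add (i3.const_mul 6),
      i1.integral_add (i5.add (i6.const_mul 2)), i5.integral_add (i6.const_mul 2),
      integral_const_mul, integral_const_mul, integral_const_mul,
      integral_eq_zero_of_flip i4.1 a, hcross]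
    · have : 0 ≤ ∫ x, H x * c a x ^ 4 ∂noiseLaw := integral_nonneg fun x =>
        mul_nonneg (hH0 x) (by positivity)
      linarith
    · intro x
      have h1 : ∑ k ∈ s, c k (flip a x) = ∑ k ∈ s, c k x := Finset.sum_congr rfl fun l hl =>
        heven a (by simp) l (by simp [hl]) (fun h => ha (h ▸ hl)) x
      rw [hHe a (by simp), hodd a (by simp), h1]
      ring

end ShiftModel


namespace ShiftModel

/-! ### Tail bounds for linear and quadratic forms of the noise -/

lemma neg_sub_half_log_le {s : ℝ} (hs : |s| ≤ 1 / 1000) :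
    -s - 1 / 2 * Real.log (1 - 2 * s) ≤ 1.005 * s ^ 2 := by
  have h2 : |2 * s| = 2 * |s| := by rw [abs_mul]; norm_num
  have h := Real.abs_log_sub_add_sum_range_le (x := 2 * s) (by rw [h2]; linarith) 2
  rw [h2] at h
  simp only [Finset.sum_range_succ, Finset.sum_range_zero, zero_add] at h
  have h' := (abs_le.1 h).1
  norm_num at h'
  have h3 : (2 * |s|) ^ 3 / (1 - 2 * |s|) ≤ 0.01 * s ^ 2 := by
    rw [div_le_iff₀ (by linarith)]
    have hsq : s ^ 2 = |s| ^ 2 := (sq_abs s).symm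
    rw [hsq]
    have h0 := abs_nonneg s
    nlinarith [mul_nonneg (sq_nonneg |s|) (sub_nonneg.2 hs)]
  nlinarith

lemma integral_exp_mul_sq_sub_one {s : ℝ} (hs : s < 1 / 2) :
    ∫ y, Real.exp (s * (y ^ 2 - 1)) ∂gaussianReal 0 1 = Real.exp (-s) / √(1 - 2 * s) := by
  rw [integral_gaussianReal_eq_integral_smul one_ne_zero]
  have h : ∀ y : ℝ, gaussianPDFReal 0 1 y • Real.exp (s * (y ^ 2 - 1))
      = ((√(2 * π))⁻¹ * Real.exp (-s)) * Real.exp (-(1 / 2 - s) * y ^ 2) := by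
    intro y
    rw [gaussianPDFReal, smul_eq_mul]
    simp only [NNReal.coe_one, mul_one, sub_zero]
    rw [mul_assoc, mul_assoc, ← Real.exp_add, ← Real.exp_add]
    congr 2
    ring
  simp only [h]
  rw [integral_const_mul, integral_gaussian]
  have e : π / (1 / 2 - s) = (2 * π) / (1 - 2 * s) := by
    have : (1 : ℝ) - 2 * s ≠ 0 := by linarith
    have : (1 : ℝ) / 2 - s ≠ 0 := by linarith
    field_simp
  rw [e, Real.sqrt_div (by positivity)]
  have : √(2 * π) ≠ 0 := by positivity
  field_simp

lemma integral_exp_mul_sq_sub_one_le {s : ℝ} (hs : |s| ≤ 1 / 1000) :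
    ∫ y, Real.exp (s * (y ^ 2 - 1)) ∂gaussianReal 0 1 ≤ Real.exp (1.005 * s ^ 2) := by
  have hs' := abs_le.1 hs
  have hpos : 0 < 1 - 2 * s := by linarith [hs'.2]
  rw [integral_exp_mul_sq_sub_one (by linarith [hs'.2])]
  have : √(1 - 2 * s) = Real.exp (1 / 2 * Real.log (1 - 2 * s)) := by
    rw [Real.sqrt_eq_rpow, Real.rpow_def_of_pos hpos, mul_comm]
  rw [this, ← Real.exp_sub]
  exact Real.exp_le_exp.2 (neg_sub_half_log_le hs)

lemma integral_exp_mul_gaussianReal (s : ℝ) :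
    ∫ y, Real.exp (s * y) ∂gaussianReal 0 1 = Real.exp (s ^ 2 / 2) := by
  have := congrFun (mgf_id_gaussianReal (μ := 0) (v := 1)) s
  simpa [mgf] using this

/-- Chernoff's bound for a sum of independent functions `v i * g (x i)` of the coordinates. -/
lemma measureReal_le_exp_of_mgf {A : Finset (ℕ × Bool)} (hA : ∀ i ∈ A, i.1 ≠ 0) {g : ℝ → ℝ}
    (hg : Measurable g) {v b : ℕ × Bool → ℝ} {t : ℝ} (ht : 0 ≤ t)
    (hpos : ∀ i ∈ A, 0 < ∫ y, Real.exp (t * v i * g y) ∂gaussianReal 0 1)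
    (hb : ∀ i ∈ A, ∫ y, Real.exp (t * v i * g y) ∂gaussianReal 0 1 ≤ Real.exp (b i)) (u : ℝ) :
    noiseLaw.real {x | u ≤ ∑ i ∈ A, v i * g (x i)} ≤ Real.exp (-t * u + ∑ i ∈ A, b i) := by
  have hind := iIndepFun_coord.comp (fun i y => v i * g y) (fun i => hg.const_mul _)
  have hmeas : ∀ i : ℕ × Bool, Measurable ((fun y => v i * g y) ∘ fun x : ℕ × Bool → ℝ => x i) :=
    fun i => (hg.const_mul _).comp (measurable_pi_apply i)
  have hmgf : ∀ i ∈ A, mgf ((fun y => v i * g y) ∘ fun x : ℕ × Bool → ℝ => x i) noiseLaw t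
      = ∫ y, Real.exp (t * v i * g y) ∂gaussianReal 0 1 := by
    intro i hi
    have h := (measurePreserving_coord i).map_eq
    simp only [hA i hi, if_false] at h
    rw [mgf, ← h, integral_map (measurable_pi_apply _).aemeasurable
      (by exact ((hg.const_mul _).exp).aestronglyMeasurable)]
    simp only [Function.comp_apply, mul_assoc]
  have hsum := hind.mgf_sum (t := t) hmeas A
  have hint : Integrable (fun x => Real.exp (t *
      (∑ i ∈ A, (fun y => v i * g y) ∘ fun x : ℕ × Bool → ℝ => x i) x)) noiseLaw := by
    by_contra hcon
    have h0 : mgf (∑ i ∈ A, (fun y => v i * g y) ∘ fun x : ℕ × Bool → ℝ => x i) noiseLaw t = 0 :=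
      integral_undef hcon
    rw [hsum, Finset.prod_congr rfl hmgf] at h0
    exact (Finset.prod_pos hpos).ne' h0
  have h := measure_ge_le_exp_mul_mgf u ht hint
  rw [hsum, Finset.prod_congr rfl hmgf] at h
  simp only [Finset.sum_apply, Function.comp_apply] at h
  refine h.trans ?_
  rw [Real.exp_add, Real.exp_sum]
  exact mul_le_mul_of_nonneg_left (Finset.prod_le_prod (fun i hi => (hpos i hi).le) hb)
    (Real.exp_pos _).le

lemma measureReal_quadratic_le {A : Finset (ℕ × Bool)} (hA : ∀ i ∈ A, i.1 ≠ 0)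
    {v : ℕ × Bool → ℝ} {t : ℝ} (ht : 0 ≤ t) (hv : ∀ i ∈ A, |t * v i| ≤ 1 / 1000) (u : ℝ) :
    noiseLaw.real {x | u ≤ ∑ i ∈ A, v i * (x i ^ 2 - 1)}
      ≤ Real.exp (-t * u + 1.005 * t ^ 2 * ∑ i ∈ A, v i ^ 2) := by
  have h := measureReal_le_exp_of_mgf hA (g := fun y => y ^ 2 - 1) (by fun_prop) ht
    (v := v) (b := fun i => 1.005 * (t * v i) ^ 2) (fun i hi => by
      rw [integral_exp_mul_sq_sub_one (by linarith [(abs_le.1 (hv i hi)).2])]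
      have : 0 < 1 - 2 * (t * v i) := by linarith [(abs_le.1 (hv i hi)).2]
      positivity) (fun i hi => integral_exp_mul_sq_sub_one_le (hv i hi)) u
  refine h.trans (le_of_eq ?_)
  congr 2
  rw [Finset.mul_sum]
  exact Finset.sum_congr rfl fun i _ => by ring

lemma measureReal_linear_le {A : Finset (ℕ × Bool)} (hA : ∀ i ∈ A, i.1 ≠ 0)
    {v : ℕ × Bool → ℝ} {t : ℝ} (ht : 0 ≤ t) (u : ℝ) :
    noiseLaw.real {x | u ≤ ∑ i ∈ A, v i * x i}
      ≤ Real.exp (-t * u + t ^ 2 / 2 * ∑ i ∈ A, v i ^ 2) := by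
  have h := measureReal_le_exp_of_mgf hA (g := fun y => y) measurable_id ht
    (v := v) (b := fun i => (t * v i) ^ 2 / 2) (fun i hi => by
      rw [integral_exp_mul_gaussianReal]; positivity)
      (fun i hi => (integral_exp_mul_gaussianReal _).le) u
  refine h.trans (le_of_eq ?_)
  congr 2
  rw [Finset.mul_sum]
  exact Finset.sum_congr rfl fun i _ => by ring

/-- The two-sided version of `measureReal_quadratic_le`. -/
lemma measureReal_abs_quadratic_le {A : Finset (ℕ × Bool)} (hA : ∀ i ∈ A, i.1 ≠ 0)
    {v : ℕ × Bool → ℝ} {t : ℝ} (ht : 0 ≤ t) (hv : ∀ i ∈ A, |t * v i| ≤ 1 / 1000) (u : ℝ) :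
    noiseLaw.real {x | u ≤ |∑ i ∈ A, v i * (x i ^ 2 - 1)|}
      ≤ 2 * Real.exp (-t * u + 1.005 * t ^ 2 * ∑ i ∈ A, v i ^ 2) := by
  have h1 := measureReal_quadratic_le hA ht hv u
  have h2 := measureReal_quadratic_le hA (v := fun i => -v i) ht
    (fun i hi => by rw [mul_neg, abs_neg]; exact hv i hi) u
  simp only [neg_sq, neg_mul, Finset.sum_neg_distrib] at h2
  have h3 : {x : ℕ × Bool → ℝ | u ≤ |∑ i ∈ A, v i * (x i ^ 2 - 1)|}
      ⊆ {x | u ≤ ∑ i ∈ A, v i * (x i ^ 2 - 1)} ∪ {x | u ≤ -∑ i ∈ A, v i * (x i ^ 2 - 1)} :=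
    fun x (hx : u ≤ _) => (le_abs.1 hx : _ ∨ _)
  have h4 := (measureReal_mono h3).trans (measureReal_union_le (μ := noiseLaw) _ _)
  simp only [neg_mul] at h1
  simp only [neg_mul]
  linarith

/-- The two-sided version of `measureReal_linear_le`. -/
lemma measureReal_abs_linear_le {A : Finset (ℕ × Bool)} (hA : ∀ i ∈ A, i.1 ≠ 0)
    {v : ℕ × Bool → ℝ} {t : ℝ} (ht : 0 ≤ t) (u : ℝ) :
    noiseLaw.real {x | u ≤ |∑ i ∈ A, v i * x i|}
      ≤ 2 * Real.exp (-t * u + t ^ 2 / 2 * ∑ i ∈ A, v i ^ 2) := by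
  have h1 := measureReal_linear_le hA (v := v) ht u
  have h2 := measureReal_linear_le hA (v := fun i => -v i) ht u
  simp only [neg_sq, neg_mul, Finset.sum_neg_distrib] at h2
  have h3 : {x : ℕ × Bool → ℝ | u ≤ |∑ i ∈ A, v i * x i|}
      ⊆ {x | u ≤ ∑ i ∈ A, v i * x i} ∪ {x | u ≤ -∑ i ∈ A, v i * x i} :=
    fun x (hx : u ≤ _) => (le_abs.1 hx : _ ∨ _)
  have h4 := (measureReal_mono h3).trans (measureReal_union_le (μ := noiseLaw) _ _)
  simp only [neg_mul] at h1
  simp only [neg_mul]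
  linarith

end ShiftModel


namespace ShiftModel

/-! ### Blocks of frequencies -/

/-- The weight `(2πk)²` of the frequency `k` in `‖f'‖²`. -/
noncomputable def wt (k : ℕ) : ℝ := (2 * π * k) ^ 2

lemma wt_nonneg (k : ℕ) : 0 ≤ wt k := sq_nonneg _

lemma wt_mono {k l : ℕ} (h : k ≤ l) : wt k ≤ wt l := by
  unfold wt; gcongr

namespace Blocks

variable {N : ℕ} (B : Blocks N)

lemma sum_block_eq_sum_Ico (F : ℕ → ℝ) {m : ℕ} (hm : m ≤ B.J) :
    ∑ j ∈ Finset.Icc 1 m, ∑ k ∈ B.block j, F k = ∑ k ∈ Finset.Ico 1 (B.κ (m + 1)), F k ∧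
      1 ≤ B.κ (m + 1) := by
  induction m with
  | zero => simp [B.κ_one]
  | succ m ih =>
    obtain ⟨h1, h2⟩ := ih (by omega)
    have h3 := B.κ_lt (m + 1) (Finset.mem_Icc.2 ⟨by omega, hm⟩)
    refine ⟨?_, by omega⟩
    rw [Finset.sum_Icc_succ_top (by omega), h1, block, Finset.sum_Ico_consecutive _ h2 h3.le]

lemma sum_block (F : ℕ → ℝ) :
    ∑ j ∈ Finset.Icc 1 B.J, ∑ k ∈ B.block j, F k = ∑ k ∈ Finset.Icc 1 N, F k := by
  rw [(B.sum_block_eq_sum_Ico F le_rfl).1, B.κ_last]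
  rfl

lemma κ_le {i j : ℕ} (hi : 1 ≤ i) (hij : i ≤ j) (hj : j ≤ B.J + 1) : B.κ i ≤ B.κ j := by
  induction j, hij using Nat.le_induction with
  | base => exact le_rfl
  | succ j hij ih =>
    exact (ih (by omega)).trans (B.κ_lt j (Finset.mem_Icc.2 ⟨by omega, by omega⟩)).le

variable {B} in
lemma mem_Icc_of_mem_block {j k : ℕ} (hj : j ∈ Finset.Icc 1 B.J) (hk : k ∈ B.block j) :
    k ∈ Finset.Icc 1 N := by
  rw [Finset.mem_Icc] at hj
  rw [block, Finset.mem_Ico] at hk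
  have h1 := B.κ_le le_rfl hj.1 (by omega)
  have h2 := B.κ_le (i := j + 1) (by omega) (by omega) le_rfl
  rw [B.κ_one] at h1
  rw [B.κ_last] at h2
  rw [Finset.mem_Icc]
  omega

variable {B} in
lemma ne_zero_of_mem_block {j k : ℕ} (hj : j ∈ Finset.Icc 1 B.J) (hk : k ∈ B.block j) :
    k ≠ 0 := by
  have := Finset.mem_Icc.1 (mem_Icc_of_mem_block hj hk)
  omega

variable {B} in
lemma block_unique {i j k : ℕ} (hi : i ∈ Finset.Icc 1 B.J) (hj : j ∈ Finset.Icc 1 B.J)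
    (hki : k ∈ B.block i) (hkj : k ∈ B.block j) : i = j := by
  rw [Finset.mem_Icc] at hi hj
  rw [block, Finset.mem_Ico] at hki hkj
  rcases lt_trichotomy i j with h | h | h
  · have := B.κ_le (i := i + 1) (j := j) (by omega) h (by omega)
    omega
  · exact h
  · have := B.κ_le (i := j + 1) (j := i) (by omega) h (by omega)
    omega

variable {B} in
lemma sum_ite_block {j k : ℕ} (hj : j ∈ Finset.Icc 1 B.J) (hk : k ∈ B.block j) (g : ℕ → ℝ) :
    ∑ i ∈ Finset.Icc 1 B.J, (if k ∈ B.block i then g i else 0) = g j := by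
  rw [Finset.sum_eq_single_of_mem j hj fun i hi hij => ?_]
  · simp [hk]
  · rw [if_neg fun h => hij (block_unique hi hj h hk)]

variable {B} in
lemma one_le_len {j : ℕ} (hj : j ∈ Finset.Icc 1 B.J) : 1 ≤ B.len j := by
  have := B.κ_lt j hj
  rw [len, block, Nat.card_Ico]
  omega

variable {B} in
lemma minLen_le_len {j : ℕ} (hj : j ∈ Finset.Icc 1 B.J) : B.minLen ≤ B.len j :=
  Finset.inf'_le _ hj

lemma J_le : B.J ≤ N := by
  have h : ∀ m, m ≤ B.J → m + 1 ≤ B.κ (m + 1) := by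
    intro m
    induction m with
    | zero => intro _; simp [B.κ_one]
    | succ m ih =>
      intro hm
      have := B.κ_lt (m + 1) (Finset.mem_Icc.2 ⟨by omega, hm⟩)
      have := ih (by omega)
      omega
  have := h B.J le_rfl
  rw [B.κ_last] at this
  omega

lemma one_mem : 1 ∈ Finset.Icc 1 B.J := Finset.mem_Icc.2 ⟨le_rfl, B.one_le_J⟩

lemma one_mem_block : 1 ∈ B.block 1 := by
  have := B.κ_lt 1 B.one_mem
  rw [B.κ_one] at this
  rw [block, Finset.mem_Ico, B.κ_one]
  omega

/-- The largest of consecutive squares is at most three times their mean. -/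
lemma sub_mul_sq_le_three_mul_sum (a n : ℕ) :
    ((n : ℝ) + 1) * ((a : ℝ) + n) ^ 2 ≤ 3 * ∑ k ∈ Finset.Ico a (a + (n + 1)), (k : ℝ) ^ 2 := by
  induction n with
  | zero => simp; nlinarith [sq_nonneg (a : ℝ)]
  | succ n ih =>
    rw [show a + (n + 1 + 1) = (a + (n + 1)) + 1 by ring, Finset.sum_Ico_succ_top (by omega)]
    push_cast at ih ⊢
    have ha : (0 : ℝ) ≤ a := Nat.cast_nonneg a
    have hn : (0 : ℝ) ≤ n := Nat.cast_nonneg n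
    nlinarith [mul_nonneg ha hn, mul_nonneg ha ha, mul_nonneg hn hn]

variable {B} in
/-- On a block of consecutive frequencies, no weight exceeds three times the mean weight. -/
lemma wt_mul_len_le {j k : ℕ} (hj : j ∈ Finset.Icc 1 B.J) (hk : k ∈ B.block j) :
    wt k * B.len j ≤ 3 * B.sigmaSq j := by
  have hlt := B.κ_lt j hj
  obtain ⟨n, hn⟩ : ∃ n, B.κ (j + 1) = B.κ j + (n + 1) := ⟨B.κ (j + 1) - B.κ j - 1, by omega⟩
  have h := sub_mul_sq_le_three_mul_sum (B.κ j) n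
  have hlen : (B.len j : ℝ) = n + 1 := by
    rw [len, block, Nat.card_Ico, hn, Nat.add_sub_cancel_left]; push_cast; ring
  have hs : B.sigmaSq j = (2 * π) ^ 2 * ∑ k ∈ Finset.Ico (B.κ j) (B.κ j + (n + 1)), (k : ℝ) ^ 2 := by
    rw [sigmaSq, block, hn, Finset.mul_sum]
    exact Finset.sum_congr rfl fun k _ => by ring
  have hk' : (k : ℝ) ≤ (B.κ j : ℝ) + n := by
    rw [block, Finset.mem_Ico, hn] at hk
    exact_mod_cast (by omega : k ≤ B.κ j + n)
  have hw : wt k ≤ (2 * π) ^ 2 * ((B.κ j : ℝ) + n) ^ 2 := by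
    rw [wt, mul_pow]; gcongr
  rw [hlen, hs]
  have h1 : wt k * ((n : ℝ) + 1) ≤ (2 * π) ^ 2 * ((B.κ j : ℝ) + n) ^ 2 * ((n : ℝ) + 1) :=
    mul_le_mul_of_nonneg_right hw (by positivity)
  have h2 := mul_le_mul_of_nonneg_left h (sq_nonneg (2 * π))
  linarith

lemma sigmaSq_eq (j : ℕ) : B.sigmaSq j = ∑ k ∈ B.block j, wt k := rfl

variable {B} in
lemma sigmaSq_pos {j : ℕ} (hj : j ∈ Finset.Icc 1 B.J) : 0 < B.sigmaSq j := by
  rw [sigmaSq_eq]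
  refine Finset.sum_pos (fun k hk => ?_) (Finset.card_pos.1 (one_le_len hj))
  have : (0 : ℝ) < k := by exact_mod_cast Nat.pos_of_ne_zero (ne_zero_of_mem_block hj hk)
  unfold wt; positivity

end Blocks

/-! ### The penalized Stein weight of one block -/

/-- The penalized Stein weight of a block with noise level `S`, penalty `φ` and energy `Y`. -/
noncomputable def steinShrink (S φ Y : ℝ) : ℝ := max 0 (1 - S * (1 + φ) / (max 0 (Y - 2 * S) + S))

lemma steinShrink_nonneg (S φ Y : ℝ) : 0 ≤ steinShrink S φ Y := le_max_left _ _

lemma steinShrink_le_one {S φ : ℝ} (hS : 0 < S) (hφ : 0 ≤ φ) (Y : ℝ) : steinShrink S φ Y ≤ 1 := by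
  refine max_le zero_le_one ?_
  have : 0 ≤ S * (1 + φ) / (max 0 (Y - 2 * S) + S) := by
    have := le_max_left 0 (Y - 2 * S)
    positivity
  linarith

/-- If the noise in the energy of a block is below the penalty, then the penalized Stein weight
differs from the oracle weight `F / (F + S)` by at most a small multiple of `S / (F + S)` and by at
most a multiple of `F / (F + S)`. The second bound is where the penalty matters: it forces the
weight to vanish unless `F` is at least of order `φ S`. -/
lemma abs_steinShrink_sub_le {S F φ n₁ n₂ : ℝ} (hS : 0 < S) (hF : 0 ≤ F) (hφ : 0 < φ)
    (hφ' : φ ≤ 1 / 8) (h₁ : |n₁| ≤ 2 * φ * √(S * F)) (h₂ : |n₂| ≤ 0.99 * φ * S) :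
    |steinShrink S φ (F + n₁ + n₂ + 2 * S) - F / (F + S)| * (F + S) ≤ 8 * φ * S ∧
    |steinShrink S φ (F + n₁ + n₂ + 2 * S) - F / (F + S)| * (F + S) ≤ 10 ^ 6 * F := by
  have hFS : 0 < F + S := by linarith
  have hφS : 0 < φ * S := mul_pos hφ hS
  set q := √(S * F) with hq
  have hq0 : 0 ≤ q := Real.sqrt_nonneg _
  have hqq : q ^ 2 = S * F := Real.sq_sqrt (by positivity)
  have hq1 : 2 * q ≤ S + F := by nlinarith [sq_nonneg (S - F), sq_nonneg (S + F)]
  obtain ⟨h1a, h1b⟩ := abs_le.1 h₁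
  obtain ⟨h2a, h2b⟩ := abs_le.1 h₂
  set X := F + n₁ + n₂ with hX
  have hXeq : F + n₁ + n₂ + 2 * S - 2 * S = X := by ring
  by_cases hc : X ≤ φ * S
  · -- The weight vanishes, which is only possible for small `F`.
    have hg : steinShrink S φ (X + 2 * S) = 0 := by
      unfold steinShrink
      refine max_eq_left ?_
      rw [sub_nonpos, le_div_iff₀ (by have := le_max_left 0 (X + 2 * S - 2 * S); linarith)]
      have : max 0 (X + 2 * S - 2 * S) ≤ φ * S := max_le hφS.le (by linarith)
      linarith
    rw [hg, zero_sub, abs_neg, abs_of_nonneg (by positivity), div_mul_cancel₀ _ hFS.ne']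
    -- `2 φ √(S F) ≤ F / 2 + 2 φ² S` by the inequality of arithmetic and geometric means
    have h4 : 2 * φ * q ≤ F / 2 + 2 * φ * (φ * S) := by
      have h6 : 0 ≤ F / 2 + 2 * φ * (φ * S) := by positivity
      refine le_of_sq_le_sq ?_ h6
      have h5 : (2 * φ * q) ^ 2 = 4 * (F / 2) * (2 * φ * (φ * S)) := by
        rw [mul_pow, hqq]; ring
      rw [h5]
      linarith [sq_nonneg (F / 2 - 2 * φ * (φ * S))]
    have h7 : φ * (φ * S) ≤ 1 / 8 * (φ * S) := mul_le_mul_of_nonneg_right hφ' hφS.le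
    have h8 : φ * S ≤ 1 / 8 * S := mul_le_mul_of_nonneg_right hφ' hS.le
    exact ⟨by linarith, by linarith⟩
  · push Not at hc
    have hXpos : 0 < X := hφS.trans hc
    have hg : steinShrink S φ (X + 2 * S) = 1 - S * (1 + φ) / (X + S) := by
      unfold steinShrink
      rw [show X + 2 * S - 2 * S = X by ring, max_eq_right hXpos.le]
      refine max_eq_right ?_
      rw [sub_nonneg, div_le_one (by linarith)]
      linarith
    have hXS : 0 < X + S := by linarith
    have hd : (steinShrink S φ (X + 2 * S) - F / (F + S)) * (F + S)
        = S * ((X - F) - φ * (F + S)) / (X + S) := by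
      rw [hg]; field_simp; ring
    have habs : |steinShrink S φ (X + 2 * S) - F / (F + S)| * (F + S)
        = S * |(X - F) - φ * (F + S)| / (X + S) := by
      rw [← abs_of_pos hFS, ← abs_mul, abs_of_pos hFS, hd, abs_div, abs_mul, abs_of_pos hS,
        abs_of_pos hXS]
    have hφF : φ * F ≤ 1 / 8 * F := mul_le_mul_of_nonneg_right hφ' hF
    have hφF0 : 0 ≤ φ * F := mul_nonneg hφ.le hF
    have h8 : φ * S ≤ 1 / 8 * S := mul_le_mul_of_nonneg_right hφ' hS.le
    have hφq : 2 * φ * q ≤ φ * S + φ * F := by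
      have := mul_le_mul_of_nonneg_left hq1 hφ.le
      linarith
    have hnum : |(X - F) - φ * (F + S)| ≤ 3 * φ * (F + S) := by
      rw [abs_le]
      constructor <;> linarith
    have hden : (F + S) / 2 ≤ X + S := by linarith
    have hmain : S * |(X - F) - φ * (F + S)| / (X + S) ≤ 6 * φ * S := by
      rw [div_le_iff₀ hXS]
      have : S * |(X - F) - φ * (F + S)| ≤ S * (3 * φ * (F + S)) :=
        mul_le_mul_of_nonneg_left hnum hS.le
      have h9 := mul_le_mul_of_nonneg_left hden (by positivity : 0 ≤ 6 * φ * S)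
      linarith
    -- The weight is positive, so the signal exceeds the gap between penalty and noise.
    have hFl : φ * S ≤ 10 ^ 5 * F := by
      have h4 : 2 * φ * q ≤ 400 * F + φ * (φ * S) / 400 := by
        have h5 : (2 * φ * q) ^ 2 = 4 * (400 * F) * (φ * (φ * S) / 400) := by
          rw [mul_pow, hqq]; ring
        have h6 : 0 ≤ 400 * F + φ * (φ * S) / 400 := by positivity
        refine le_of_sq_le_sq ?_ h6
        rw [h5]
        linarith [sq_nonneg (400 * F - φ * (φ * S) / 400)]
      have h7 : φ * (φ * S) ≤ 1 / 8 * (φ * S) := mul_le_mul_of_nonneg_right hφ' hφS.le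
      linarith
    rw [habs]
    exact ⟨by linarith, by linarith⟩

end ShiftModel

namespace ShiftModel

/-- The weight `g` is close to the oracle weight `F / (F + S)` of a block with signal `F` and noise
level `S`, all errors being measured by the oracle risk `F S / (F + S)` of the block. -/
structure IsCloseToOracle (F S φ g : ℝ) : Prop where
  sub_mul_signal : |g - F / (F + S)| * F ≤ 8 * φ * (F * S / (F + S))
  sub_mul_noise : |g - F / (F + S)| * S ≤ 10 ^ 6 * (F * S / (F + S))
  sub_mul_sqrt : |g - F / (F + S)| * √(S * F) ≤ 10 ^ 6 * (F * S / (F + S))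
  le_mul : g ≤ (10 ^ 6 + 1) * (F / (F + S))
  sq_sub_sq : |g ^ 2 - (F / (F + S)) ^ 2| * (F + S) ≤ 10 ^ 7 * φ * (F * S / (F + S))

lemma two_mul_sqrt_le {S F : ℝ} (hS : 0 ≤ S) (hF : 0 ≤ F) : 2 * √(S * F) ≤ S + F := by
  refine le_of_sq_le_sq ?_ (by positivity)
  rw [mul_pow, Real.sq_sqrt (by positivity)]
  linarith [sq_nonneg (S - F)]

lemma isCloseToOracle_of_abs_sub_le {F S φ g : ℝ} (hS : 0 < S) (hF : 0 ≤ F) (hφ : 0 < φ)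
    (hφ' : φ ≤ 1 / 8) (hg : 0 ≤ g) (h₁ : |g - F / (F + S)| * (F + S) ≤ 8 * φ * S)
    (h₂ : |g - F / (F + S)| * (F + S) ≤ 10 ^ 6 * F) : IsCloseToOracle F S φ g := by
  have hFS : 0 < F + S := by linarith
  set d := |g - F / (F + S)| with hd
  have hd0 : 0 ≤ d := abs_nonneg _
  have hq0 : 0 ≤ √(S * F) := Real.sqrt_nonneg _
  have hqq : √(S * F) ^ 2 = S * F := Real.sq_sqrt (by positivity)
  have hφS : 0 ≤ φ * S := by positivity
  have h0 : 0 ≤ F / (F + S) := by positivity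
  have hle : g ≤ (10 ^ 6 + 1) * (F / (F + S)) := by
    have h3 : d ≤ 10 ^ 6 * F / (F + S) := by rwa [le_div_iff₀ hFS]
    have h4 : g - F / (F + S) ≤ d := le_abs_self _
    have h5 : 10 ^ 6 * F / (F + S) = 10 ^ 6 * (F / (F + S)) := by ring
    linarith
  refine ⟨?_, ?_, ?_, hle, ?_⟩
  · rw [← mul_div_assoc, le_div_iff₀ hFS]
    have := mul_le_mul_of_nonneg_right h₁ hF
    linarith
  · rw [← mul_div_assoc, le_div_iff₀ hFS]
    have := mul_le_mul_of_nonneg_right h₂ hS.le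
    linarith
  · rw [← mul_div_assoc, le_div_iff₀ hFS]
    have h3 : d * (F + S) ≤ 10 ^ 6 * √(S * F) := by
      refine le_of_sq_le_sq ?_ (by positivity)
      have h4 : 8 * φ * S ≤ S := by
        have := mul_le_mul_of_nonneg_right hφ' hS.le
        linarith
      have h5 : (d * (F + S)) * (d * (F + S)) ≤ (8 * φ * S) * (10 ^ 6 * F) :=
        mul_le_mul h₁ h₂ (by positivity) (by positivity)
      have h6 : (8 * φ * S) * (10 ^ 6 * F) ≤ S * (10 ^ 6 * F) :=
        mul_le_mul_of_nonneg_right h4 (by positivity)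
      have h7 : 0 ≤ S * F := by positivity
      rw [mul_pow (10 ^ 6) (√(S * F)), hqq, sq]
      linarith
    have h4 := mul_le_mul_of_nonneg_right h3 hq0
    rw [mul_assoc (10 ^ 6), ← sq, hqq] at h4
    linarith
  · have h3 : |g ^ 2 - (F / (F + S)) ^ 2| = d * (g + F / (F + S)) := by
      rw [sq_sub_sq, abs_mul, abs_of_nonneg (by positivity : 0 ≤ g + F / (F + S)), mul_comm]
    rw [h3]
    have h4 : d * (g + F / (F + S)) * (F + S) = d * (F + S) * (g + F / (F + S)) := by ring
    rw [h4]
    have h5 : d * (F + S) * (g + F / (F + S)) ≤ 8 * φ * S * ((10 ^ 6 + 2) * (F / (F + S))) :=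
      mul_le_mul h₁ (by linarith) (by positivity) (by positivity)
    have h6 : 0 ≤ φ * S * (F / (F + S)) := by positivity
    have h7 : F * S / (F + S) = S * (F / (F + S)) := by ring
    rw [h7]
    linarith

/-! ### Block statistics of the observations -/

section Model

variable {N : ℕ} (B : Blocks N) (ε : ℝ) (c : ℕ → ℝ) (x : ℕ × Bool → ℝ)

/-- The filter with the value `g j` on the block `B_j`. -/
noncomputable def blockFilter (g : ℕ → ℝ) (k : ℕ) : ℝ :=
  ∑ j ∈ Finset.Icc 1 B.J, if k ∈ B.block j then g j else 0

variable {B} in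
lemma blockFilter_eq {g : ℕ → ℝ} {j k : ℕ} (hj : j ∈ Finset.Icc 1 B.J) (hk : k ∈ B.block j) :
    blockFilter B g k = g j := Blocks.sum_ite_block hj hk g

lemma sum_blockFilter_mul (g G : ℕ → ℝ) :
    ∑ k ∈ Finset.Icc 1 N, blockFilter B g k * G k
      = ∑ j ∈ Finset.Icc 1 B.J, g j * ∑ k ∈ B.block j, G k := by
  rw [← B.sum_block]
  refine Finset.sum_congr rfl fun j hj => ?_
  rw [Finset.mul_sum]
  exact Finset.sum_congr rfl fun k hk => by rw [blockFilter_eq hj hk]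

/-- The part of `∑ (2πk)² c_k²` carried by the block `B_j`. -/
noncomputable def blockSignal (j : ℕ) : ℝ := ∑ k ∈ B.block j, wt k * c k ^ 2

/-- The noise level `ε² σ_j²` of the block `B_j`. -/
noncomputable def blockNoise (j : ℕ) : ℝ := ε ^ 2 * B.sigmaSq j

/-- The minimizer `F_j / (F_j + S_j)` of the risk `(1 - h)² F_j + h² S_j` of the block `B_j`. -/
noncomputable def oracleWeight (j : ℕ) : ℝ :=
  blockSignal B c j / (blockSignal B c j + blockNoise B ε j)

/-- The minimum `F_j S_j / (F_j + S_j)` of the risk of the block `B_j`. -/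
noncomputable def blockRisk (j : ℕ) : ℝ :=
  blockSignal B c j * blockNoise B ε j / (blockSignal B c j + blockNoise B ε j)

/-- The oracle risk of a signal with `∑ (2πk)² c_k² = F`: the minimal risks of the blocks together
with the signal outside of the blocks. -/
noncomputable def oracleRisk (F : ℝ) : ℝ :=
  ∑ j ∈ Finset.Icc 1 B.J, blockRisk B ε c j + (F - ∑ j ∈ Finset.Icc 1 B.J, blockSignal B c j)

/-- The cosine observation of frequency `k`, for the origin at the true shift. -/
noncomputable def noisyRe (k : ℕ) : ℝ := c k + ε * x (k, true)

/-- The sine observation of frequency `k`, for the origin at the true shift. -/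
noncomputable def noisyIm (k : ℕ) : ℝ := ε * x (k, false)

/-- The observed energy of a block. -/
noncomputable def noisyEnergy (j : ℕ) : ℝ :=
  ∑ k ∈ B.block j, wt k * (noisyRe ε c x k ^ 2 + noisyIm ε x k ^ 2)

/-- The contribution of a block of weight one to `-∂²Φ` at the true shift. -/
noncomputable def blockCurv (j : ℕ) : ℝ :=
  ∑ k ∈ B.block j, wt k * (noisyRe ε c x k ^ 2 - noisyIm ε x k ^ 2)

/-- The sum of the squares of the terms of the score that belong to a block of weight one. -/
noncomputable def blockVar (j : ℕ) : ℝ :=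
  ∑ k ∈ B.block j, wt k * (noisyRe ε c x k * noisyIm ε x k) ^ 2

/-- The penalized Stein weight of the block `B_j`. -/
noncomputable def steinWeight (j : ℕ) : ℝ :=
  steinShrink (blockNoise B ε j) (penalty B ε j) (noisyEnergy B ε c x j)

/-- The derivative of the profile likelihood at the true shift. -/
noncomputable def score : ℝ :=
  ∑ k ∈ Finset.Icc 1 N,
    blockFilter B (steinWeight B ε c x) k * (2 * π * k) * (noisyRe ε c x k * noisyIm ε x k)

/-- Minus the second derivative, at the true shift, of the profile likelihood with block weights
`g`. -/
noncomputable def curv (g : ℕ → ℝ) : ℝ := ∑ j ∈ Finset.Icc 1 B.J, g j * blockCurv B ε c x j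

/-- The sum of the squares of the terms of the score with block weights `g`. -/
noncomputable def scoreVar (g : ℕ → ℝ) : ℝ := ∑ j ∈ Finset.Icc 1 B.J, g j ^ 2 * blockVar B ε c x j

/-- The good event: in each block the noise stays below the penalty, and the noise at the first
frequency is at most `Λ`. -/
structure IsGood (Λ : ℝ) : Prop where
  cross : ∀ j ∈ Finset.Icc 1 B.J, |∑ k ∈ B.block j, 2 * ε * (wt k * c k * x (k, true))|
    ≤ 2 * penalty B ε j * √(blockNoise B ε j * blockSignal B c j)
  both : ∀ j ∈ Finset.Icc 1 B.J,
    |∑ k ∈ B.block j, ε ^ 2 * (wt k * (x (k, true) ^ 2 + x (k, false) ^ 2 - 2))|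
      ≤ 0.99 * penalty B ε j * blockNoise B ε j
  re : ∀ j ∈ Finset.Icc 1 B.J, |∑ k ∈ B.block j, ε ^ 2 * (wt k * (x (k, true) ^ 2 - 1))|
    ≤ penalty B ε j * blockNoise B ε j
  first_re : |x (1, true)| ≤ Λ
  first_im : |x (1, false)| ≤ Λ

end Model

section Model

variable {N : ℕ} {B : Blocks N} {ε : ℝ} {c : ℕ → ℝ} {x : ℕ × Bool → ℝ} {Λ φ F : ℝ} {j : ℕ}

lemma blockSignal_nonneg : 0 ≤ blockSignal B c j :=
  Finset.sum_nonneg fun k _ => mul_nonneg (wt_nonneg k) (sq_nonneg _)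

lemma blockNoise_pos (hε : 0 < ε) (hj : j ∈ Finset.Icc 1 B.J) : 0 < blockNoise B ε j :=
  mul_pos (by positivity) (Blocks.sigmaSq_pos hj)

lemma blockNoise_nonneg : 0 ≤ blockNoise B ε j :=
  mul_nonneg (sq_nonneg _) (Finset.sum_nonneg fun _ _ => sq_nonneg _)

lemma blockNoise_eq_sum : blockNoise B ε j = ∑ k ∈ B.block j, ε ^ 2 * wt k := by
  rw [blockNoise, Blocks.sigmaSq_eq, Finset.mul_sum]

lemma oracleWeight_nonneg : 0 ≤ oracleWeight B ε c j :=
  div_nonneg blockSignal_nonneg (add_nonneg blockSignal_nonneg blockNoise_nonneg)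

lemma oracleWeight_le_one : oracleWeight B ε c j ≤ 1 :=
  div_le_one_of_le₀ (by linarith [blockNoise_nonneg (B := B) (ε := ε) (j := j)])
    (add_nonneg blockSignal_nonneg blockNoise_nonneg)

lemma blockRisk_nonneg : 0 ≤ blockRisk B ε c j :=
  div_nonneg (mul_nonneg blockSignal_nonneg blockNoise_nonneg)
    (add_nonneg blockSignal_nonneg blockNoise_nonneg)

lemma blockRisk_eq : blockRisk B ε c j = oracleWeight B ε c j * blockNoise B ε j := by
  rw [blockRisk, oracleWeight]; ring

lemma oracleWeight_mul_blockSignal (hε : 0 < ε) (hj : j ∈ Finset.Icc 1 B.J) :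
    oracleWeight B ε c j * blockSignal B c j = blockSignal B c j - blockRisk B ε c j := by
  have := blockNoise_pos hε hj
  have := blockSignal_nonneg (B := B) (c := c) (j := j)
  rw [oracleWeight, blockRisk]
  field_simp
  ring

lemma oracleWeight_mul_add (hε : 0 < ε) (hj : j ∈ Finset.Icc 1 B.J) :
    oracleWeight B ε c j * (blockSignal B c j + blockNoise B ε j) = blockSignal B c j := by
  have := blockNoise_pos hε hj
  have := blockSignal_nonneg (B := B) (c := c) (j := j)
  rw [oracleWeight, div_mul_cancel₀]
  positivity

lemma blockVar_nonneg : 0 ≤ blockVar B ε c x j :=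
  Finset.sum_nonneg fun k _ => mul_nonneg (wt_nonneg k) (sq_nonneg _)

lemma steinWeight_nonneg : 0 ≤ steinWeight B ε c x j := steinShrink_nonneg _ _ _

lemma steinWeight_le_one (hε : 0 < ε) (hj : j ∈ Finset.Icc 1 B.J) :
    steinWeight B ε c x j ≤ 1 :=
  steinShrink_le_one (blockNoise_pos hε hj) (Real.sqrt_nonneg _) _

/-- The noise in the observed energy: cross term and pure noise. -/
lemma noisyEnergy_eq : noisyEnergy B ε c x j
    = blockSignal B c j + (∑ k ∈ B.block j, 2 * ε * (wt k * c k * x (k, true)))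
      + (∑ k ∈ B.block j, ε ^ 2 * (wt k * (x (k, true) ^ 2 + x (k, false) ^ 2 - 2)))
      + 2 * blockNoise B ε j := by
  rw [noisyEnergy, blockSignal, blockNoise_eq_sum, Finset.mul_sum, ← Finset.sum_add_distrib,
    ← Finset.sum_add_distrib, ← Finset.sum_add_distrib]
  exact Finset.sum_congr rfl fun k _ => by rw [noisyRe, noisyIm]; ring

lemma blockCurv_eq : blockCurv B ε c x j
    = blockSignal B c j + ∑ k ∈ B.block j, wt k * (2 * ε * c k * x (k, true)
      + ε ^ 2 * (x (k, true) ^ 2 - x (k, false) ^ 2)) := by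
  rw [blockCurv, blockSignal, ← Finset.sum_add_distrib]
  exact Finset.sum_congr rfl fun k _ => by rw [noisyRe, noisyIm]; ring

namespace IsGood

lemma isCloseToOracle (h : IsGood B ε c x Λ) (hε : 0 < ε) (hj : j ∈ Finset.Icc 1 B.J)
    (hφ0 : 0 < penalty B ε j) (hφ : penalty B ε j ≤ 1 / 8) :
    IsCloseToOracle (blockSignal B c j) (blockNoise B ε j) (penalty B ε j)
      (steinWeight B ε c x j) := by
  have hS := blockNoise_pos hε hj
  have h1 := abs_steinShrink_sub_le hS (blockSignal_nonneg (B := B) (c := c) (j := j)) hφ0 hφ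
    (h.cross j hj) (h.both j hj)
  rw [← noisyEnergy_eq] at h1
  exact isCloseToOracle_of_abs_sub_le hS blockSignal_nonneg hφ0 hφ steinWeight_nonneg h1.1 h1.2

lemma abs_blockCurv_sub_le (h : IsGood B ε c x Λ) (hj : j ∈ Finset.Icc 1 B.J) :
    |blockCurv B ε c x j - blockSignal B c j|
      ≤ 2 * penalty B ε j * √(blockNoise B ε j * blockSignal B c j)
        + 3 * (penalty B ε j * blockNoise B ε j) := by
  have h1 := abs_le.1 (h.cross j hj)
  have h2 := abs_le.1 (h.both j hj)
  have h3 := abs_le.1 (h.re j hj)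
  have hS := blockNoise_nonneg (B := B) (ε := ε) (j := j)
  have hp : 0 ≤ penalty B ε j * blockNoise B ε j := mul_nonneg (Real.sqrt_nonneg _) hS
  have h4 : blockCurv B ε c x j - blockSignal B c j
      = ∑ k ∈ B.block j, 2 * ε * (wt k * c k * x (k, true))
        + 2 * ∑ k ∈ B.block j, ε ^ 2 * (wt k * (x (k, true) ^ 2 - 1))
        - ∑ k ∈ B.block j, ε ^ 2 * (wt k * (x (k, true) ^ 2 + x (k, false) ^ 2 - 2)) := by
    rw [blockCurv_eq, add_sub_cancel_left, Finset.mul_sum, ← Finset.sum_add_distrib,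
      ← Finset.sum_sub_distrib]
    exact Finset.sum_congr rfl fun k _ => by ring
  rw [h4, abs_le]
  constructor <;> linarith [h1.1, h1.2, h2.1, h2.2, h3.1, h3.2]

lemma sum_noisyIm_sq_le (h : IsGood B ε c x Λ) (hj : j ∈ Finset.Icc 1 B.J)
    (hφ : penalty B ε j ≤ 1 / 8) :
    ∑ k ∈ B.block j, wt k * noisyIm ε x k ^ 2 ≤ 2 * blockNoise B ε j := by
  have h2 := abs_le.1 (h.both j hj)
  have h3 := abs_le.1 (h.re j hj)
  have hS := blockNoise_nonneg (B := B) (ε := ε) (j := j)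
  have hp : penalty B ε j * blockNoise B ε j ≤ 1 / 8 * blockNoise B ε j :=
    mul_le_mul_of_nonneg_right hφ hS
  have h4 : ∑ k ∈ B.block j, wt k * noisyIm ε x k ^ 2
      = (∑ k ∈ B.block j, ε ^ 2 * (wt k * (x (k, true) ^ 2 + x (k, false) ^ 2 - 2)))
        - (∑ k ∈ B.block j, ε ^ 2 * (wt k * (x (k, true) ^ 2 - 1))) + blockNoise B ε j := by
    rw [blockNoise_eq_sum, ← Finset.sum_sub_distrib, ← Finset.sum_add_distrib]
    exact Finset.sum_congr rfl fun k _ => by rw [noisyIm]; ring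
  rw [h4]
  linarith [h2.1, h2.2, h3.1, h3.2]

lemma noisyEnergy_le (h : IsGood B ε c x Λ) (hj : j ∈ Finset.Icc 1 B.J)
    (hφ : penalty B ε j ≤ 1 / 8) :
    noisyEnergy B ε c x j ≤ 4 * (blockSignal B c j + blockNoise B ε j) := by
  have h1 := abs_le.1 (h.cross j hj)
  have h2 := abs_le.1 (h.both j hj)
  have hS := blockNoise_nonneg (B := B) (ε := ε) (j := j)
  have hF := blockSignal_nonneg (B := B) (c := c) (j := j)
  have hp : penalty B ε j * blockNoise B ε j ≤ 1 / 8 * blockNoise B ε j :=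
    mul_le_mul_of_nonneg_right hφ hS
  have hq : 2 * √(blockNoise B ε j * blockSignal B c j) ≤ blockNoise B ε j + blockSignal B c j :=
    two_mul_sqrt_le hS hF
  have hp2 : penalty B ε j * √(blockNoise B ε j * blockSignal B c j)
      ≤ 1 / 8 * √(blockNoise B ε j * blockSignal B c j) :=
    mul_le_mul_of_nonneg_right hφ (Real.sqrt_nonneg _)
  rw [noisyEnergy_eq]
  linarith [h1.2, h2.2]

end IsGood

end Model

end ShiftModel

namespace ShiftModel

/-! ### The good event: comparison with the oracle -/

section Model

variable {N : ℕ} {B : Blocks N} {ε : ℝ} {c : ℕ → ℝ} {x : ℕ × Bool → ℝ} {Λ φ F τ : ℝ} {j : ℕ}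

/-- The regime of small noise: all penalties are at most the small number `φ`, all blocks have
length at least `τ`, the noise levels are at most one, and the oracle risk is small against the
total signal `F`. -/
structure IsRegular {N : ℕ} (B : Blocks N) (ε : ℝ) (c : ℕ → ℝ) (F φ τ : ℝ) : Prop where
  ε_pos : 0 < ε
  F_pos : 0 < F
  penalty_pos : ∀ j ∈ Finset.Icc 1 B.J, 0 < penalty B ε j
  penalty_le : ∀ j ∈ Finset.Icc 1 B.J, penalty B ε j ≤ φ
  φ_le : φ ≤ 10⁻¹ ^ 8
  one_le_τ : 1 ≤ τ
  τ_le : ∀ j ∈ Finset.Icc 1 B.J, τ ≤ B.len j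
  noise_le : ∑ j ∈ Finset.Icc 1 B.J, blockNoise B ε j ≤ 1
  signal_le : ∑ j ∈ Finset.Icc 1 B.J, blockSignal B c j ≤ F
  risk_le : oracleRisk B ε c F ≤ F / 8

namespace IsRegular

lemma φ_pos (h : IsRegular B ε c F φ τ) : 0 < φ :=
  (h.penalty_pos 1 B.one_mem).trans_le (h.penalty_le 1 B.one_mem)

lemma penalty_le_eighth (h : IsRegular B ε c F φ τ) (hj : j ∈ Finset.Icc 1 B.J) :
    penalty B ε j ≤ 1 / 8 :=
  (h.penalty_le j hj).trans (h.φ_le.trans (by norm_num))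

lemma sum_blockRisk_le (h : IsRegular B ε c F φ τ) :
    ∑ j ∈ Finset.Icc 1 B.J, blockRisk B ε c j ≤ oracleRisk B ε c F := by
  have := h.signal_le
  unfold oracleRisk
  linarith

lemma oracleRisk_nonneg (h : IsRegular B ε c F φ τ) : 0 ≤ oracleRisk B ε c F :=
  (Finset.sum_nonneg fun _ _ => blockRisk_nonneg).trans h.sum_blockRisk_le

lemma blockSignal_le (h : IsRegular B ε c F φ τ) (hj : j ∈ Finset.Icc 1 B.J) :
    blockSignal B c j ≤ F :=
  (Finset.single_le_sum (f := fun j => blockSignal B c j) (fun _ _ => blockSignal_nonneg) hj).trans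
    h.signal_le

lemma blockNoise_le (h : IsRegular B ε c F φ τ) (hj : j ∈ Finset.Icc 1 B.J) :
    blockNoise B ε j ≤ 1 :=
  (Finset.single_le_sum (f := fun j => blockNoise B ε j) (fun _ _ => blockNoise_nonneg) hj).trans
    h.noise_le

end IsRegular

/-- The noise in the curvature of the profile likelihood with the oracle weights. -/
noncomputable def curvNoise {N : ℕ} (B : Blocks N) (ε : ℝ) (c : ℕ → ℝ) (x : ℕ × Bool → ℝ) : ℝ :=
  ∑ j ∈ Finset.Icc 1 B.J, oracleWeight B ε c j * (blockCurv B ε c x j - blockSignal B c j)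

lemma curv_oracle_eq (h : IsRegular B ε c F φ τ) :
    curv B ε c x (oracleWeight B ε c) = F - oracleRisk B ε c F + curvNoise B ε c x := by
  have h1 : curv B ε c x (oracleWeight B ε c)
      = ∑ j ∈ Finset.Icc 1 B.J, (blockSignal B c j - blockRisk B ε c j) + curvNoise B ε c x := by
    rw [curv, curvNoise, ← Finset.sum_add_distrib]
    refine Finset.sum_congr rfl fun j hj => ?_
    rw [← oracleWeight_mul_blockSignal h.ε_pos hj]
    ring
  rw [h1, Finset.sum_sub_distrib, oracleRisk]
  ring

lemma IsGood.abs_curvNoise_le (hx : IsGood B ε c x Λ) (h : IsRegular B ε c F φ τ) :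
    |curvNoise B ε c x| ≤ 4 * φ * F := by
  have hφ := h.φ_pos
  have h1 : ∀ j ∈ Finset.Icc 1 B.J,
      |oracleWeight B ε c j * (blockCurv B ε c x j - blockSignal B c j)|
        ≤ 4 * φ * blockSignal B c j := by
    intro j hj
    have h2 := hx.abs_blockCurv_sub_le hj
    have hS := blockNoise_nonneg (B := B) (ε := ε) (j := j)
    have hF := blockSignal_nonneg (B := B) (c := c) (j := j)
    have hw := oracleWeight_nonneg (B := B) (ε := ε) (c := c) (j := j)
    have hq := two_mul_sqrt_le hS hF
    have hq0 : 0 ≤ √(blockNoise B ε j * blockSignal B c j) := Real.sqrt_nonneg _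
    have h3 : 2 * penalty B ε j * √(blockNoise B ε j * blockSignal B c j)
        + 3 * (penalty B ε j * blockNoise B ε j)
        ≤ φ * (4 * (blockSignal B c j + blockNoise B ε j)) := by
      calc _ = penalty B ε j * (2 * √(blockNoise B ε j * blockSignal B c j)
            + 3 * blockNoise B ε j) := by ring
        _ ≤ φ * (4 * (blockSignal B c j + blockNoise B ε j)) :=
          mul_le_mul (h.penalty_le j hj) (by linarith) (by positivity) hφ.le
    rw [abs_mul, abs_of_nonneg hw]
    calc _ ≤ oracleWeight B ε c j * (φ * (4 * (blockSignal B c j + blockNoise B ε j))) :=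
          mul_le_mul_of_nonneg_left (h2.trans h3) hw
      _ = 4 * φ * (oracleWeight B ε c j * (blockSignal B c j + blockNoise B ε j)) := by ring
      _ = _ := by rw [oracleWeight_mul_add h.ε_pos hj]
  refine (Finset.abs_sum_le_sum_abs _ _).trans ((Finset.sum_le_sum h1).trans ?_)
  rw [← Finset.mul_sum]
  exact mul_le_mul_of_nonneg_left h.signal_le (by positivity)

lemma IsGood.abs_curv_sub_le (hx : IsGood B ε c x Λ) (h : IsRegular B ε c F φ τ) :
    |curv B ε c x (steinWeight B ε c x) - curv B ε c x (oracleWeight B ε c)|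
      ≤ 10 ^ 7 * φ * oracleRisk B ε c F := by
  have hφ := h.φ_pos
  have h1 : ∀ j ∈ Finset.Icc 1 B.J,
      |steinWeight B ε c x j * blockCurv B ε c x j - oracleWeight B ε c j * blockCurv B ε c x j|
        ≤ 10 ^ 7 * φ * blockRisk B ε c j := by
    intro j hj
    have hpp := h.penalty_pos j hj
    have hcl := hx.isCloseToOracle h.ε_pos hj hpp (h.penalty_le_eighth hj)
    have h2 := abs_le.1 (hx.abs_blockCurv_sub_le hj)
    have hS := blockNoise_nonneg (B := B) (ε := ε) (j := j)
    have hF := blockSignal_nonneg (B := B) (c := c) (j := j)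
    have hq0 : 0 ≤ √(blockNoise B ε j * blockSignal B c j) := Real.sqrt_nonneg _
    have hc1 := hcl.sub_mul_signal
    have hc2 := hcl.sub_mul_noise
    have hc3 := hcl.sub_mul_sqrt
    rw [← sub_mul, abs_mul]
    change |steinWeight B ε c x j - oracleWeight B ε c j| * _
      ≤ 8 * penalty B ε j * blockRisk B ε c j at hc1
    change |steinWeight B ε c x j - oracleWeight B ε c j| * _
      ≤ 10 ^ 6 * blockRisk B ε c j at hc2
    change |steinWeight B ε c x j - oracleWeight B ε c j| * _
      ≤ 10 ^ 6 * blockRisk B ε c j at hc3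
    set d := |steinWeight B ε c x j - oracleWeight B ε c j|
    have hd : 0 ≤ d := abs_nonneg _
    have h3 : |blockCurv B ε c x j| ≤ blockSignal B c j
        + penalty B ε j * (2 * √(blockNoise B ε j * blockSignal B c j) + 3 * blockNoise B ε j) := by
      rw [abs_le]
      constructor <;> linarith [h2.1, h2.2]
    calc d * |blockCurv B ε c x j|
        ≤ d * (blockSignal B c j + penalty B ε j
          * (2 * √(blockNoise B ε j * blockSignal B c j) + 3 * blockNoise B ε j)) :=
          mul_le_mul_of_nonneg_left h3 hd
      _ = d * blockSignal B c j + penalty B ε j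
          * (2 * (d * √(blockNoise B ε j * blockSignal B c j)) + 3 * (d * blockNoise B ε j)) := by
          ring
      _ ≤ 8 * penalty B ε j * blockRisk B ε c j + penalty B ε j
          * (2 * (10 ^ 6 * blockRisk B ε c j) + 3 * (10 ^ 6 * blockRisk B ε c j)) := by
          gcongr
      _ = penalty B ε j * ((5 * 10 ^ 6 + 8) * blockRisk B ε c j) := by ring
      _ ≤ φ * (10 ^ 7 * blockRisk B ε c j) :=
          mul_le_mul (h.penalty_le j hj)
            (mul_le_mul_of_nonneg_right (by norm_num) blockRisk_nonneg)
            (mul_nonneg (by norm_num) blockRisk_nonneg) hφ.le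
      _ = _ := by ring
  rw [curv, curv, ← Finset.sum_sub_distrib]
  refine (Finset.abs_sum_le_sum_abs _ _).trans ((Finset.sum_le_sum h1).trans ?_)
  rw [← Finset.mul_sum]
  exact mul_le_mul_of_nonneg_left h.sum_blockRisk_le (by positivity)

lemma IsGood.curv_oracle_mem (hx : IsGood B ε c x Λ) (h : IsRegular B ε c F φ τ) :
    F / 2 ≤ curv B ε c x (oracleWeight B ε c) ∧ curv B ε c x (oracleWeight B ε c) ≤ 3 / 2 * F := by
  have h1 := abs_le.1 (hx.abs_curvNoise_le h)
  have h2 := h.risk_le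
  have h3 := h.oracleRisk_nonneg
  have h4 : φ * F ≤ 10⁻¹ ^ 8 * F := mul_le_mul_of_nonneg_right h.φ_le h.F_pos.le
  have := h.F_pos
  rw [curv_oracle_eq h]
  norm_num at h4
  constructor <;> linarith [h1.1, h1.2]

lemma IsGood.curv_stein_mem (hx : IsGood B ε c x Λ) (h : IsRegular B ε c F φ τ) :
    F / 2 ≤ curv B ε c x (steinWeight B ε c x) ∧
      curv B ε c x (steinWeight B ε c x) ≤ 3 / 2 * F := by
  have h1 := abs_le.1 (hx.abs_curvNoise_le h)
  have h2 := h.risk_le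
  have h3 := h.oracleRisk_nonneg
  have h4 : φ * F ≤ 10⁻¹ ^ 8 * F := mul_le_mul_of_nonneg_right h.φ_le h.F_pos.le
  have h5 := abs_le.1 (hx.abs_curv_sub_le h)
  have h6 : φ * oracleRisk B ε c F ≤ 10⁻¹ ^ 8 * oracleRisk B ε c F :=
    mul_le_mul_of_nonneg_right h.φ_le h3
  have := h.F_pos
  rw [curv_oracle_eq h] at h5
  norm_num at h4 h6
  constructor <;> linarith [h1.1, h1.2, h5.1, h5.2]

lemma scoreVar_nonneg (g : ℕ → ℝ) : 0 ≤ scoreVar B ε c x g :=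
  Finset.sum_nonneg fun _ _ => mul_nonneg (sq_nonneg _) blockVar_nonneg

/-- The bound for the difference of the score variances with the Stein weights and with the oracle
weights, up to a factor `φ`. -/
noncomputable def varExcess {N : ℕ} (B : Blocks N) (ε : ℝ) (c : ℕ → ℝ) (x : ℕ × Bool → ℝ) : ℝ :=
  ∑ j ∈ Finset.Icc 1 B.J,
    blockRisk B ε c j / (blockSignal B c j + blockNoise B ε j) * blockVar B ε c x j

lemma varExcess_nonneg : 0 ≤ varExcess B ε c x :=
  Finset.sum_nonneg fun _ _ => mul_nonneg
    (div_nonneg blockRisk_nonneg (add_nonneg blockSignal_nonneg blockNoise_nonneg)) blockVar_nonneg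

lemma IsGood.scoreVar_le (hx : IsGood B ε c x Λ) (h : IsRegular B ε c F φ τ) :
    scoreVar B ε c x (steinWeight B ε c x)
      ≤ scoreVar B ε c x (oracleWeight B ε c) + 10 ^ 7 * φ * varExcess B ε c x := by
  have hφ := h.φ_pos
  rw [scoreVar, scoreVar, varExcess, Finset.mul_sum, ← Finset.sum_add_distrib]
  refine Finset.sum_le_sum fun j hj => ?_
  have hpp := h.penalty_pos j hj
  have hcl := (hx.isCloseToOracle h.ε_pos hj hpp (h.penalty_le_eighth hj)).sq_sub_sq
  have hV := blockVar_nonneg (B := B) (ε := ε) (c := c) (x := x) (j := j)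
  have hS := blockNoise_pos (B := B) h.ε_pos hj
  have hF := blockSignal_nonneg (B := B) (c := c) (j := j)
  change |steinWeight B ε c x j ^ 2 - oracleWeight B ε c j ^ 2| * _
    ≤ 10 ^ 7 * penalty B ε j * blockRisk B ε c j at hcl
  have h1 : steinWeight B ε c x j ^ 2 - oracleWeight B ε c j ^ 2
      ≤ 10 ^ 7 * φ * (blockRisk B ε c j / (blockSignal B c j + blockNoise B ε j)) := by
    rw [← mul_div_assoc, le_div_iff₀ (by positivity)]
    refine (mul_le_mul_of_nonneg_right (le_abs_self _) (by positivity)).trans (hcl.trans ?_)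
    have := h.penalty_le j hj
    have hR := blockRisk_nonneg (B := B) (ε := ε) (c := c) (j := j)
    gcongr
  have := mul_le_mul_of_nonneg_right h1 hV
  linarith

/-- The majorant of `V / D²` on the good event: `V / F²` for the oracle weights, expanded in the
relative error of the curvature up to second order, and two remainders of relative size `φ`. -/
noncomputable def ratioBound {N : ℕ} (B : Blocks N) (ε : ℝ) (c : ℕ → ℝ) (F φ : ℝ)
    (x : ℕ × Bool → ℝ) : ℝ :=
  scoreVar B ε c x (oracleWeight B ε c) / F ^ 2
      * (1 + 2 * ((oracleRisk B ε c F - curvNoise B ε c x) / F)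
        + 8 * ((oracleRisk B ε c F - curvNoise B ε c x) / F) ^ 2)
    + 48 * 10 ^ 7 * φ * oracleRisk B ε c F / F ^ 3 * scoreVar B ε c x (oracleWeight B ε c)
    + 4 * 10 ^ 7 * φ / F ^ 2 * varExcess B ε c x

lemma one_add_two_mul_add_nonneg (y : ℝ) : 0 ≤ 1 + 2 * y + 8 * y ^ 2 := by
  linarith [sq_nonneg (y + 1), sq_nonneg y]

lemma ratioBound_nonneg (h : IsRegular B ε c F φ τ) : 0 ≤ ratioBound B ε c F φ x := by
  have h1 := h.φ_pos
  have h2 := h.oracleRisk_nonneg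
  have h3 := scoreVar_nonneg (B := B) (ε := ε) (c := c) (x := x) (oracleWeight B ε c)
  have h4 := varExcess_nonneg (B := B) (ε := ε) (c := c) (x := x)
  have h5 := one_add_two_mul_add_nonneg ((oracleRisk B ε c F - curvNoise B ε c x) / F)
  have h6 := h.F_pos
  unfold ratioBound
  positivity

lemma inv_one_sub_sq_le {y : ℝ} (hy : y ≤ 1 / 2) :
    1 / (1 - y) ^ 2 ≤ 1 + 2 * y + 8 * y ^ 2 := by
  have h0 : 0 < 1 - y := by linarith
  rw [div_le_iff₀ (by positivity)]
  have : 0 ≤ y ^ 2 * ((1 - 2 * y) * (5 - 4 * y)) :=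
    mul_nonneg (sq_nonneg _) (mul_nonneg (by linarith) (by linarith))
  linarith

lemma IsGood.scoreVar_div_le (hx : IsGood B ε c x Λ) (h : IsRegular B ε c F φ τ) :
    scoreVar B ε c x (steinWeight B ε c x) / curv B ε c x (steinWeight B ε c x) ^ 2
      ≤ ratioBound B ε c F φ x := by
  have hF := h.F_pos
  have hφ := h.φ_pos
  have hR := h.oracleRisk_nonneg
  obtain ⟨ha1, ha2⟩ := hx.curv_stein_mem h
  obtain ⟨hb1, hb2⟩ := hx.curv_oracle_mem h
  have hV := hx.scoreVar_le h
  have hD := hx.abs_curv_sub_le h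
  have hVb := scoreVar_nonneg (B := B) (ε := ε) (c := c) (x := x) (oracleWeight B ε c)
  have he := varExcess_nonneg (B := B) (ε := ε) (c := c) (x := x)
  have hDbar := curv_oracle_eq h (x := x)
  unfold ratioBound
  set Da := curv B ε c x (steinWeight B ε c x)
  set Db := curv B ε c x (oracleWeight B ε c)
  set V := scoreVar B ε c x (oracleWeight B ε c)
  set E := varExcess B ε c x
  set R := oracleRisk B ε c F
  set y := (R - curvNoise B ε c x) / F with hy
  have hDa : 0 < Da := by linarith
  have hDb : 0 < Db := by linarith
  have hDy : Db = F * (1 - y) := by rw [hy, hDbar]; field_simp; ring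
  have hy2 : y ≤ 1 / 2 := by
    rw [hDy] at hb1
    have : F * (1 / 2) ≤ F * (1 - y) := by linarith
    linarith [le_of_mul_le_mul_left this hF]
  have h1 : V / Db ^ 2 ≤ V / F ^ 2 * (1 + 2 * y + 8 * y ^ 2) := by
    have : V / Db ^ 2 = V / F ^ 2 * (1 / (1 - y) ^ 2) := by
      rw [hDy, mul_pow, div_mul_div_comm, mul_one]
    rw [this]
    exact mul_le_mul_of_nonneg_left (inv_one_sub_sq_le hy2) (by positivity)
  have h2 : 1 / Da ^ 2 - 1 / Db ^ 2 ≤ 48 * (10 ^ 7 * φ * R) / F ^ 3 := by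
    have e1 : 1 / Da ^ 2 - 1 / Db ^ 2 = (Db - Da) * (Db + Da) / (Da * Db) ^ 2 := by
      field_simp; ring
    have e2 : (Db - Da) * (Db + Da) ≤ 10 ^ 7 * φ * R * (3 * F) := by
      have : Db - Da ≤ |Da - Db| := by rw [abs_sub_comm]; exact le_abs_self _
      exact mul_le_mul (this.trans hD) (by linarith) (by linarith) (by positivity)
    have e3 : (F ^ 2 / 4) ^ 2 ≤ (Da * Db) ^ 2 := by
      have : F ^ 2 / 4 ≤ Da * Db := by
        calc F ^ 2 / 4 = F / 2 * (F / 2) := by ring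
          _ ≤ Da * Db := mul_le_mul ha1 hb1 (by positivity) hDa.le
      gcongr
    rw [e1, div_le_div_iff₀ (by positivity) (by positivity)]
    calc (Db - Da) * (Db + Da) * F ^ 3 ≤ 10 ^ 7 * φ * R * (3 * F) * F ^ 3 := by gcongr
      _ = 48 * (10 ^ 7 * φ * R) * (F ^ 2 / 4) ^ 2 := by ring
      _ ≤ _ := by gcongr
  have h3 : 1 / Da ^ 2 ≤ 4 / F ^ 2 := by
    rw [div_le_div_iff₀ (by positivity) (by positivity)]
    have : (F / 2) ^ 2 ≤ Da ^ 2 := by gcongr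
    linarith
  calc scoreVar B ε c x (steinWeight B ε c x) / Da ^ 2
      ≤ (V + 10 ^ 7 * φ * E) / Da ^ 2 := by gcongr
    _ = V / Db ^ 2 + (1 / Da ^ 2 - 1 / Db ^ 2) * V + 1 / Da ^ 2 * (10 ^ 7 * φ * E) := by ring
    _ ≤ V / F ^ 2 * (1 + 2 * y + 8 * y ^ 2) + 48 * (10 ^ 7 * φ * R) / F ^ 3 * V
        + 4 / F ^ 2 * (10 ^ 7 * φ * E) := by gcongr
    _ = _ := by ring

/-! ### Expansion of the profile likelihood at the true shift -/

/-- The factor of the quadratic term in the expansion of `∂Φ` at the true shift. -/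
noncomputable def cubicTerm {N : ℕ} (B : Blocks N) (ε : ℝ) (c : ℕ → ℝ) (x : ℕ × Bool → ℝ) : ℝ :=
  ∑ k ∈ Finset.Icc 1 N, blockFilter B (steinWeight B ε c x) k
    * ((2 * π * k) * wt k * |noisyRe ε c x k * noisyIm ε x k|)

/-- The factor of the cubic term in the expansion of `∂Φ` at the true shift. -/
noncomputable def quarticTerm {N : ℕ} (B : Blocks N) (ε : ℝ) (c : ℕ → ℝ) (x : ℕ × Bool → ℝ) : ℝ :=
  ∑ k ∈ Finset.Icc 1 N, blockFilter B (steinWeight B ε c x) k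
    * (wt k * (wt k * (noisyRe ε c x k ^ 2 + noisyIm ε x k ^ 2)))

/-- The bound for the terms of higher order in the expansion of `∂Φ`. -/
noncomputable def remainderBound {N : ℕ} (B : Blocks N) (ε : ℝ) (c : ℕ → ℝ) (F τ : ℝ) : ℝ :=
  2 * 10 ^ 7 * (F + 1) * oracleRisk B ε c F / √τ

lemma IsGood.stein_mul_noise_le (hx : IsGood B ε c x Λ) (h : IsRegular B ε c F φ τ)
    (hj : j ∈ Finset.Icc 1 B.J) :
    steinWeight B ε c x j * blockNoise B ε j ≤ (10 ^ 6 + 1) * blockRisk B ε c j := by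
  have hle := (hx.isCloseToOracle h.ε_pos hj (h.penalty_pos j hj) (h.penalty_le_eighth hj)).le_mul
  have := mul_le_mul_of_nonneg_right hle (blockNoise_nonneg (B := B) (ε := ε) (j := j))
  refine this.trans (le_of_eq ?_)
  rw [blockRisk]
  ring

lemma IsRegular.wt_mul_le (h : IsRegular B ε c F φ τ) (hj : j ∈ Finset.Icc 1 B.J) {k : ℕ}
    (hk : k ∈ B.block j) : ε ^ 2 * τ * wt k ≤ 3 * blockNoise B ε j := by
  have h1 := Blocks.wt_mul_len_le hj hk
  have h2 := mul_le_mul_of_nonneg_left (h.τ_le j hj) (wt_nonneg k)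
  have h3 := mul_le_mul_of_nonneg_left (h2.trans h1) (sq_nonneg ε)
  rw [blockNoise]
  linarith

lemma IsGood.sum_cubic_le (hx : IsGood B ε c x Λ) (h : IsRegular B ε c F φ τ)
    (hj : j ∈ Finset.Icc 1 B.J) :
    ε * √τ * ∑ k ∈ B.block j, (2 * π * k) * wt k * |noisyRe ε c x k * noisyIm ε x k|
      ≤ 5 * (F + 1) * blockNoise B ε j := by
  have hε := h.ε_pos
  have hτ : 0 < τ := zero_lt_one.trans_le h.one_le_τ
  have hF := h.F_pos
  have hS := blockNoise_nonneg (B := B) (ε := ε) (j := j)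
  have hFj := blockSignal_nonneg (B := B) (c := c) (j := j)
  refine le_of_sq_le_sq ?_ (by positivity)
  -- Cauchy's inequality, after bounding one factor `2πk` by its maximum on the block
  have h1 : (∑ k ∈ B.block j, (2 * π * k) * wt k * |noisyRe ε c x k * noisyIm ε x k|) ^ 2
      ≤ (∑ k ∈ B.block j, wt k * (wt k * noisyRe ε c x k ^ 2))
        * ∑ k ∈ B.block j, wt k * noisyIm ε x k ^ 2 := by
    have h2 := Finset.sum_mul_sq_le_sq_mul_sq (B.block j)
      (fun k => wt k * |noisyRe ε c x k|) (fun k => (2 * π * k) * |noisyIm ε x k|)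
    refine le_of_eq_of_le ?_ (h2.trans (le_of_eq ?_))
    · congr 1
      exact Finset.sum_congr rfl fun k _ => by rw [abs_mul]; ring
    · congr 1
      · exact Finset.sum_congr rfl fun k _ => by rw [mul_pow, sq_abs]; ring
      · exact Finset.sum_congr rfl fun k _ => by rw [mul_pow, sq_abs]; rfl
  have h3 : ε ^ 2 * τ * ∑ k ∈ B.block j, wt k * (wt k * noisyRe ε c x k ^ 2)
      ≤ 3 * blockNoise B ε j * noisyEnergy B ε c x j := by
    rw [noisyEnergy, Finset.mul_sum, Finset.mul_sum]
    refine Finset.sum_le_sum fun k hk => ?_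
    have h4 := h.wt_mul_le hj hk
    have h5 : wt k * noisyRe ε c x k ^ 2 ≤ wt k * (noisyRe ε c x k ^ 2 + noisyIm ε x k ^ 2) :=
      mul_le_mul_of_nonneg_left (by linarith [sq_nonneg (noisyIm ε x k)]) (wt_nonneg k)
    have h6 := mul_le_mul h4 h5 (mul_nonneg (wt_nonneg k) (sq_nonneg _)) (by positivity)
    linarith
  have h7 := hx.sum_noisyIm_sq_le hj (h.penalty_le_eighth hj)
  have h8 := hx.noisyEnergy_le hj (h.penalty_le_eighth hj)
  have h9 : 0 ≤ ∑ k ∈ B.block j, wt k * noisyIm ε x k ^ 2 :=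
    Finset.sum_nonneg fun k _ => mul_nonneg (wt_nonneg k) (sq_nonneg _)
  have h10 : blockSignal B c j + blockNoise B ε j ≤ F + 1 :=
    add_le_add (h.blockSignal_le hj) (h.blockNoise_le hj)
  rw [mul_pow, mul_pow, Real.sq_sqrt hτ.le]
  calc _ ≤ ε ^ 2 * τ * ((∑ k ∈ B.block j, wt k * (wt k * noisyRe ε c x k ^ 2))
        * ∑ k ∈ B.block j, wt k * noisyIm ε x k ^ 2) := by gcongr
    _ = (ε ^ 2 * τ * ∑ k ∈ B.block j, wt k * (wt k * noisyRe ε c x k ^ 2))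
        * ∑ k ∈ B.block j, wt k * noisyIm ε x k ^ 2 := by ring
    _ ≤ (3 * blockNoise B ε j * (4 * (F + 1))) * (2 * blockNoise B ε j) := by
        refine mul_le_mul (h3.trans ?_) h7 h9 (by positivity)
        gcongr
        linarith
    _ = 24 * (F + 1) * blockNoise B ε j ^ 2 := by ring
    _ ≤ 25 * (F + 1) ^ 2 * blockNoise B ε j ^ 2 := by
        gcongr
        · norm_num
        · nlinarith
    _ = _ := by ring

lemma IsGood.sum_quartic_le (hx : IsGood B ε c x Λ) (h : IsRegular B ε c F φ τ)
    (hj : j ∈ Finset.Icc 1 B.J) :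
    ε ^ 2 * τ * ∑ k ∈ B.block j, wt k * (wt k * (noisyRe ε c x k ^ 2 + noisyIm ε x k ^ 2))
      ≤ 12 * (F + 1) * blockNoise B ε j := by
  have hS := blockNoise_nonneg (B := B) (ε := ε) (j := j)
  have h8 := hx.noisyEnergy_le hj (h.penalty_le_eighth hj)
  have h10 : blockSignal B c j + blockNoise B ε j ≤ F + 1 :=
    add_le_add (h.blockSignal_le hj) (h.blockNoise_le hj)
  have h3 : ε ^ 2 * τ * ∑ k ∈ B.block j, wt k * (wt k * (noisyRe ε c x k ^ 2 + noisyIm ε x k ^ 2))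
      ≤ 3 * blockNoise B ε j * noisyEnergy B ε c x j := by
    rw [noisyEnergy, Finset.mul_sum, Finset.mul_sum]
    refine Finset.sum_le_sum fun k hk => ?_
    rw [← mul_assoc]
    exact mul_le_mul_of_nonneg_right (h.wt_mul_le hj hk)
      (mul_nonneg (wt_nonneg k) (add_nonneg (sq_nonneg _) (sq_nonneg _)))
  calc _ ≤ _ := h3
    _ ≤ 3 * blockNoise B ε j * (4 * (F + 1)) := by gcongr; linarith
    _ = _ := by ring

lemma blockFilter_steinWeight_nonneg (k : ℕ) : 0 ≤ blockFilter B (steinWeight B ε c x) k :=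
  Finset.sum_nonneg fun j _ => by split_ifs <;> [exact steinWeight_nonneg; exact le_rfl]

lemma cubicTerm_nonneg : 0 ≤ cubicTerm B ε c x :=
  Finset.sum_nonneg fun k _ => mul_nonneg (blockFilter_steinWeight_nonneg k)
    (mul_nonneg (mul_nonneg (by positivity) (wt_nonneg k)) (abs_nonneg _))

lemma quarticTerm_nonneg : 0 ≤ quarticTerm B ε c x :=
  Finset.sum_nonneg fun k _ => mul_nonneg (blockFilter_steinWeight_nonneg k)
    (mul_nonneg (wt_nonneg k) (mul_nonneg (wt_nonneg k) (by positivity)))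

lemma IsGood.cubicTerm_le (hx : IsGood B ε c x Λ) (h : IsRegular B ε c F φ τ) :
    ε * cubicTerm B ε c x ≤ remainderBound B ε c F τ := by
  have hF := h.F_pos
  have hR := h.oracleRisk_nonneg
  have hτ : 0 < √τ := Real.sqrt_pos.2 (zero_lt_one.trans_le h.one_le_τ)
  rw [remainderBound, le_div_iff₀ hτ, cubicTerm, sum_blockFilter_mul, Finset.mul_sum,
    Finset.sum_mul]
  have h1 : ∀ j ∈ Finset.Icc 1 B.J, ε * (steinWeight B ε c x j
      * ∑ k ∈ B.block j, (2 * π * k) * wt k * |noisyRe ε c x k * noisyIm ε x k|) * √τ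
      ≤ 2 * 10 ^ 7 * (F + 1) * blockRisk B ε c j := by
    intro j hj
    have h2 := mul_le_mul_of_nonneg_left (hx.sum_cubic_le h hj)
      (steinWeight_nonneg (B := B) (ε := ε) (c := c) (x := x) (j := j))
    have h3 := mul_le_mul_of_nonneg_left (hx.stein_mul_noise_le h hj)
      (by positivity : 0 ≤ 5 * (F + 1))
    have h4 : 0 ≤ (F + 1) * blockRisk B ε c j := mul_nonneg (by positivity) blockRisk_nonneg
    linarith
  refine (Finset.sum_le_sum h1).trans ?_
  rw [← Finset.mul_sum]
  exact mul_le_mul_of_nonneg_left h.sum_blockRisk_le (by positivity)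

lemma IsGood.quarticTerm_le (hx : IsGood B ε c x Λ) (h : IsRegular B ε c F φ τ) :
    ε ^ 2 * quarticTerm B ε c x ≤ remainderBound B ε c F τ := by
  have hF := h.F_pos
  have hR := h.oracleRisk_nonneg
  have hτ1 := h.one_le_τ
  have hτ : 0 < √τ := Real.sqrt_pos.2 (zero_lt_one.trans_le h.one_le_τ)
  have hle : √τ ≤ τ := by
    rw [Real.sqrt_le_left (by linarith)]
    nlinarith
  rw [remainderBound, le_div_iff₀ hτ]
  have h0 : ε ^ 2 * quarticTerm B ε c x * √τ ≤ ε ^ 2 * quarticTerm B ε c x * τ :=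
    mul_le_mul_of_nonneg_left hle (mul_nonneg (sq_nonneg _) quarticTerm_nonneg)
  refine h0.trans ?_
  rw [quarticTerm, sum_blockFilter_mul, Finset.mul_sum, Finset.sum_mul]
  have h1 : ∀ j ∈ Finset.Icc 1 B.J, ε ^ 2 * (steinWeight B ε c x j
      * ∑ k ∈ B.block j, wt k * (wt k * (noisyRe ε c x k ^ 2 + noisyIm ε x k ^ 2))) * τ
      ≤ 2 * 10 ^ 7 * (F + 1) * blockRisk B ε c j := by
    intro j hj
    have h2 := mul_le_mul_of_nonneg_left (hx.sum_quartic_le h hj)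
      (steinWeight_nonneg (B := B) (ε := ε) (c := c) (x := x) (j := j))
    have h3 := mul_le_mul_of_nonneg_left (hx.stein_mul_noise_le h hj)
      (by positivity : 0 ≤ 12 * (F + 1))
    have h4 : 0 ≤ (F + 1) * blockRisk B ε c j := mul_nonneg (by positivity) blockRisk_nonneg
    linarith
  refine (Finset.sum_le_sum h1).trans ?_
  rw [← Finset.mul_sum]
  exact mul_le_mul_of_nonneg_left h.sum_blockRisk_le (by positivity)

end Model

end ShiftModel

namespace ShiftModel

/-- The profile likelihood as a function of the distance `u` to the true shift. -/
noncomputable def trigProfile (N : ℕ) (g a b : ℕ → ℝ) (u : ℝ) : ℝ :=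
  1 / 2 * ∑ k ∈ Finset.Icc 1 N,
    g k * (a k * Real.cos (2 * π * k * u) + b k * Real.sin (2 * π * k * u)) ^ 2

lemma hasDerivAt_trigProfile (N : ℕ) (g a b : ℕ → ℝ) (u : ℝ) :
    HasDerivAt (trigProfile N g a b) (∑ k ∈ Finset.Icc 1 N, g k * ((2 * π * k) *
      (a k * b k * Real.cos (2 * (2 * π * k * u))
        - (a k ^ 2 - b k ^ 2) / 2 * Real.sin (2 * (2 * π * k * u))))) u := by
  have h1 : ∀ k : ℕ, HasDerivAt
      (fun u : ℝ => g k * (a k * Real.cos (2 * π * k * u) + b k * Real.sin (2 * π * k * u)) ^ 2)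
      (g k * (2 * (a k * Real.cos (2 * π * k * u) + b k * Real.sin (2 * π * k * u))
        * (a k * (-Real.sin (2 * π * k * u) * (2 * π * k))
          + b k * (Real.cos (2 * π * k * u) * (2 * π * k))))) u := by
    intro k
    have h2 : HasDerivAt (fun u : ℝ => 2 * π * k * u) (2 * π * k) u := by
      simpa using (hasDerivAt_id u).const_mul (2 * π * (k : ℝ))
    have h3 := ((h2.cos.const_mul (a k)).add (h2.sin.const_mul (b k))).pow 2
    exact (h3.const_mul (g k)).congr_deriv (by simp)
  have h5 := (HasDerivAt.fun_sum fun k (_ : k ∈ Finset.Icc 1 N) => h1 k).const_mul (1 / 2)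
  refine h5.congr_deriv ?_
  rw [Finset.mul_sum]
  refine Finset.sum_congr rfl fun k _ => ?_
  rw [Real.cos_two_mul', Real.sin_two_mul]
  ring

/-- The first-order condition at a maximizer `u` of the profile likelihood on an interval that
contains `0`, after expanding the derivative at `0`. -/
lemma curv_mul_sq_le {N : ℕ} {g a b : ℕ → ℝ} (hg : ∀ k, 0 ≤ g k) {u : ℝ}
    (hmax : ∀ t ∈ Set.Icc (0 : ℝ) 1, trigProfile N g a b (t * u) ≤ trigProfile N g a b u) :
    (∑ k ∈ Finset.Icc 1 N, g k * (wt k * (a k ^ 2 - b k ^ 2))) * u ^ 2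
      ≤ (∑ k ∈ Finset.Icc 1 N, g k * (2 * π * k) * (a k * b k)) * u
        + |u| * (2 * u ^ 2 * (∑ k ∈ Finset.Icc 1 N, g k * ((2 * π * k) * wt k * |a k * b k|))
          + 2 / 3 * |u| ^ 3 * ∑ k ∈ Finset.Icc 1 N, g k * (wt k * (wt k * (a k ^ 2 + b k ^ 2)))) := by
  have hd := hasDerivAt_trigProfile N g a b u
  set d := ∑ k ∈ Finset.Icc 1 N, g k * ((2 * π * k) *
      (a k * b k * Real.cos (2 * (2 * π * k * u))
        - (a k ^ 2 - b k ^ 2) / 2 * Real.sin (2 * (2 * π * k * u)))) with hd_def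
  have hcond : 0 ≤ u * d := by
    have h2 : HasDerivAt (fun t : ℝ => trigProfile N g a b ((1 - t) * u)) (d * (-u)) 0 := by
      have h3 : HasDerivAt (fun t : ℝ => (1 - t) * u) (-u) 0 := by
        simpa using ((hasDerivAt_id (0 : ℝ)).const_sub 1).mul_const u
      exact HasDerivAt.comp (h₂ := trigProfile N g a b) (0 : ℝ) (by simpa using hd) h3
    have h4 := h2.tendsto_slope_zero_right
    have h5 : d * (-u) ≤ 0 := by
      refine le_of_tendsto h4 ?_
      filter_upwards [Ioo_mem_nhdsGT (zero_lt_one' ℝ)] with t ht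
      rw [smul_eq_mul, zero_add, sub_zero, one_mul]
      exact mul_nonpos_of_nonneg_of_nonpos (inv_nonneg.2 ht.1.le)
        (sub_nonpos.2 (hmax _ ⟨by linarith [ht.2], by linarith [ht.1]⟩))
    linarith
  have hterm : ∀ k ∈ Finset.Icc 1 N,
      u * (g k * ((2 * π * k) * (a k * b k * Real.cos (2 * (2 * π * k * u))
        - (a k ^ 2 - b k ^ 2) / 2 * Real.sin (2 * (2 * π * k * u)))))
      ≤ g k * (2 * π * k) * (a k * b k) * u - g k * (wt k * (a k ^ 2 - b k ^ 2)) * u ^ 2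
        + |u| * (2 * u ^ 2 * (g k * ((2 * π * k) * wt k * |a k * b k|))
          + 2 / 3 * |u| ^ 3 * (g k * (wt k * (wt k * (a k ^ 2 + b k ^ 2))))) := by
    intro k _
    set m : ℝ := 2 * π * k with hm
    have hm0 : 0 ≤ m := by positivity
    have hwt : wt k = m ^ 2 := rfl
    have hc : |1 - Real.cos (2 * (m * u))| ≤ 2 * (m * u) ^ 2 := by
      rw [abs_of_nonneg (by linarith [Real.cos_le_one (2 * (m * u))])]
      have := Real.one_sub_sq_div_two_le_cos (x := 2 * (m * u))
      linarith
    have hs : |2 * (m * u) - Real.sin (2 * (m * u))| ≤ 4 / 3 * (m * |u|) ^ 3 := by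
      refine (Real.abs_sub_sin_le _).trans (le_of_eq ?_)
      rw [abs_mul, abs_mul, abs_of_nonneg hm0, abs_of_pos (zero_lt_two' ℝ)]
      ring
    have hab : |a k ^ 2 - b k ^ 2| ≤ a k ^ 2 + b k ^ 2 := by
      rw [abs_le]; constructor <;> linarith [sq_nonneg (a k), sq_nonneg (b k)]
    have e1 : -(a k * b k) * u * (1 - Real.cos (2 * (m * u)))
        ≤ |a k * b k| * |u| * (2 * (m * u) ^ 2) := by
      refine (le_abs_self _).trans ?_
      rw [abs_mul, abs_mul, abs_neg]
      gcongr
    have e2 : (a k ^ 2 - b k ^ 2) / 2 * u * (2 * (m * u) - Real.sin (2 * (m * u)))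
        ≤ (a k ^ 2 + b k ^ 2) / 2 * |u| * (4 / 3 * (m * |u|) ^ 3) := by
      refine (le_abs_self _).trans ?_
      rw [abs_mul, abs_mul, abs_div, abs_of_pos (zero_lt_two' ℝ)]
      gcongr
    have e3 := mul_le_mul_of_nonneg_left (add_le_add e1 e2) (mul_nonneg (hg k) hm0)
    rw [hwt]
    linarith
  have hsum := Finset.sum_le_sum hterm
  rw [← Finset.mul_sum, ← hd_def] at hsum
  have h6 := hcond.trans hsum
  simp only [Finset.sum_add_distrib, Finset.sum_sub_distrib, ← Finset.mul_sum, ← Finset.sum_mul]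
    at h6
  linarith

/-- Solving the expanded first-order condition for `u`: the leading term is `s / D`. -/
lemma sq_le_of_expansion {D s u X₃ X₄ K F ε δ : ℝ} (hε : 0 < ε) (hF : 0 < F) (hD : F / 2 ≤ D)
    (hX₃0 : 0 ≤ X₃) (hX₄0 : 0 ≤ X₄) (hX₃ : ε * X₃ ≤ K) (hX₄ : ε ^ 2 * X₄ ≤ K) (hu : |u| ≤ 2 * δ)
    (hK : 4 * (δ / ε) * K + 8 / 3 * (δ / ε) ^ 2 * K ≤ F / 8)
    (h : D * u ^ 2 ≤ s * u + |u| * (2 * u ^ 2 * X₃ + 2 / 3 * |u| ^ 3 * X₄)) :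
    u ^ 2 ≤ s ^ 2 / D ^ 2 + 216 * (1 / F ^ 4 + 1 / F ^ 5) * K * (s ^ 2 + s ^ 4 / ε ^ 2) := by
  have hD0 : 0 < D := by linarith
  have hK0 : 0 ≤ K := (mul_nonneg hε.le hX₃0).trans hX₃
  have hu0 := abs_nonneg u
  have hs0 := abs_nonneg s
  have hδ : 0 ≤ δ := by linarith
  have hX₃' : X₃ ≤ K / ε := by rw [le_div_iff₀ hε]; linarith
  have hX₄' : X₄ ≤ K / ε ^ 2 := by rw [le_div_iff₀ (by positivity)]; linarith
  set r := 2 * u ^ 2 * X₃ + 2 / 3 * |u| ^ 3 * X₄ with hr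
  have hr0 : 0 ≤ r := by positivity
  rcases eq_or_ne u 0 with rfl | hne
  · have : 0 ≤ 216 * (1 / F ^ 4 + 1 / F ^ 5) * K * (s ^ 2 + s ^ 4 / ε ^ 2) := by positivity
    have : 0 ≤ s ^ 2 / D ^ 2 := by positivity
    linarith
  have hupos : 0 < |u| := abs_pos.2 hne
  have h1 : D * |u| ≤ |s| + r := by
    have h2 : s * u ≤ |s| * |u| := by rw [← abs_mul]; exact le_abs_self _
    have h3 : |u| * (D * |u|) ≤ |u| * (|s| + r) := by
      have : |u| * (D * |u|) = D * u ^ 2 := by rw [← sq_abs u]; ring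
      linarith
    exact le_of_mul_le_mul_left h3 hupos
  have hr1 : r ≤ 2 * |u| ^ 2 * (K / ε) + 2 / 3 * |u| ^ 3 * (K / ε ^ 2) := by
    rw [hr, ← sq_abs u]; gcongr
  have hr2 : r ≤ F / 8 * |u| := by
    refine hr1.trans ?_
    calc 2 * |u| ^ 2 * (K / ε) + 2 / 3 * |u| ^ 3 * (K / ε ^ 2)
        = (2 * |u| * (K / ε) + 2 / 3 * |u| ^ 2 * (K / ε ^ 2)) * |u| := by ring
      _ ≤ (2 * (2 * δ) * (K / ε) + 2 / 3 * (2 * δ) ^ 2 * (K / ε ^ 2)) * |u| := by gcongr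
      _ = (4 * (δ / ε) * K + 8 / 3 * (δ / ε) ^ 2 * K) * |u| := by ring
      _ ≤ F / 8 * |u| := by gcongr
  have hu3 : F * |u| ≤ 3 * |s| := by
    have := mul_le_mul_of_nonneg_right hD hu0
    linarith
  have hu3' : |u| ≤ 3 * |s| / F := by rw [le_div_iff₀ hF]; linarith
  have hrs : r ≤ |s| := by linarith
  have hr3 : r ≤ 18 * K * (|s| ^ 2 / (F ^ 2 * ε) + |s| ^ 3 / (F ^ 3 * ε ^ 2)) := by
    refine hr1.trans ?_
    calc 2 * |u| ^ 2 * (K / ε) + 2 / 3 * |u| ^ 3 * (K / ε ^ 2)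
        ≤ 2 * (3 * |s| / F) ^ 2 * (K / ε) + 2 / 3 * (3 * |s| / F) ^ 3 * (K / ε ^ 2) := by gcongr
      _ = _ := by field_simp; ring
  have hsr : |s| * r ≤ 18 * K * ((1 / F ^ 2 + 1 / F ^ 3) * (s ^ 2 + s ^ 4 / ε ^ 2)) := by
    have h4 : |s| ^ 3 / ε ≤ s ^ 2 + s ^ 4 / ε ^ 2 := by
      have := sq_nonneg (|s| - |s| ^ 2 / ε)
      have e : (|s| - |s| ^ 2 / ε) ^ 2 = |s| ^ 2 - 2 * (|s| ^ 3 / ε) + (|s| ^ 2) ^ 2 / ε ^ 2 := by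
        ring
      rw [e, sq_abs] at this
      have h5 : 0 ≤ s ^ 2 + s ^ 4 / ε ^ 2 := by positivity
      have h6 : (s ^ 2) ^ 2 = s ^ 4 := by ring
      rw [h6] at this
      linarith
    have h5 : |s| ^ 4 / ε ^ 2 ≤ s ^ 2 + s ^ 4 / ε ^ 2 := by
      have : |s| ^ 4 = s ^ 4 := by rw [pow_abs, abs_of_nonneg (by positivity)]
      rw [this]
      linarith [sq_nonneg s]
    calc |s| * r ≤ |s| * (18 * K * (|s| ^ 2 / (F ^ 2 * ε) + |s| ^ 3 / (F ^ 3 * ε ^ 2))) := by gcongr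
      _ = 18 * K * (1 / F ^ 2 * (|s| ^ 3 / ε) + 1 / F ^ 3 * (|s| ^ 4 / ε ^ 2)) := by
          field_simp
      _ ≤ 18 * K * (1 / F ^ 2 * (s ^ 2 + s ^ 4 / ε ^ 2)
          + 1 / F ^ 3 * (s ^ 2 + s ^ 4 / ε ^ 2)) := by gcongr
      _ = _ := by ring
  have h7 : D ^ 2 * u ^ 2 ≤ s ^ 2 + 3 * (|s| * r) := by
    have h8 : (D * |u|) ^ 2 ≤ (|s| + r) ^ 2 := by gcongr
    have h9 : (|s| + r) ^ 2 = s ^ 2 + 2 * (|s| * r) + r * r := by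
      rw [← sq_abs s]; ring
    have h10 : r * r ≤ |s| * r := mul_le_mul_of_nonneg_right hrs hr0
    rw [mul_pow, sq_abs, h9] at h8
    linarith
  have h11 : u ^ 2 ≤ s ^ 2 / D ^ 2 + 3 * (|s| * r) / D ^ 2 := by
    rw [← add_div, le_div_iff₀ (by positivity)]
    linarith
  have h12 : 3 * (|s| * r) / D ^ 2 ≤ 12 / F ^ 2 * (|s| * r) := by
    rw [div_mul_eq_mul_div, div_le_div_iff₀ (by positivity) (by positivity)]
    have h13 : F ^ 2 ≤ 4 * D ^ 2 := by
      have : (F / 2) ^ 2 ≤ D ^ 2 := by gcongr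
      linarith
    have h14 : 0 ≤ 3 * (|s| * r) := by positivity
    have := mul_le_mul_of_nonneg_left h13 h14
    linarith
  have h15 : 12 / F ^ 2 * (|s| * r)
      ≤ 12 / F ^ 2 * (18 * K * ((1 / F ^ 2 + 1 / F ^ 3) * (s ^ 2 + s ^ 4 / ε ^ 2))) := by gcongr
  have h16 : 12 / F ^ 2 * (18 * K * ((1 / F ^ 2 + 1 / F ^ 3) * (s ^ 2 + s ^ 4 / ε ^ 2)))
      = 216 * (1 / F ^ 4 + 1 / F ^ 5) * K * (s ^ 2 + s ^ 4 / ε ^ 2) := by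
    field_simp
    ring
  linarith

section Model

variable {N : ℕ} {B : Blocks N} {ε : ℝ} {c : ℕ → ℝ} {x : ℕ × Bool → ℝ} {Λ φ F τ δ u : ℝ}

/-- On the good event the error `u` of the estimator is at most `s / D` up to remainders, where `s`
is the score and `D` the curvature of the profile likelihood at the true shift. -/
lemma IsGood.sq_error_le (hx : IsGood B ε c x Λ) (h : IsRegular B ε c F φ τ) (hu : |u| ≤ 2 * δ)
    (hK : 4 * (δ / ε) * remainderBound B ε c F τ + 8 / 3 * (δ / ε) ^ 2 * remainderBound B ε c F τ
      ≤ F / 8)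
    (hmax : ∀ t ∈ Set.Icc (0 : ℝ) 1,
      trigProfile N (blockFilter B (steinWeight B ε c x)) (noisyRe ε c x) (noisyIm ε x) (t * u)
        ≤ trigProfile N (blockFilter B (steinWeight B ε c x)) (noisyRe ε c x) (noisyIm ε x) u) :
    u ^ 2 ≤ score B ε c x ^ 2 / curv B ε c x (steinWeight B ε c x) ^ 2
      + 216 * (1 / F ^ 4 + 1 / F ^ 5) * remainderBound B ε c F τ
        * (score B ε c x ^ 2 + score B ε c x ^ 4 / ε ^ 2) := by
  refine sq_le_of_expansion h.ε_pos h.F_pos (hx.curv_stein_mem h).1 cubicTerm_nonneg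
    quarticTerm_nonneg (hx.cubicTerm_le h) (hx.quarticTerm_le h) hu hK ?_
  have h1 := curv_mul_sq_le blockFilter_steinWeight_nonneg hmax
  rw [sum_blockFilter_mul] at h1
  exact h1

end Model

end ShiftModel

namespace ShiftModel

/-! ### Moments of the block statistics -/

section Moments

variable {k l m : ℕ} (ε : ℝ) (c : ℕ → ℝ)

lemma HasMoments.coord_pow_mul (k m n : ℕ) :
    HasMoments noiseLaw fun x => x (k, true) ^ m * x (k, false) ^ n :=
  ((hasMoments_coord (k, true)).pow m).mul ((hasMoments_coord (k, false)).pow n)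

/-- The expectation of a polynomial in the two noise coordinates of a frequency, given by the list
of its coefficients and exponents. -/
lemma integral_list_monomials (hk : k ≠ 0) (M : List (ℝ × ℕ × ℕ)) :
    HasMoments noiseLaw
      (fun x => (M.map fun t => t.1 * (x (k, true) ^ t.2.1 * x (k, false) ^ t.2.2)).sum) ∧
    ∫ x, (M.map fun t => t.1 * (x (k, true) ^ t.2.1 * x (k, false) ^ t.2.2)).sum ∂noiseLaw
      = (M.map fun t => t.1 * ((∫ y, y ^ t.2.1 ∂gaussianReal 0 1)
        * ∫ y, y ^ t.2.2 ∂gaussianReal 0 1)).sum := by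
  induction M with
  | nil => simpa using HasMoments.const 0
  | cons t M ih =>
    simp only [List.map_cons, List.sum_cons]
    have h := (HasMoments.coord_pow_mul k t.2.1 t.2.2).const_mul t.1
    refine ⟨h.add ih.1, ?_⟩
    rw [h.integral_add ih.1, ih.2, integral_const_mul, integral_coord_pow_mul hk]

/-- The square of the term of frequency `k` in the score, up to its weight. -/
noncomputable def prodSq (ε : ℝ) (c : ℕ → ℝ) (k : ℕ) (x : ℕ × Bool → ℝ) : ℝ :=
  (noisyRe ε c x k * noisyIm ε x k) ^ 2

/-- The centered term of frequency `k` in the curvature, up to its weight. -/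
noncomputable def curvTerm (ε : ℝ) (c : ℕ → ℝ) (k : ℕ) (x : ℕ × Bool → ℝ) : ℝ :=
  2 * ε * c k * x (k, true) + ε ^ 2 * (x (k, true) ^ 2 - x (k, false) ^ 2)

lemma hasMoments_noisyRe (k : ℕ) : HasMoments noiseLaw fun x => noisyRe ε c x k :=
  (HasMoments.const (c k)).add ((hasMoments_coord (k, true)).const_mul ε)

lemma hasMoments_noisyIm (k : ℕ) : HasMoments noiseLaw fun x => noisyIm ε x k :=
  (hasMoments_coord (k, false)).const_mul ε

lemma hasMoments_prodSq (k : ℕ) : HasMoments noiseLaw (prodSq ε c k) :=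
  ((hasMoments_noisyRe ε c k).mul (hasMoments_noisyIm ε k)).pow 2

lemma hasMoments_curvTerm (k : ℕ) : HasMoments noiseLaw (curvTerm ε c k) :=
  ((hasMoments_coord (k, true)).const_mul (2 * ε * c k)).add
    ((((hasMoments_coord (k, true)).pow 2).sub ((hasMoments_coord (k, false)).pow 2)).const_mul
      (ε ^ 2))

lemma integral_prodSq (hk : k ≠ 0) :
    ∫ x, prodSq ε c k x ∂noiseLaw = ε ^ 2 * (c k ^ 2 + ε ^ 2) := by
  obtain ⟨h1, h2, h5, h6⟩ := integral_pow_gaussianReal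
  have h := (integral_list_monomials hk
    [(ε ^ 2 * c k ^ 2, 0, 2), (2 * ε ^ 3 * c k, 1, 2), (ε ^ 4, 2, 2)]).2
  simp only [List.map_cons, List.map_nil, List.sum_cons, List.sum_nil, pow_one, h1, h2,
    pow_zero, integral_const, probReal_univ, smul_eq_mul] at h
  refine (integral_congr_ae (Eventually.of_forall fun x => ?_)).trans (h.trans (by ring))
  simp only [prodSq, noisyRe, noisyIm]
  ring

lemma integral_prodSq_sq_le (hk : k ≠ 0) :
    ∫ x, prodSq ε c k x ^ 2 ∂noiseLaw ≤ 9 * (ε ^ 2 * (c k ^ 2 + ε ^ 2)) ^ 2 := by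
  obtain ⟨h1, h2, h3, h4, -⟩ := integral_pow_gaussianReal
  have h := (integral_list_monomials hk
    [(ε ^ 4 * c k ^ 4, 0, 4), (4 * ε ^ 5 * c k ^ 3, 1, 4), (6 * ε ^ 6 * c k ^ 2, 2, 4),
      (4 * ε ^ 7 * c k, 3, 4), (ε ^ 8, 4, 4)]).2
  simp only [List.map_cons, List.map_nil, List.sum_cons, List.sum_nil, pow_one, h1, h2, h3, h4,
    pow_zero, integral_const, probReal_univ, smul_eq_mul] at h
  have e : ∫ x, prodSq ε c k x ^ 2 ∂noiseLaw
      = 3 * ε ^ 4 * (c k ^ 4 + 6 * ε ^ 2 * c k ^ 2 + 3 * ε ^ 4) := by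
    refine (integral_congr_ae (Eventually.of_forall fun x => ?_)).trans (h.trans (by ring))
    simp only [prodSq, noisyRe, noisyIm]
    ring
  rw [e]
  have : 0 ≤ ε ^ 4 * c k ^ 4 := by positivity
  linarith

lemma integral_curvTerm (hk : k ≠ 0) : ∫ x, curvTerm ε c k x ∂noiseLaw = 0 := by
  obtain ⟨h1, h2, h5, h6⟩ := integral_pow_gaussianReal
  have h := (integral_list_monomials hk
    [(2 * ε * c k, 1, 0), (ε ^ 2, 2, 0), (-ε ^ 2, 0, 2)]).2
  simp only [List.map_cons, List.map_nil, List.sum_cons, List.sum_nil, pow_one, h1, h2,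
    pow_zero, integral_const, probReal_univ, smul_eq_mul] at h
  refine (integral_congr_ae (Eventually.of_forall fun x => ?_)).trans (h.trans (by ring))
  simp only [curvTerm]
  ring

lemma integral_curvTerm_sq (hk : k ≠ 0) :
    ∫ x, curvTerm ε c k x ^ 2 ∂noiseLaw = 4 * (ε ^ 2 * (c k ^ 2 + ε ^ 2)) := by
  obtain ⟨h1, h2, h3, h4, -⟩ := integral_pow_gaussianReal
  have h := (integral_list_monomials hk
    [(4 * ε ^ 2 * c k ^ 2, 2, 0), (4 * ε ^ 3 * c k, 3, 0), (-4 * ε ^ 3 * c k, 1, 2),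
      (ε ^ 4, 4, 0), (-2 * ε ^ 4, 2, 2), (ε ^ 4, 0, 4)]).2
  simp only [List.map_cons, List.map_nil, List.sum_cons, List.sum_nil, pow_one, h1, h2, h3, h4,
    pow_zero, integral_const, probReal_univ, smul_eq_mul] at h
  refine (integral_congr_ae (Eventually.of_forall fun x => ?_)).trans (h.trans (by ring))
  simp only [curvTerm]
  ring

lemma integral_prodSq_mul_curvTerm_nonneg (hk : k ≠ 0) :
    0 ≤ ∫ x, prodSq ε c k x * curvTerm ε c k x ∂noiseLaw := by
  obtain ⟨h1, h2, h3, h4, -⟩ := integral_pow_gaussianReal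
  have h := (integral_list_monomials hk
    [(2 * ε ^ 3 * c k ^ 3, 1, 2), (5 * ε ^ 4 * c k ^ 2, 2, 2), (-ε ^ 4 * c k ^ 2, 0, 4),
      (4 * ε ^ 5 * c k, 3, 2), (-2 * ε ^ 5 * c k, 1, 4), (ε ^ 6, 4, 2), (-ε ^ 6, 2, 4)]).2
  simp only [List.map_cons, List.map_nil, List.sum_cons, List.sum_nil, pow_one, h1, h2, h3, h4,
    pow_zero, integral_const, probReal_univ, smul_eq_mul] at h
  have e : ∫ x, prodSq ε c k x * curvTerm ε c k x ∂noiseLaw = 2 * ε ^ 4 * c k ^ 2 := by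
    refine (integral_congr_ae (Eventually.of_forall fun x => ?_)).trans (h.trans (by ring))
    simp only [prodSq, curvTerm, noisyRe, noisyIm]
    ring
  rw [e]
  positivity

lemma integral_prodSq_mul_curvTerm_sq_le (hk : k ≠ 0) :
    ∫ x, prodSq ε c k x * curvTerm ε c k x ^ 2 ∂noiseLaw
      ≤ 12 * (ε ^ 2 * (c k ^ 2 + ε ^ 2)) ^ 2 := by
  obtain ⟨h1, h2, h3, h4, h5, h6⟩ := integral_pow_gaussianReal
  have h := (integral_list_monomials hk
    [(4 * ε ^ 4 * c k ^ 4, 2, 2),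
      (4 * ε ^ 5 * c k ^ 3, 3, 2), (-4 * ε ^ 5 * c k ^ 3, 1, 4), (8 * ε ^ 5 * c k ^ 3, 3, 2),
      (ε ^ 6 * c k ^ 2, 4, 2), (-2 * ε ^ 6 * c k ^ 2, 2, 4), (ε ^ 6 * c k ^ 2, 0, 6),
      (8 * ε ^ 6 * c k ^ 2, 4, 2), (-8 * ε ^ 6 * c k ^ 2, 2, 4), (4 * ε ^ 6 * c k ^ 2, 4, 2),
      (2 * ε ^ 7 * c k, 5, 2), (-4 * ε ^ 7 * c k, 3, 4), (2 * ε ^ 7 * c k, 1, 6),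
      (4 * ε ^ 7 * c k, 5, 2), (-4 * ε ^ 7 * c k, 3, 4),
      (ε ^ 8, 6, 2), (-2 * ε ^ 8, 4, 4), (ε ^ 8, 2, 6)]).2
  simp only [List.map_cons, List.map_nil, List.sum_cons, List.sum_nil, pow_one, h1, h2, h3, h4, h5,
    h6, pow_zero, integral_const, probReal_univ, smul_eq_mul] at h
  have e : ∫ x, prodSq ε c k x * curvTerm ε c k x ^ 2 ∂noiseLaw
      = 4 * ε ^ 4 * (c k ^ 4 + 6 * ε ^ 2 * c k ^ 2 + 3 * ε ^ 4) := by
    refine (integral_congr_ae (Eventually.of_forall fun x => ?_)).trans (h.trans (by ring))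
    simp only [prodSq, curvTerm, noisyRe, noisyIm]
    ring
  rw [e]
  have : 0 ≤ ε ^ 4 * c k ^ 4 := by positivity
  linarith

/-! The statistics of different frequencies are independent. -/

lemma integral_prodSq_mul_prodSq_le (hk : k ≠ 0) (hl : l ≠ 0) :
    ∫ x, prodSq ε c k x * prodSq ε c l x ∂noiseLaw
      ≤ 9 * (ε ^ 2 * (c k ^ 2 + ε ^ 2)) * (ε ^ 2 * (c l ^ 2 + ε ^ 2)) := by
  rcases eq_or_ne k l with rfl | hkl
  · have := integral_prodSq_sq_le ε c hk
    simp only [sq (prodSq ε c k _)] at this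
    linarith
  · have h := integral_mul_of_ne hkl hkl
      (G := fun z => ((c k + ε * z.1.1) * (ε * z.1.2)) ^ 2)
      (H := fun z => ((c l + ε * z.1) * (ε * z.2)) ^ 2) (by fun_prop) (by fun_prop)
    change ∫ x, prodSq ε c k x * prodSq ε c l x ∂noiseLaw
      = (∫ x, prodSq ε c k x ∂noiseLaw) * ∫ x, prodSq ε c l x ∂noiseLaw at h
    rw [h, integral_prodSq ε c hk, integral_prodSq ε c hl]
    have : 0 ≤ ε ^ 2 * (c k ^ 2 + ε ^ 2) * (ε ^ 2 * (c l ^ 2 + ε ^ 2)) := by positivity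
    linarith

lemma integral_prodSq_mul_curvTerm_nonneg' (hk : k ≠ 0) (hl : l ≠ 0) :
    0 ≤ ∫ x, prodSq ε c k x * curvTerm ε c l x ∂noiseLaw := by
  rcases eq_or_ne k l with rfl | hkl
  · exact integral_prodSq_mul_curvTerm_nonneg ε c hk
  · have h := integral_mul_of_ne hkl hkl
      (G := fun z => ((c k + ε * z.1.1) * (ε * z.1.2)) ^ 2)
      (H := fun z => 2 * ε * c l * z.1 + ε ^ 2 * (z.1 ^ 2 - z.2 ^ 2)) (by fun_prop) (by fun_prop)
    change ∫ x, prodSq ε c k x * curvTerm ε c l x ∂noiseLaw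
      = (∫ x, prodSq ε c k x ∂noiseLaw) * ∫ x, curvTerm ε c l x ∂noiseLaw at h
    rw [h, integral_curvTerm ε c hl, mul_zero]

lemma integral_prodSq_mul_curvTerm_sq_le' (hk : k ≠ 0) (hl : l ≠ 0) :
    ∫ x, prodSq ε c k x * curvTerm ε c l x ^ 2 ∂noiseLaw
      ≤ 12 * (ε ^ 2 * (c k ^ 2 + ε ^ 2)) * (ε ^ 2 * (c l ^ 2 + ε ^ 2)) := by
  rcases eq_or_ne k l with rfl | hkl
  · have := integral_prodSq_mul_curvTerm_sq_le ε c hk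
    linarith
  · have h := integral_mul_of_ne hkl hkl
      (G := fun z => ((c k + ε * z.1.1) * (ε * z.1.2)) ^ 2)
      (H := fun z => (2 * ε * c l * z.1 + ε ^ 2 * (z.1 ^ 2 - z.2 ^ 2)) ^ 2)
      (by fun_prop) (by fun_prop)
    change ∫ x, prodSq ε c k x * curvTerm ε c l x ^ 2 ∂noiseLaw
      = (∫ x, prodSq ε c k x ∂noiseLaw) * ∫ x, curvTerm ε c l x ^ 2 ∂noiseLaw at h
    rw [h, integral_prodSq ε c hk, integral_curvTerm_sq ε c hl]
    have : 0 ≤ ε ^ 2 * (c k ^ 2 + ε ^ 2) * (ε ^ 2 * (c l ^ 2 + ε ^ 2)) := by positivity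
    linarith

lemma integral_prodSq_mul_curvTerm_mul_curvTerm (hl : l ≠ 0) (hm : m ≠ 0) (hlm : l ≠ m) :
    ∫ x, prodSq ε c k x * (curvTerm ε c l x * curvTerm ε c m x) ∂noiseLaw = 0 := by
  have key : ∀ l m : ℕ, m ≠ 0 → l ≠ m → k ≠ m →
      ∫ x, prodSq ε c k x * (curvTerm ε c l x * curvTerm ε c m x) ∂noiseLaw = 0 := by
    intro l m hm hlm hkm
    have h := integral_mul_of_ne hkm hlm
      (G := fun z => ((c k + ε * z.1.1) * (ε * z.1.2)) ^ 2
        * (2 * ε * c l * z.2.1 + ε ^ 2 * (z.2.1 ^ 2 - z.2.2 ^ 2)))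
      (H := fun z => 2 * ε * c m * z.1 + ε ^ 2 * (z.1 ^ 2 - z.2 ^ 2)) (by fun_prop) (by fun_prop)
    change ∫ x, prodSq ε c k x * curvTerm ε c l x * curvTerm ε c m x ∂noiseLaw
      = (∫ x, prodSq ε c k x * curvTerm ε c l x ∂noiseLaw) * ∫ x, curvTerm ε c m x ∂noiseLaw at h
    rw [integral_curvTerm ε c hm, mul_zero] at h
    simpa only [mul_assoc] using h
  rcases eq_or_ne k m with rfl | hkm
  · simp only [mul_comm (curvTerm ε c l _)]
    exact key k l hl hlm.symm hlm.symm
  · exact key l m hm hlm hkm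

end Moments

end ShiftModel

namespace ShiftModel

/-! ### Expectation of the majorant -/

section Model

variable {N : ℕ} {B : Blocks N} {ε : ℝ} {c : ℕ → ℝ} {Λ φ F τ : ℝ} {j : ℕ}

lemma ne_zero_of_mem_Icc {k : ℕ} (hk : k ∈ Finset.Icc 1 N) : k ≠ 0 := by
  have := Finset.mem_Icc.1 hk
  omega

lemma scoreVar_eq (x : ℕ × Bool → ℝ) (g : ℕ → ℝ) : scoreVar B ε c x g
    = ∑ k ∈ Finset.Icc 1 N, blockFilter B (fun j => g j ^ 2) k * wt k * prodSq ε c k x := by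
  simp only [mul_assoc]
  rw [sum_blockFilter_mul]
  rfl

lemma curvNoise_eq (x : ℕ × Bool → ℝ) : curvNoise B ε c x
    = ∑ k ∈ Finset.Icc 1 N, blockFilter B (oracleWeight B ε c) k * wt k * curvTerm ε c k x := by
  simp only [mul_assoc]
  rw [sum_blockFilter_mul]
  refine Finset.sum_congr rfl fun j _ => ?_
  rw [blockCurv_eq, add_sub_cancel_left]
  rfl

lemma blockFilter_nonneg {g : ℕ → ℝ} (hg : ∀ j, 0 ≤ g j) (k : ℕ) : 0 ≤ blockFilter B g k :=
  Finset.sum_nonneg fun j _ => by split_ifs <;> [exact hg j; exact le_rfl]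

lemma hasMoments_scoreVar (g : ℕ → ℝ) : HasMoments noiseLaw fun x => scoreVar B ε c x g := by
  simp only [scoreVar_eq]
  exact HasMoments.sum _ fun k _ => (hasMoments_prodSq ε c k).const_mul _

lemma hasMoments_curvNoise : HasMoments noiseLaw fun x => curvNoise B ε c x := by
  simp only [curvNoise_eq]
  exact HasMoments.sum _ fun k _ => (hasMoments_curvTerm ε c k).const_mul _

lemma hasMoments_blockVar (j : ℕ) : HasMoments noiseLaw fun x => blockVar B ε c x j :=
  HasMoments.sum _ fun k _ => (hasMoments_prodSq ε c k).const_mul _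

lemma hasMoments_varExcess : HasMoments noiseLaw fun x => varExcess B ε c x :=
  HasMoments.sum _ fun j _ => (hasMoments_blockVar j).const_mul _

lemma sum_wt_mul_eq (j : ℕ) : ∑ k ∈ B.block j, wt k * (ε ^ 2 * (c k ^ 2 + ε ^ 2))
    = ε ^ 2 * (blockSignal B c j + blockNoise B ε j) := by
  rw [blockSignal, blockNoise_eq_sum, ← Finset.sum_add_distrib, Finset.mul_sum]
  exact Finset.sum_congr rfl fun k _ => by ring

lemma integral_blockVar (hj : j ∈ Finset.Icc 1 B.J) :
    ∫ x, blockVar B ε c x j ∂noiseLaw = ε ^ 2 * (blockSignal B c j + blockNoise B ε j) := by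
  change ∫ x, ∑ k ∈ B.block j, wt k * prodSq ε c k x ∂noiseLaw = _
  rw [integral_finsetSum _ fun k _ => ((hasMoments_prodSq ε c k).const_mul _).integrable,
    ← sum_wt_mul_eq]
  refine Finset.sum_congr rfl fun k hk => ?_
  rw [integral_const_mul]
  rw [integral_prodSq ε c (Blocks.ne_zero_of_mem_block hj hk)]

lemma integral_scoreVar (g : ℕ → ℝ) : ∫ x, scoreVar B ε c x g ∂noiseLaw
    = ∑ j ∈ Finset.Icc 1 B.J, g j ^ 2 * (ε ^ 2 * (blockSignal B c j + blockNoise B ε j)) := by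
  simp only [scoreVar]
  rw [integral_finsetSum _ fun j _ => ((hasMoments_blockVar j).const_mul _).integrable]
  exact Finset.sum_congr rfl fun j hj => by rw [integral_const_mul, integral_blockVar hj]

lemma integral_scoreVar_oracle (h : IsRegular B ε c F φ τ) :
    ∫ x, scoreVar B ε c x (oracleWeight B ε c) ∂noiseLaw = ε ^ 2 * (F - oracleRisk B ε c F) := by
  rw [integral_scoreVar]
  have : ∀ j ∈ Finset.Icc 1 B.J, oracleWeight B ε c j ^ 2
      * (ε ^ 2 * (blockSignal B c j + blockNoise B ε j))
      = ε ^ 2 * (blockSignal B c j - blockRisk B ε c j) := by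
    intro j hj
    rw [← oracleWeight_mul_blockSignal h.ε_pos hj]
    linear_combination ε ^ 2 * oracleWeight B ε c j * oracleWeight_mul_add (c := c) h.ε_pos hj
  rw [Finset.sum_congr rfl this, ← Finset.mul_sum, Finset.sum_sub_distrib, oracleRisk]
  ring

lemma integral_varExcess_le (h : IsRegular B ε c F φ τ) :
    ∫ x, varExcess B ε c x ∂noiseLaw ≤ ε ^ 2 * oracleRisk B ε c F := by
  simp only [varExcess]
  rw [integral_finsetSum _ fun j _ => ((hasMoments_blockVar j).const_mul _).integrable]
  refine le_trans (le_of_eq ?_) (mul_le_mul_of_nonneg_left h.sum_blockRisk_le (sq_nonneg ε))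
  rw [Finset.mul_sum]
  refine Finset.sum_congr rfl fun j hj => ?_
  have h1 := blockNoise_pos (B := B) h.ε_pos hj
  have h2 := blockSignal_nonneg (B := B) (c := c) (j := j)
  rw [integral_const_mul, integral_blockVar hj]
  field_simp

lemma integral_scoreVar_sq_le (h : IsRegular B ε c F φ τ) :
    ∫ x, scoreVar B ε c x (fun _ => 1) ^ 2 ∂noiseLaw ≤ 9 * (ε ^ 2 * (F + 1)) ^ 2 := by
  have h1 : ∀ x, scoreVar B ε c x (fun _ => 1) ^ 2
      = ∑ k ∈ Finset.Icc 1 N, ∑ l ∈ Finset.Icc 1 N,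
        (wt k * wt l) * (prodSq ε c k x * prodSq ε c l x) := by
    intro x
    have : scoreVar B ε c x (fun _ => 1) = ∑ k ∈ Finset.Icc 1 N, wt k * prodSq ε c k x := by
      rw [← B.sum_block]
      exact Finset.sum_congr rfl fun j _ => by rw [one_pow, one_mul]; rfl
    rw [this, sq, Finset.sum_mul_sum]
    exact Finset.sum_congr rfl fun k _ => Finset.sum_congr rfl fun l _ => by ring
  have hint : ∀ k l, HasMoments noiseLaw
      fun x => (wt k * wt l) * (prodSq ε c k x * prodSq ε c l x) := fun k l =>
    ((hasMoments_prodSq ε c k).mul (hasMoments_prodSq ε c l)).const_mul _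
  simp only [h1]
  rw [integral_finsetSum _ fun k _ => (HasMoments.sum _ fun l _ => hint k l).integrable]
  have h2 : ∀ k ∈ Finset.Icc 1 N,
      ∫ x, ∑ l ∈ Finset.Icc 1 N, (wt k * wt l) * (prodSq ε c k x * prodSq ε c l x) ∂noiseLaw
        ≤ ∑ l ∈ Finset.Icc 1 N, 9 * ((wt k * (ε ^ 2 * (c k ^ 2 + ε ^ 2)))
          * (wt l * (ε ^ 2 * (c l ^ 2 + ε ^ 2)))) := by
    intro k hk
    rw [integral_finsetSum _ fun l _ => (hint k l).integrable]
    refine Finset.sum_le_sum fun l hl => ?_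
    rw [integral_const_mul]
    have := mul_le_mul_of_nonneg_left (integral_prodSq_mul_prodSq_le ε c (ne_zero_of_mem_Icc hk)
      (ne_zero_of_mem_Icc hl)) (mul_nonneg (wt_nonneg k) (wt_nonneg l))
    linarith
  refine (Finset.sum_le_sum h2).trans ?_
  simp only [← Finset.mul_sum]
  rw [← Finset.sum_mul, ← sq]
  have h3 : ∑ k ∈ Finset.Icc 1 N, wt k * (ε ^ 2 * (c k ^ 2 + ε ^ 2)) ≤ ε ^ 2 * (F + 1) := by
    rw [← B.sum_block]
    simp only [sum_wt_mul_eq]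
    rw [← Finset.mul_sum, Finset.sum_add_distrib]
    exact mul_le_mul_of_nonneg_left (add_le_add h.signal_le h.noise_le) (sq_nonneg ε)
  have h4 : 0 ≤ ∑ k ∈ Finset.Icc 1 N, wt k * (ε ^ 2 * (c k ^ 2 + ε ^ 2)) :=
    Finset.sum_nonneg fun k _ => mul_nonneg (wt_nonneg k) (by positivity)
  gcongr

lemma integral_scoreVar_mul_curvNoise_nonneg :
    0 ≤ ∫ x, scoreVar B ε c x (oracleWeight B ε c) * curvNoise B ε c x ∂noiseLaw := by
  let v : ℕ → ℝ := fun k => blockFilter B (fun j => oracleWeight B ε c j ^ 2) k * wt k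
  let w : ℕ → ℝ := fun k => blockFilter B (oracleWeight B ε c) k * wt k
  have e1 : ∀ x, scoreVar B ε c x (oracleWeight B ε c)
      = ∑ k ∈ Finset.Icc 1 N, v k * prodSq ε c k x := fun x => scoreVar_eq x _
  have e2 : ∀ x, curvNoise B ε c x = ∑ l ∈ Finset.Icc 1 N, w l * curvTerm ε c l x := curvNoise_eq
  simp only [e1, e2, Finset.sum_mul_sum]
  have hv0 : ∀ k, 0 ≤ v k := fun k =>
    mul_nonneg (blockFilter_nonneg (fun j => sq_nonneg _) k) (wt_nonneg k)
  have hw0 : ∀ k, 0 ≤ w k := fun k =>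
    mul_nonneg (blockFilter_nonneg (fun j => oracleWeight_nonneg) k) (wt_nonneg k)
  have hint : ∀ k l, HasMoments noiseLaw
      fun x => v k * prodSq ε c k x * (w l * curvTerm ε c l x) := fun k l =>
    ((hasMoments_prodSq ε c k).const_mul _).mul ((hasMoments_curvTerm ε c l).const_mul _)
  rw [integral_finsetSum _ fun k _ => (HasMoments.sum _ fun l _ => hint k l).integrable]
  refine Finset.sum_nonneg fun k hk => ?_
  rw [integral_finsetSum _ fun l _ => (hint k l).integrable]
  refine Finset.sum_nonneg fun l hl => ?_
  have e3 : ∀ x, v k * prodSq ε c k x * (w l * curvTerm ε c l x)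
      = (v k * w l) * (prodSq ε c k x * curvTerm ε c l x) := fun x => by ring
  rw [integral_congr_ae (Eventually.of_forall e3), integral_const_mul]
  exact mul_nonneg (mul_nonneg (hv0 k) (hw0 l)) (integral_prodSq_mul_curvTerm_nonneg' ε c
    (ne_zero_of_mem_Icc hk) (ne_zero_of_mem_Icc hl))

lemma sum_sq_wt_le (h : IsRegular B ε c F φ τ) :
    ∑ k ∈ Finset.Icc 1 N, (blockFilter B (oracleWeight B ε c) k * wt k) ^ 2
      * (ε ^ 2 * (c k ^ 2 + ε ^ 2)) ≤ 3 * F * oracleRisk B ε c F / τ := by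
  have hτ : 0 < τ := zero_lt_one.trans_le h.one_le_τ
  have hF := h.F_pos
  rw [le_div_iff₀ hτ, ← B.sum_block, Finset.sum_mul]
  have h1 : ∀ j ∈ Finset.Icc 1 B.J, (∑ k ∈ B.block j,
      (blockFilter B (oracleWeight B ε c) k * wt k) ^ 2 * (ε ^ 2 * (c k ^ 2 + ε ^ 2))) * τ
      ≤ 3 * F * blockRisk B ε c j := by
    intro j hj
    have hS := blockNoise_nonneg (B := B) (ε := ε) (j := j)
    have hw := oracleWeight_nonneg (B := B) (ε := ε) (c := c) (j := j)
    have hFj := blockSignal_nonneg (B := B) (c := c) (j := j)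
    calc _ ≤ ∑ k ∈ B.block j, oracleWeight B ε c j ^ 2 * (3 * blockNoise B ε j)
          * (wt k * (c k ^ 2 + ε ^ 2)) := by
          rw [Finset.sum_mul]
          refine Finset.sum_le_sum fun k hk => ?_
          rw [blockFilter_eq hj hk]
          have h2 := mul_le_mul_of_nonneg_left (h.wt_mul_le hj hk)
            (mul_nonneg (sq_nonneg (oracleWeight B ε c j))
              (mul_nonneg (wt_nonneg k) (by positivity : 0 ≤ c k ^ 2 + ε ^ 2)))
          linarith
      _ = 3 * (blockNoise B ε j * oracleWeight B ε c j) * (oracleWeight B ε c j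
          * (blockSignal B c j + blockNoise B ε j)) := by
          rw [← Finset.mul_sum]
          have : ∑ k ∈ B.block j, wt k * (c k ^ 2 + ε ^ 2)
              = blockSignal B c j + blockNoise B ε j := by
            rw [blockSignal, blockNoise_eq_sum, ← Finset.sum_add_distrib]
            exact Finset.sum_congr rfl fun k _ => by ring
          rw [this]
          ring
      _ = 3 * blockRisk B ε c j * blockSignal B c j := by
          rw [oracleWeight_mul_add h.ε_pos hj, blockRisk_eq]; ring
      _ ≤ 3 * blockRisk B ε c j * F :=
          mul_le_mul_of_nonneg_left (h.blockSignal_le hj)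
            (mul_nonneg (by norm_num) blockRisk_nonneg)
      _ = _ := by ring
  refine (Finset.sum_le_sum h1).trans ?_
  rw [← Finset.mul_sum]
  exact mul_le_mul_of_nonneg_left h.sum_blockRisk_le (by positivity)

lemma integral_scoreVar_mul_curvNoise_sq_le (h : IsRegular B ε c F φ τ) :
    ∫ x, scoreVar B ε c x (oracleWeight B ε c) * curvNoise B ε c x ^ 2 ∂noiseLaw
      ≤ 36 * ε ^ 2 * F ^ 2 * oracleRisk B ε c F / τ := by
  have hEV := integral_scoreVar_oracle h
  have hF := h.F_pos
  have hR := h.oracleRisk_nonneg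
  let v : ℕ → ℝ := fun k => blockFilter B (fun j => oracleWeight B ε c j ^ 2) k * wt k
  let w : ℕ → ℝ := fun k => blockFilter B (oracleWeight B ε c) k * wt k
  have hsq : ∑ k ∈ Finset.Icc 1 N, w k ^ 2 * (ε ^ 2 * (c k ^ 2 + ε ^ 2))
      ≤ 3 * F * oracleRisk B ε c F / τ := sum_sq_wt_le h
  have e1 : ∀ x, scoreVar B ε c x (oracleWeight B ε c)
      = ∑ k ∈ Finset.Icc 1 N, v k * prodSq ε c k x := fun x => scoreVar_eq x _
  have e2 : ∀ x, curvNoise B ε c x = ∑ l ∈ Finset.Icc 1 N, w l * curvTerm ε c l x := curvNoise_eq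
  simp only [e1] at hEV
  simp only [e1, e2]
  have hv0 : ∀ k, 0 ≤ v k := fun k =>
    mul_nonneg (blockFilter_nonneg (fun j => sq_nonneg _) k) (wt_nonneg k)
  rw [integral_finsetSum _ fun k _ => ((hasMoments_prodSq ε c k).const_mul _).integrable] at hEV
  have h0 : ∀ x, (∑ k ∈ Finset.Icc 1 N, v k * prodSq ε c k x)
      * (∑ l ∈ Finset.Icc 1 N, w l * curvTerm ε c l x) ^ 2
      = ∑ k ∈ Finset.Icc 1 N, ∑ l ∈ Finset.Icc 1 N, ∑ m ∈ Finset.Icc 1 N,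
        (v k * (w l * w m)) * (prodSq ε c k x * (curvTerm ε c l x * curvTerm ε c m x)) := by
    intro x
    rw [sq, Finset.sum_mul_sum, Finset.sum_mul]
    refine Finset.sum_congr rfl fun k _ => ?_
    rw [Finset.mul_sum]
    refine Finset.sum_congr rfl fun l _ => ?_
    rw [Finset.mul_sum]
    exact Finset.sum_congr rfl fun m _ => by ring
  have hint : ∀ k l m, HasMoments noiseLaw fun x =>
      (v k * (w l * w m)) * (prodSq ε c k x * (curvTerm ε c l x * curvTerm ε c m x)) :=
    fun k l m => ((hasMoments_prodSq ε c k).mul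
      ((hasMoments_curvTerm ε c l).mul (hasMoments_curvTerm ε c m))).const_mul _
  simp only [h0]
  rw [integral_finsetSum _ fun k _ => (HasMoments.sum _ fun l _ =>
    HasMoments.sum _ fun m _ => hint k l m).integrable]
  have h1 : ∀ k ∈ Finset.Icc 1 N, ∫ x, ∑ l ∈ Finset.Icc 1 N, ∑ m ∈ Finset.Icc 1 N,
        (v k * (w l * w m)) * (prodSq ε c k x * (curvTerm ε c l x * curvTerm ε c m x)) ∂noiseLaw
      ≤ ∑ l ∈ Finset.Icc 1 N, 12 * (v k * (ε ^ 2 * (c k ^ 2 + ε ^ 2)))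
        * (w l ^ 2 * (ε ^ 2 * (c l ^ 2 + ε ^ 2))) := by
    intro k hk
    rw [integral_finsetSum _ fun l _ => (HasMoments.sum _ fun m _ => hint k l m).integrable]
    refine Finset.sum_le_sum fun l hl => ?_
    rw [integral_finsetSum _ fun m _ => (hint k l m).integrable, Finset.sum_eq_single_of_mem l hl]
    · rw [integral_const_mul]
      simp only [← sq]
      have := mul_le_mul_of_nonneg_left (integral_prodSq_mul_curvTerm_sq_le' ε c
        (ne_zero_of_mem_Icc hk) (ne_zero_of_mem_Icc hl)) (mul_nonneg (hv0 k) (sq_nonneg (w l)))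
      linarith
    · intro m hm hml
      rw [integral_const_mul, integral_prodSq_mul_curvTerm_mul_curvTerm ε c
        (ne_zero_of_mem_Icc hl) (ne_zero_of_mem_Icc hm) hml.symm, mul_zero]
  refine (Finset.sum_le_sum h1).trans ?_
  simp only [← Finset.mul_sum]
  rw [← Finset.sum_mul, ← Finset.mul_sum]
  have h2 : ∑ k ∈ Finset.Icc 1 N, v k * (ε ^ 2 * (c k ^ 2 + ε ^ 2))
      = ε ^ 2 * (F - oracleRisk B ε c F) := by
    rw [← hEV]
    exact Finset.sum_congr rfl fun k hk => by
      rw [integral_const_mul, integral_prodSq ε c (ne_zero_of_mem_Icc hk)]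
  rw [h2]
  have h3 : 0 ≤ ∑ l ∈ Finset.Icc 1 N, w l ^ 2 * (ε ^ 2 * (c l ^ 2 + ε ^ 2)) :=
    Finset.sum_nonneg fun l _ => by positivity
  have hτ : 0 < τ := zero_lt_one.trans_le h.one_le_τ
  calc _ ≤ 12 * (ε ^ 2 * F) * (3 * F * oracleRisk B ε c F / τ) := by
        refine mul_le_mul ?_ hsq h3 (by positivity)
        gcongr
        linarith
    _ = _ := by ring

lemma hasMoments_ratioBound : HasMoments noiseLaw fun x => ratioBound B ε c F φ x := by
  have hV := hasMoments_scoreVar (B := B) (ε := ε) (c := c) (oracleWeight B ε c)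
  have hy : HasMoments noiseLaw fun x => (oracleRisk B ε c F - curvNoise B ε c x) / F := by
    simpa only [div_eq_inv_mul] using
      ((HasMoments.const (oracleRisk B ε c F)).sub hasMoments_curvNoise).const_mul F⁻¹
  have hV' : HasMoments noiseLaw fun x => scoreVar B ε c x (oracleWeight B ε c) / F ^ 2 := by
    simpa only [div_eq_inv_mul] using hV.const_mul (F ^ 2)⁻¹
  exact ((hV'.mul (((HasMoments.const 1).add (hy.const_mul 2)).add ((hy.pow 2).const_mul 8))).add
    (hV.const_mul _)).add (hasMoments_varExcess.const_mul _)

lemma integral_ratioBound_le (h : IsRegular B ε c F φ τ) :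
    ∫ x, ratioBound B ε c F φ x ∂noiseLaw ≤ ε ^ 2 / F * (1 + oracleRisk B ε c F / F
      * (1 + 16 * (oracleRisk B ε c F / F) + 10 ^ 9 * φ + 576 / τ)) := by
  have hF := h.F_pos
  have hφ := h.φ_pos
  have hR := h.oracleRisk_nonneg
  have hτ : 0 < τ := zero_lt_one.trans_le h.one_le_τ
  have hε := h.ε_pos
  set R := oracleRisk B ε c F with hRdef
  have hV := hasMoments_scoreVar (B := B) (ε := ε) (c := c) (oracleWeight B ε c)
  have hn := hasMoments_curvNoise (B := B) (ε := ε) (c := c)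
  have hE := hasMoments_varExcess (B := B) (ε := ε) (c := c)
  have hVn := hV.mul hn
  have hVn2 := hV.mul (hn.pow 2)
  have hle : ∀ x, ratioBound B ε c F φ x
      ≤ (1 / F ^ 2 + 2 * R / F ^ 3 + 16 * R ^ 2 / F ^ 4 + 48 * 10 ^ 7 * φ * R / F ^ 3)
          * scoreVar B ε c x (oracleWeight B ε c)
        - 2 / F ^ 3 * (scoreVar B ε c x (oracleWeight B ε c) * curvNoise B ε c x)
        + 16 / F ^ 4 * (scoreVar B ε c x (oracleWeight B ε c) * curvNoise B ε c x ^ 2)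
        + 4 * 10 ^ 7 * φ / F ^ 2 * varExcess B ε c x := by
    intro x
    have h1 : 0 ≤ scoreVar B ε c x (oracleWeight B ε c) := scoreVar_nonneg _
    have h2 : 0 ≤ 8 / F ^ 4 * scoreVar B ε c x (oracleWeight B ε c)
        * (R + curvNoise B ε c x) ^ 2 := by positivity
    rw [ratioBound, ← hRdef]
    have e : (1 / F ^ 2 + 2 * R / F ^ 3 + 16 * R ^ 2 / F ^ 4 + 48 * 10 ^ 7 * φ * R / F ^ 3)
          * scoreVar B ε c x (oracleWeight B ε c)
        - 2 / F ^ 3 * (scoreVar B ε c x (oracleWeight B ε c) * curvNoise B ε c x)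
        + 16 / F ^ 4 * (scoreVar B ε c x (oracleWeight B ε c) * curvNoise B ε c x ^ 2)
        + 4 * 10 ^ 7 * φ / F ^ 2 * varExcess B ε c x
        - (scoreVar B ε c x (oracleWeight B ε c) / F ^ 2
          * (1 + 2 * ((R - curvNoise B ε c x) / F) + 8 * ((R - curvNoise B ε c x) / F) ^ 2)
        + 48 * 10 ^ 7 * φ * R / F ^ 3 * scoreVar B ε c x (oracleWeight B ε c)
        + 4 * 10 ^ 7 * φ / F ^ 2 * varExcess B ε c x)
        = 8 / F ^ 4 * scoreVar B ε c x (oracleWeight B ε c) * (R + curvNoise B ε c x) ^ 2 := by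
      field_simp
      ring
    linarith
  have hint := (((hV.const_mul
    (1 / F ^ 2 + 2 * R / F ^ 3 + 16 * R ^ 2 / F ^ 4 + 48 * 10 ^ 7 * φ * R / F ^ 3)).sub
      (hVn.const_mul (2 / F ^ 3))).add (hVn2.const_mul (16 / F ^ 4))).add
      (hE.const_mul (4 * 10 ^ 7 * φ / F ^ 2))
  refine (integral_mono hasMoments_ratioBound.integrable hint.integrable hle).trans ?_
  rw [HasMoments.integral_add ((((hV.const_mul _).sub (hVn.const_mul _))).add (hVn2.const_mul _))
    (hE.const_mul _), HasMoments.integral_add ((hV.const_mul _).sub (hVn.const_mul _))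
    (hVn2.const_mul _), integral_sub (hV.const_mul _).integrable (hVn.const_mul _).integrable,
    integral_const_mul, integral_const_mul, integral_const_mul, integral_const_mul,
    integral_scoreVar_oracle h]
  have h1 : 0 ≤ 2 / F ^ 3 * ∫ x, scoreVar B ε c x (oracleWeight B ε c) * curvNoise B ε c x ∂noiseLaw
      := mul_nonneg (by positivity) integral_scoreVar_mul_curvNoise_nonneg
  have h2 : 16 / F ^ 4
      * ∫ x, scoreVar B ε c x (oracleWeight B ε c) * curvNoise B ε c x ^ 2 ∂noiseLaw
      ≤ 16 / F ^ 4 * (36 * ε ^ 2 * F ^ 2 * R / τ) :=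
    mul_le_mul_of_nonneg_left (integral_scoreVar_mul_curvNoise_sq_le h) (by positivity)
  have h3 : 4 * 10 ^ 7 * φ / F ^ 2 * ∫ x, varExcess B ε c x ∂noiseLaw
      ≤ 4 * 10 ^ 7 * φ / F ^ 2 * (ε ^ 2 * R) :=
    mul_le_mul_of_nonneg_left (integral_varExcess_le h) (by positivity)
  have h4 : (1 / F ^ 2 + 2 * R / F ^ 3 + 16 * R ^ 2 / F ^ 4 + 48 * 10 ^ 7 * φ * R / F ^ 3)
      * (ε ^ 2 * (F - R)) + 16 / F ^ 4 * (36 * ε ^ 2 * F ^ 2 * R / τ)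
      + 4 * 10 ^ 7 * φ / F ^ 2 * (ε ^ 2 * R)
      = ε ^ 2 / F * (1 + R / F * (1 + 16 * (R / F) + 10 ^ 9 * φ + 576 / τ))
        - (ε ^ 2 / F * (2 * (R / F) ^ 2 + 16 * (R / F) ^ 3 + 48 * 10 ^ 7 * φ * (R / F) ^ 2)
          + ε ^ 2 / F * (48 * 10 ^ 7 * φ * (R / F))) := by
    field_simp
    ring
  have h5 : 0 ≤ ε ^ 2 / F * (2 * (R / F) ^ 2 + 16 * (R / F) ^ 3 + 48 * 10 ^ 7 * φ * (R / F) ^ 2)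
          + ε ^ 2 / F * (48 * 10 ^ 7 * φ * (R / F)) := by positivity
  linarith

end Model

end ShiftModel

namespace ShiftModel

/-! ### Expectation of the squared error on the good event -/

section Model

variable {N : ℕ} {B : Blocks N} {ε : ℝ} {c : ℕ → ℝ} {Λ φ F τ : ℝ}

lemma hasMoments_noisyEnergy (j : ℕ) : HasMoments noiseLaw fun x => noisyEnergy B ε c x j :=
  HasMoments.sum _ fun k _ =>
    (((hasMoments_noisyRe ε c k).pow 2).add ((hasMoments_noisyIm ε k).pow 2)).const_mul _

lemma hasMoments_blockCurv (j : ℕ) : HasMoments noiseLaw fun x => blockCurv B ε c x j :=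
  HasMoments.sum _ fun k _ =>
    (((hasMoments_noisyRe ε c k).pow 2).sub ((hasMoments_noisyIm ε k).pow 2)).const_mul _

lemma measurable_steinWeight (j : ℕ) : Measurable fun x => steinWeight B ε c x j := by
  have h := (hasMoments_noisyEnergy (B := B) (ε := ε) (c := c) j).1
  unfold steinWeight steinShrink
  exact measurable_const.max (measurable_const.sub
    (measurable_const.div ((measurable_const.max (h.sub_const _)).add_const _)))

lemma hasMoments_steinWeight (hε : 0 < ε) {j : ℕ} (hj : j ∈ Finset.Icc 1 B.J) :
    HasMoments noiseLaw fun x => steinWeight B ε c x j :=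
  HasMoments.of_bounded (measurable_steinWeight j) 1 fun x => by
    rw [abs_of_nonneg steinWeight_nonneg]
    exact steinWeight_le_one hε hj

lemma measurableSet_isGood : MeasurableSet {x | IsGood B ε c x Λ} := by
  have h : {x | IsGood B ε c x Λ}
      = (⋂ j ∈ Finset.Icc 1 B.J, {x | |∑ k ∈ B.block j, 2 * ε * (wt k * c k * x (k, true))|
            ≤ 2 * penalty B ε j * √(blockNoise B ε j * blockSignal B c j)})
        ∩ (⋂ j ∈ Finset.Icc 1 B.J,
          {x | |∑ k ∈ B.block j, ε ^ 2 * (wt k * (x (k, true) ^ 2 + x (k, false) ^ 2 - 2))|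
            ≤ 0.99 * penalty B ε j * blockNoise B ε j})
        ∩ (⋂ j ∈ Finset.Icc 1 B.J, {x | |∑ k ∈ B.block j, ε ^ 2 * (wt k * (x (k, true) ^ 2 - 1))|
            ≤ penalty B ε j * blockNoise B ε j})
        ∩ {x | |x (1, true)| ≤ Λ} ∩ {x | |x (1, false)| ≤ Λ} := by
    ext x
    simp only [Set.mem_inter_iff, Set.mem_iInter, Set.mem_ofPred_eq]
    exact ⟨fun h => ⟨⟨⟨⟨h.cross, h.both⟩, h.re⟩, h.first_re⟩, h.first_im⟩,
      fun h => ⟨h.1.1.1.1, h.1.1.1.2, h.1.1.2, h.1.2, h.2⟩⟩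
  rw [h]
  refine ((((Finset.measurableSet_biInter _ fun j _ => ?_).inter
    (Finset.measurableSet_biInter _ fun j _ => ?_)).inter
    (Finset.measurableSet_biInter _ fun j _ => ?_)).inter ?_).inter ?_ <;>
  exact measurableSet_le (by fun_prop) measurable_const

/-! All statistics that are even in the sine coordinates are invariant under sign changes. -/

lemma flip_true (k l : ℕ) (x : ℕ × Bool → ℝ) : flip k x (l, true) = x (l, true) := by
  simp [flip]

lemma flip_false_sq (k l : ℕ) (x : ℕ × Bool → ℝ) : flip k x (l, false) ^ 2 = x (l, false) ^ 2 := by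
  unfold flip; split_ifs <;> simp

lemma flip_false_self (k : ℕ) (x : ℕ × Bool → ℝ) : flip k x (k, false) = -x (k, false) := by
  simp [flip]

lemma flip_false_of_ne {k l : ℕ} (h : l ≠ k) (x : ℕ × Bool → ℝ) :
    flip k x (l, false) = x (l, false) := by
  simp [flip, h]

lemma noisyRe_flip (k l : ℕ) (x : ℕ × Bool → ℝ) : noisyRe ε c (flip k x) l = noisyRe ε c x l := by
  rw [noisyRe, noisyRe, flip_true]

lemma noisyIm_flip_sq (k l : ℕ) (x : ℕ × Bool → ℝ) :
    noisyIm ε (flip k x) l ^ 2 = noisyIm ε x l ^ 2 := by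
  rw [noisyIm, noisyIm, mul_pow, mul_pow, flip_false_sq]

lemma steinWeight_flip (k : ℕ) (x : ℕ × Bool → ℝ) :
    steinWeight B ε c (flip k x) = steinWeight B ε c x := by
  funext j
  simp only [steinWeight, noisyEnergy, noisyRe_flip, noisyIm_flip_sq]

lemma curv_steinWeight_flip (k : ℕ) (x : ℕ × Bool → ℝ) :
    curv B ε c (flip k x) (steinWeight B ε c (flip k x)) = curv B ε c x (steinWeight B ε c x) := by
  simp only [steinWeight_flip, curv, blockCurv, noisyRe_flip, noisyIm_flip_sq]

lemma isGood_flip (k : ℕ) (x : ℕ × Bool → ℝ) : IsGood B ε c (flip k x) Λ ↔ IsGood B ε c x Λ := by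
  have h1 : |flip k x (1, false)| = |x (1, false)| := by
    rw [← sq_eq_sq_iff_abs_eq_abs, flip_false_sq]
  constructor
  · intro h
    obtain ⟨a1, a2, a3, a4, a5⟩ := h
    simp only [flip_true, flip_false_sq, h1] at a1 a2 a3 a4 a5
    exact ⟨a1, a2, a3, a4, a5⟩
  · intro h
    obtain ⟨a1, a2, a3, a4, a5⟩ := h
    constructor <;> simpa only [flip_true, flip_false_sq, h1]

open Classical in
/-- The indicator of the good event. -/
noncomputable def goodInd {N : ℕ} (B : Blocks N) (ε : ℝ) (c : ℕ → ℝ) (Λ : ℝ) (x : ℕ × Bool → ℝ) :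
    ℝ := if IsGood B ε c x Λ then 1 else 0

lemma goodInd_nonneg (x : ℕ × Bool → ℝ) : 0 ≤ goodInd B ε c Λ x := by
  unfold goodInd; split_ifs <;> norm_num

lemma goodInd_le_one (x : ℕ × Bool → ℝ) : goodInd B ε c Λ x ≤ 1 := by
  unfold goodInd; split_ifs <;> norm_num

lemma hasMoments_goodInd : HasMoments noiseLaw (goodInd B ε c Λ) := by
  classical
  refine HasMoments.of_bounded ?_ 1 fun x => by
    rw [abs_of_nonneg (goodInd_nonneg x)]; exact goodInd_le_one x
  exact Measurable.ite measurableSet_isGood measurable_const measurable_const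

lemma goodInd_flip (k : ℕ) (x : ℕ × Bool → ℝ) :
    goodInd B ε c Λ (flip k x) = goodInd B ε c Λ x := by
  by_cases h : IsGood B ε c x Λ
  · rw [goodInd, goodInd, if_pos h, if_pos ((isGood_flip k x).2 h)]
  · rw [goodInd, goodInd, if_neg h, if_neg (mt (isGood_flip k x).1 h)]

/-- The indicator of the good event divided by the squared curvature. -/
noncomputable def goodDiv {N : ℕ} (B : Blocks N) (ε : ℝ) (c : ℕ → ℝ) (Λ : ℝ) (x : ℕ × Bool → ℝ) :
    ℝ := goodInd B ε c Λ x / curv B ε c x (steinWeight B ε c x) ^ 2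

lemma goodDiv_flip (k : ℕ) (x : ℕ × Bool → ℝ) :
    goodDiv B ε c Λ (flip k x) = goodDiv B ε c Λ x := by
  rw [goodDiv, goodDiv, goodInd_flip, curv_steinWeight_flip]

lemma hasMoments_goodDiv (h : IsRegular B ε c F φ τ) : HasMoments noiseLaw (goodDiv B ε c Λ) := by
  have hF := h.F_pos
  refine HasMoments.of_bounded ?_ (4 / F ^ 2) fun x => ?_
  · refine hasMoments_goodInd.1.div (Measurable.pow_const ?_ 2)
    exact (HasMoments.sum _ fun j hj => (hasMoments_steinWeight h.ε_pos hj).mul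
      (hasMoments_blockCurv j)).1
  · by_cases hx : IsGood B ε c x Λ
    · have hD := (hx.curv_stein_mem h).1
      have hD0 : 0 < curv B ε c x (steinWeight B ε c x) := by linarith
      rw [goodDiv, goodInd, if_pos hx, abs_of_nonneg (by positivity),
        div_le_div_iff₀ (by positivity) (by positivity)]
      have : (F / 2) ^ 2 ≤ curv B ε c x (steinWeight B ε c x) ^ 2 := by gcongr
      linarith
    · rw [goodDiv, goodInd, if_neg hx, zero_div, abs_zero]
      positivity

/-- The term of frequency `k` in the score. -/
noncomputable def scoreTerm {N : ℕ} (B : Blocks N) (ε : ℝ) (c : ℕ → ℝ) (k : ℕ)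
    (x : ℕ × Bool → ℝ) : ℝ :=
  blockFilter B (steinWeight B ε c x) k * (2 * π * k) * (noisyRe ε c x k * noisyIm ε x k)

lemma hasMoments_scoreTerm (hε : 0 < ε) (k : ℕ) : HasMoments noiseLaw (scoreTerm B ε c k) := by
  have h1 : HasMoments noiseLaw fun x => blockFilter B (steinWeight B ε c x) k := by
    refine HasMoments.sum _ fun j hj => ?_
    split_ifs
    · exact hasMoments_steinWeight hε hj
    · exact HasMoments.const 0
  exact (h1.mul (HasMoments.const _)).mul ((hasMoments_noisyRe ε c k).mul (hasMoments_noisyIm ε k))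

lemma scoreTerm_flip_self (k : ℕ) (x : ℕ × Bool → ℝ) :
    scoreTerm B ε c k (flip k x) = -scoreTerm B ε c k x := by
  rw [scoreTerm, scoreTerm, steinWeight_flip, noisyRe_flip, noisyIm, noisyIm, flip_false_self]
  ring

lemma scoreTerm_flip_of_ne {k l : ℕ} (h : l ≠ k) (x : ℕ × Bool → ℝ) :
    scoreTerm B ε c l (flip k x) = scoreTerm B ε c l x := by
  rw [scoreTerm, scoreTerm, steinWeight_flip, noisyRe_flip, noisyIm, noisyIm, flip_false_of_ne h]

lemma sum_scoreTerm_sq (x : ℕ × Bool → ℝ) :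
    ∑ k ∈ Finset.Icc 1 N, scoreTerm B ε c k x ^ 2 = scoreVar B ε c x (steinWeight B ε c x) := by
  rw [scoreVar, ← B.sum_block]
  refine Finset.sum_congr rfl fun j hj => ?_
  rw [blockVar, Finset.mul_sum]
  refine Finset.sum_congr rfl fun k hk => ?_
  rw [scoreTerm, blockFilter_eq hj hk, wt]
  ring

lemma hasMoments_score (hε : 0 < ε) : HasMoments noiseLaw fun x => score B ε c x :=
  HasMoments.sum _ fun k _ => hasMoments_scoreTerm hε k

lemma hasMoments_scoreVar_stein (hε : 0 < ε) :
    HasMoments noiseLaw fun x => scoreVar B ε c x (steinWeight B ε c x) :=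
  HasMoments.sum _ fun j hj => ((hasMoments_steinWeight hε hj).pow 2).mul (hasMoments_blockVar j)

lemma scoreVar_stein_le (hε : 0 < ε) (x : ℕ × Bool → ℝ) :
    scoreVar B ε c x (steinWeight B ε c x) ≤ scoreVar B ε c x fun _ => 1 := by
  refine Finset.sum_le_sum fun j hj => ?_
  have := steinWeight_le_one (c := c) (x := x) hε hj
  have h0 : 0 ≤ steinWeight B ε c x j := steinWeight_nonneg
  have hV := blockVar_nonneg (B := B) (ε := ε) (c := c) (x := x) (j := j)
  gcongr

/-- The score is a sum of terms that are odd in the sine noise of their own frequency; hence its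
square may be replaced by the sum of the squares, although the weights depend on the data. -/
lemma integral_goodDiv_mul_score_sq_le (h : IsRegular B ε c F φ τ) :
    ∫ x, goodDiv B ε c Λ x * score B ε c x ^ 2 ∂noiseLaw
      ≤ ∫ x, ratioBound B ε c F φ x ∂noiseLaw := by
  have hH := hasMoments_goodDiv (Λ := Λ) h
  have h1 := integral_mul_sum_sq (Finset.Icc 1 N) (fun k _ => hasMoments_scoreTerm h.ε_pos k)
    (fun k _ x => scoreTerm_flip_self (B := B) (ε := ε) (c := c) k x)
    (fun k _ l _ hlk x => scoreTerm_flip_of_ne hlk x) hH fun k _ x => goodDiv_flip k x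
  simp only [sum_scoreTerm_sq] at h1
  refine h1.trans_le (integral_mono (hH.mul (hasMoments_scoreVar_stein h.ε_pos)).integrable
    hasMoments_ratioBound.integrable fun x => ?_)
  by_cases hx : IsGood B ε c x Λ
  · refine le_of_eq_of_le ?_ (hx.scoreVar_div_le h)
    rw [goodDiv, goodInd, if_pos hx]
    ring
  · dsimp only
    rw [goodDiv, goodInd, if_neg hx, zero_div, zero_mul]
    exact ratioBound_nonneg h

lemma integral_goodInd_mul_score_sq_le (h : IsRegular B ε c F φ τ) :
    ∫ x, goodInd B ε c Λ x * score B ε c x ^ 2 ∂noiseLaw ≤ ε ^ 2 * (F + 1) := by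
  have hH := hasMoments_goodInd (B := B) (ε := ε) (c := c) (Λ := Λ)
  have h1 := integral_mul_sum_sq (Finset.Icc 1 N) (fun k _ => hasMoments_scoreTerm h.ε_pos k)
    (fun k _ x => scoreTerm_flip_self (B := B) (ε := ε) (c := c) k x)
    (fun k _ l _ hlk x => scoreTerm_flip_of_ne hlk x) hH fun k _ x => goodInd_flip k x
  simp only [sum_scoreTerm_sq] at h1
  refine h1.trans_le ((integral_mono (hH.mul (hasMoments_scoreVar_stein h.ε_pos)).integrable
    (hasMoments_scoreVar (B := B) (ε := ε) (c := c) fun _ => 1).integrable fun x => ?_).trans ?_)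
  · exact (mul_le_of_le_one_left (scoreVar_nonneg _) (goodInd_le_one x)).trans
      (scoreVar_stein_le h.ε_pos x)
  · rw [integral_scoreVar]
    simp only [one_pow, one_mul]
    rw [← Finset.mul_sum, Finset.sum_add_distrib]
    exact mul_le_mul_of_nonneg_left (add_le_add h.signal_le h.noise_le) (sq_nonneg ε)

lemma integral_goodInd_mul_score_pow_four_le (h : IsRegular B ε c F φ τ) :
    ∫ x, goodInd B ε c Λ x * score B ε c x ^ 4 ∂noiseLaw ≤ 27 * (ε ^ 2 * (F + 1)) ^ 2 := by
  have hH := hasMoments_goodInd (B := B) (ε := ε) (c := c) (Λ := Λ)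
  have h1 := integral_mul_sum_pow_four_le (Finset.Icc 1 N)
    (fun k _ => hasMoments_scoreTerm h.ε_pos k)
    (fun k _ x => scoreTerm_flip_self (B := B) (ε := ε) (c := c) k x)
    (fun k _ l _ hlk x => scoreTerm_flip_of_ne hlk x) hH goodInd_nonneg fun k _ x => goodInd_flip k x
  simp only [sum_scoreTerm_sq] at h1
  refine h1.trans ?_
  have h2 : ∫ x, goodInd B ε c Λ x * scoreVar B ε c x (steinWeight B ε c x) ^ 2 ∂noiseLaw
      ≤ ∫ x, scoreVar B ε c x (fun _ => 1) ^ 2 ∂noiseLaw := by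
    refine integral_mono (hH.mul ((hasMoments_scoreVar_stein h.ε_pos).pow 2)).integrable
      ((hasMoments_scoreVar fun _ => 1).pow 2).integrable fun x => ?_
    refine (mul_le_of_le_one_left (sq_nonneg _) (goodInd_le_one x)).trans ?_
    exact pow_le_pow_left₀ (scoreVar_nonneg _) (scoreVar_stein_le h.ε_pos x) 2
  linarith [integral_scoreVar_sq_le h]

/-- The majorant of the squared error: the expansion of the likelihood on the good event, and the
trivial bound one elsewhere. -/
noncomputable def errorBound {N : ℕ} (B : Blocks N) (ε : ℝ) (c : ℕ → ℝ) (F τ Λ : ℝ)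
    (x : ℕ × Bool → ℝ) : ℝ :=
  goodDiv B ε c Λ x * score B ε c x ^ 2
    + 216 * (1 / F ^ 4 + 1 / F ^ 5) * remainderBound B ε c F τ
      * (goodInd B ε c Λ x * score B ε c x ^ 2 + 1 / ε ^ 2 * (goodInd B ε c Λ x * score B ε c x ^ 4))
    + (1 - goodInd B ε c Λ x)

lemma hasMoments_errorBound (h : IsRegular B ε c F φ τ) :
    HasMoments noiseLaw (errorBound B ε c F τ Λ) := by
  have hs := hasMoments_score (B := B) (c := c) h.ε_pos
  have hG := hasMoments_goodInd (B := B) (ε := ε) (c := c) (Λ := Λ)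
  exact (((hasMoments_goodDiv h).mul (hs.pow 2)).add (((hG.mul (hs.pow 2)).add
    ((hG.mul (hs.pow 4)).const_mul _)).const_mul _)).add ((HasMoments.const 1).sub hG)

lemma integral_errorBound_le (h : IsRegular B ε c F φ τ) :
    ∫ x, errorBound B ε c F τ Λ x ∂noiseLaw
      ≤ ε ^ 2 / F * (1 + oracleRisk B ε c F / F
        * (1 + 16 * (oracleRisk B ε c F / F) + 10 ^ 9 * φ + 576 / τ))
        + 216 * (1 / F ^ 4 + 1 / F ^ 5) * remainderBound B ε c F τ * (28 * ε ^ 2 * (F + 1) ^ 2)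
        + noiseLaw.real {x | ¬ IsGood B ε c x Λ} := by
  have hε := h.ε_pos
  have hF := h.F_pos
  have hs := hasMoments_score (B := B) (c := c) h.ε_pos
  have hG := hasMoments_goodInd (B := B) (ε := ε) (c := c) (Λ := Λ)
  have hD := (hasMoments_goodDiv (Λ := Λ) h).mul (hs.pow 2)
  have h2 := hG.mul (hs.pow 2)
  have h4 := (hG.mul (hs.pow 4)).const_mul (1 / ε ^ 2)
  have hK : 0 ≤ 216 * (1 / F ^ 4 + 1 / F ^ 5) * remainderBound B ε c F τ := by
    have := h.oracleRisk_nonneg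
    unfold remainderBound
    positivity
  have e1 : ∫ x, (1 - goodInd B ε c Λ x) ∂noiseLaw = noiseLaw.real {x | ¬ IsGood B ε c x Λ} := by
    have hm : MeasurableSet {x | ¬ IsGood B ε c x Λ} := measurableSet_isGood.compl
    rw [← integral_indicator_one hm]
    refine integral_congr_ae (Eventually.of_forall fun x => ?_)
    by_cases hx : IsGood B ε c x Λ <;> simp [goodInd, hx]
  simp only [errorBound]
  rw [HasMoments.integral_add (hD.add ((h2.add h4).const_mul _)) ((HasMoments.const 1).sub hG),
    HasMoments.integral_add hD ((h2.add h4).const_mul _), integral_const_mul,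
    HasMoments.integral_add h2 h4, integral_const_mul, e1]
  have h5 := (integral_goodDiv_mul_score_sq_le (Λ := Λ) h).trans (integral_ratioBound_le h)
  have h6 : ∫ x, goodInd B ε c Λ x * score B ε c x ^ 2 ∂noiseLaw
      + 1 / ε ^ 2 * ∫ x, goodInd B ε c Λ x * score B ε c x ^ 4 ∂noiseLaw
      ≤ 28 * ε ^ 2 * (F + 1) ^ 2 := by
    have h7 := integral_goodInd_mul_score_sq_le (Λ := Λ) h
    have h8 := mul_le_mul_of_nonneg_left (integral_goodInd_mul_score_pow_four_le (Λ := Λ) h)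
      (by positivity : 0 ≤ 1 / ε ^ 2)
    have h9 : 1 / ε ^ 2 * (27 * (ε ^ 2 * (F + 1)) ^ 2) = 27 * ε ^ 2 * (F + 1) ^ 2 := by
      field_simp
    have h10 : ε ^ 2 * (F + 1) ≤ ε ^ 2 * (F + 1) ^ 2 := by
      gcongr
      nlinarith
    linarith
  have h7 := mul_le_mul_of_nonneg_left h6 hK
  linarith

end Model

end ShiftModel

namespace ShiftModel

/-! ### Probability of the good event -/

section Model

variable {N : ℕ} {B : Blocks N} {ε : ℝ} {c : ℕ → ℝ} {Λ φ F τ L : ℝ} {j : ℕ}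

lemma penalty_sq_mul_len (hL : Real.log (ε ^ (-5 : ℤ)) = 5 * L) (hL0 : 0 ≤ L)
    (hj : j ∈ Finset.Icc 1 B.J) : penalty B ε j ^ 2 * B.len j = 120 * L := by
  have h : (0 : ℝ) < B.len j := by exact_mod_cast Blocks.one_le_len hj
  rw [penalty, hL, Real.sq_sqrt (by positivity)]
  field_simp
  ring

/-- No single frequency of a block carries much more than the mean noise level of the block. -/
lemma sq_mul_wt_mul_len_le (hj : j ∈ Finset.Icc 1 B.J) {k : ℕ} (hk : k ∈ B.block j) :
    ε ^ 2 * wt k * B.len j ≤ 3 * blockNoise B ε j := by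
  have := mul_le_mul_of_nonneg_left (Blocks.wt_mul_len_le hj hk) (sq_nonneg ε)
  rw [blockNoise]
  linarith

lemma measureReal_cross_le (hε : 0 < ε) (hL : Real.log (ε ^ (-5 : ℤ)) = 5 * L) (hL0 : 0 ≤ L)
    (hj : j ∈ Finset.Icc 1 B.J) :
    noiseLaw.real {x | 2 * penalty B ε j * √(blockNoise B ε j * blockSignal B c j)
      < |∑ k ∈ B.block j, 2 * ε * (wt k * c k * x (k, true))|} ≤ 2 * Real.exp (-(4.8 * L)) := by
  have hS := blockNoise_pos hε hj
  have hp0 : 0 ≤ penalty B ε j := Real.sqrt_nonneg _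
  have hT : (0 : ℝ) < B.len j := by exact_mod_cast Blocks.one_le_len hj
  rcases (blockSignal_nonneg (B := B) (c := c) (j := j)).eq_or_lt with hF | hF
  · -- Without signal in the block there is no cross term.
    have h0 : ∀ k ∈ B.block j, wt k * c k ^ 2 = 0 := by
      have := (Finset.sum_eq_zero_iff_of_nonneg fun k _ =>
        mul_nonneg (wt_nonneg k) (sq_nonneg (c k))).1 hF.symm
      exact this
    have h1 : ∀ x : ℕ × Bool → ℝ, ∑ k ∈ B.block j, 2 * ε * (wt k * c k * x (k, true)) = 0 := by
      refine fun x => Finset.sum_eq_zero fun k hk => ?_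
      rcases mul_eq_zero.1 (h0 k hk) with h | h
      · rw [h]; ring
      · rw [pow_eq_zero_iff two_ne_zero] at h
        rw [h]; ring
    simp only [h1, ← hF, mul_zero, Real.sqrt_zero, abs_zero, lt_irrefl, Set.ofPred_false,
      measureReal_empty]
    positivity
  · set u := 2 * penalty B ε j * √(blockNoise B ε j * blockSignal B c j) with hu
    set V := 12 * (blockNoise B ε j * blockSignal B c j) / B.len j with hV
    have hV0 : 0 < V := by positivity
    have hu0 : 0 ≤ u := by positivity
    have hu2 : u ^ 2 = 40 * L * V := by
      have := penalty_sq_mul_len hL hL0 hj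
      rw [hu, mul_pow, mul_pow, Real.sq_sqrt (by positivity), hV]
      field_simp
      linear_combination 4 * this
    have h := measureReal_abs_linear_le (A := B.block j ×ˢ {true})
      (fun i hi => Blocks.ne_zero_of_mem_block hj (Finset.mem_product.1 hi).1)
      (v := fun i => 2 * ε * (wt i.1 * c i.1)) (t := u / V) (by positivity) u
    simp only [Finset.sum_product, Finset.sum_singleton] at h
    refine (measureReal_mono fun x hx => ?_).trans (h.trans ?_)
    · rw [Set.mem_ofPred_eq] at hx ⊢
      refine hx.le.trans (le_of_eq ?_)
      congr 1
      exact Finset.sum_congr rfl fun k _ => by ring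
    · have h1 : ∑ k ∈ B.block j, (2 * ε * (wt k * c k)) ^ 2 ≤ V := by
        rw [hV, le_div_iff₀ hT, blockSignal, Finset.mul_sum, Finset.mul_sum, Finset.sum_mul]
        refine Finset.sum_le_sum fun k hk => ?_
        have := mul_le_mul_of_nonneg_right (sq_mul_wt_mul_len_le (ε := ε) hj hk)
          (mul_nonneg (wt_nonneg k) (sq_nonneg (c k)))
        linarith
      have h2 : (u / V) ^ 2 / 2 * ∑ k ∈ B.block j, (2 * ε * (wt k * c k)) ^ 2
          ≤ (u / V) ^ 2 / 2 * V := by gcongr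
      have h3 : -(u / V) * u + (u / V) ^ 2 / 2 * V = -(20 * L) := by
        have : -(u / V) * u + (u / V) ^ 2 / 2 * V = -(u ^ 2 / (2 * V)) := by field_simp; ring
        rw [this, hu2]
        field_simp
        ring
      have h4 : -(u / V) * u + (u / V) ^ 2 / 2 * ∑ k ∈ B.block j, (2 * ε * (wt k * c k)) ^ 2
          ≤ -(4.8 * L) := by linarith
      gcongr

lemma abs_t_mul_le (hε : 0 < ε) (hp : penalty B ε j ≤ 10⁻¹ ^ 8) (hj : j ∈ Finset.Icc 1 B.J) {k : ℕ}
    (hk : k ∈ B.block j) :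
    |penalty B ε j * B.len j / (12 * blockNoise B ε j) * (ε ^ 2 * wt k)| ≤ 1 / 1000 := by
  have hS := blockNoise_pos hε hj
  have hp0 : 0 ≤ penalty B ε j := Real.sqrt_nonneg _
  have hw := wt_nonneg k
  rw [abs_of_nonneg (by positivity), div_mul_eq_mul_div, div_le_iff₀ (by positivity)]
  have h1 := mul_le_mul hp (sq_mul_wt_mul_len_le (ε := ε) hj hk) (by positivity) (by positivity)
  norm_num at h1
  linarith

lemma sum_sq_noise_le (hj : j ∈ Finset.Icc 1 B.J) :
    (∑ k ∈ B.block j, (ε ^ 2 * wt k) ^ 2) * B.len j ≤ 3 * blockNoise B ε j ^ 2 := by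
  rw [Finset.sum_mul, sq (blockNoise B ε j)]
  nth_rewrite 2 [blockNoise_eq_sum]
  rw [Finset.mul_sum, Finset.mul_sum]
  refine Finset.sum_le_sum fun k hk => ?_
  have := mul_le_mul_of_nonneg_right (sq_mul_wt_mul_len_le (ε := ε) hj hk)
    (mul_nonneg (sq_nonneg ε) (wt_nonneg k))
  linarith

lemma measureReal_both_le (hε : 0 < ε) (hL : Real.log (ε ^ (-5 : ℤ)) = 5 * L) (hL0 : 0 ≤ L)
    (hp : penalty B ε j ≤ 10⁻¹ ^ 8) (hj : j ∈ Finset.Icc 1 B.J) :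
    noiseLaw.real {x | 0.99 * penalty B ε j * blockNoise B ε j
      < |∑ k ∈ B.block j, ε ^ 2 * (wt k * (x (k, true) ^ 2 + x (k, false) ^ 2 - 2))|}
      ≤ 2 * Real.exp (-(4.8 * L)) := by
  have hS := blockNoise_pos hε hj
  have hp0 : 0 ≤ penalty B ε j := Real.sqrt_nonneg _
  have hT : (0 : ℝ) < B.len j := by exact_mod_cast Blocks.one_le_len hj
  have hpT := penalty_sq_mul_len hL hL0 hj
  set t := penalty B ε j * B.len j / (12 * blockNoise B ε j) with ht
  have ht0 : 0 ≤ t := by positivity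
  have h := measureReal_abs_quadratic_le (A := B.block j ×ˢ {true, false})
    (fun i hi => Blocks.ne_zero_of_mem_block hj (Finset.mem_product.1 hi).1)
    (v := fun i => ε ^ 2 * wt i.1) ht0
    (fun i hi => abs_t_mul_le hε hp hj (Finset.mem_product.1 hi).1)
    (0.99 * penalty B ε j * blockNoise B ε j)
  simp only [Finset.sum_product, Finset.sum_pair (show true ≠ false by decide)] at h
  refine (measureReal_mono fun x hx => ?_).trans (h.trans ?_)
  · rw [Set.mem_ofPred_eq] at hx ⊢
    refine hx.le.trans (le_of_eq ?_)
    congr 1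
    exact Finset.sum_congr rfl fun k _ => by ring
  · have h1 := sum_sq_noise_le (ε := ε) hj
    have h2 : ∑ k ∈ B.block j, ((ε ^ 2 * wt k) ^ 2 + (ε ^ 2 * wt k) ^ 2)
        ≤ 6 * blockNoise B ε j ^ 2 / B.len j := by
      rw [le_div_iff₀ hT, Finset.sum_add_distrib]
      linarith
    have h3 : 1.005 * t ^ 2 * ∑ k ∈ B.block j, ((ε ^ 2 * wt k) ^ 2 + (ε ^ 2 * wt k) ^ 2)
        ≤ 1.005 * t ^ 2 * (6 * blockNoise B ε j ^ 2 / B.len j) := by gcongr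
    have h4 : 1.005 * t ^ 2 * (6 * blockNoise B ε j ^ 2 / B.len j)
        = 1.005 / 24 * (penalty B ε j ^ 2 * B.len j) := by
      rw [ht]; field_simp; ring
    have h5 : -t * (0.99 * penalty B ε j * blockNoise B ε j)
        = -(0.99 / 12) * (penalty B ε j ^ 2 * B.len j) := by
      rw [ht]; field_simp
    rw [h5]
    rw [h4] at h3
    have h6 : -(0.99 / 12) * (penalty B ε j ^ 2 * B.len j)
        + 1.005 * t ^ 2 * ∑ k ∈ B.block j, ((ε ^ 2 * wt k) ^ 2 + (ε ^ 2 * wt k) ^ 2)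
        ≤ -(4.8 * L) := by
      rw [hpT] at h3 ⊢
      linarith
    gcongr

lemma measureReal_re_le (hε : 0 < ε) (hL : Real.log (ε ^ (-5 : ℤ)) = 5 * L) (hL0 : 0 ≤ L)
    (hp : penalty B ε j ≤ 10⁻¹ ^ 8) (hj : j ∈ Finset.Icc 1 B.J) :
    noiseLaw.real {x | penalty B ε j * blockNoise B ε j
      < |∑ k ∈ B.block j, ε ^ 2 * (wt k * (x (k, true) ^ 2 - 1))|}
      ≤ 2 * Real.exp (-(4.8 * L)) := by
  have hS := blockNoise_pos hε hj
  have hp0 : 0 ≤ penalty B ε j := Real.sqrt_nonneg _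
  have hT : (0 : ℝ) < B.len j := by exact_mod_cast Blocks.one_le_len hj
  have hpT := penalty_sq_mul_len hL hL0 hj
  set t := penalty B ε j * B.len j / (12 * blockNoise B ε j) with ht
  have ht0 : 0 ≤ t := by positivity
  have h := measureReal_abs_quadratic_le (A := B.block j ×ˢ {true})
    (fun i hi => Blocks.ne_zero_of_mem_block hj (Finset.mem_product.1 hi).1)
    (v := fun i => ε ^ 2 * wt i.1) ht0
    (fun i hi => abs_t_mul_le hε hp hj (Finset.mem_product.1 hi).1)
    (penalty B ε j * blockNoise B ε j)
  simp only [Finset.sum_product, Finset.sum_singleton] at h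
  refine (measureReal_mono fun x hx => ?_).trans (h.trans ?_)
  · rw [Set.mem_ofPred_eq] at hx ⊢
    refine hx.le.trans (le_of_eq ?_)
    congr 1
    exact Finset.sum_congr rfl fun k _ => by ring
  · have h1 := sum_sq_noise_le (ε := ε) hj
    have h2 : ∑ k ∈ B.block j, (ε ^ 2 * wt k) ^ 2 ≤ 3 * blockNoise B ε j ^ 2 / B.len j := by
      rw [le_div_iff₀ hT]
      linarith
    have h3 : 1.005 * t ^ 2 * ∑ k ∈ B.block j, (ε ^ 2 * wt k) ^ 2
        ≤ 1.005 * t ^ 2 * (3 * blockNoise B ε j ^ 2 / B.len j) := by gcongr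
    have h4 : 1.005 * t ^ 2 * (3 * blockNoise B ε j ^ 2 / B.len j)
        = 1.005 / 48 * (penalty B ε j ^ 2 * B.len j) := by
      rw [ht]; field_simp; ring
    have h5 : -t * (penalty B ε j * blockNoise B ε j)
        = -(1 / 12) * (penalty B ε j ^ 2 * B.len j) := by
      rw [ht]; field_simp
    rw [h5]
    rw [h4] at h3
    have h6 : -(1 / 12) * (penalty B ε j ^ 2 * B.len j)
        + 1.005 * t ^ 2 * ∑ k ∈ B.block j, (ε ^ 2 * wt k) ^ 2 ≤ -(4.8 * L) := by
      rw [hpT] at h3 ⊢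
      linarith
    gcongr

lemma measureReal_first_le (hΛ : 0 ≤ Λ) (hΛL : 9.6 * L ≤ Λ ^ 2) (b : Bool) :
    noiseLaw.real {x | Λ < |x (1, b)|} ≤ 2 * Real.exp (-(4.8 * L)) := by
  have h := measureReal_abs_linear_le (A := {((1, b) : ℕ × Bool)}) (by simp)
    (v := fun _ => 1) hΛ Λ
  simp only [Finset.sum_singleton, one_mul, one_pow, mul_one] at h
  have hsub : {x : ℕ × Bool → ℝ | Λ < |x (1, b)|} ⊆ {x | Λ ≤ |x (1, b)|} := fun x hx => by
    rw [Set.mem_ofPred_eq] at hx ⊢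
    exact hx.le
  refine (measureReal_mono hsub).trans (h.trans ?_)
  have : -Λ * Λ + Λ ^ 2 / 2 ≤ -(4.8 * L) := by linarith
  gcongr

/-- The good event fails only with a probability of smaller order than `ε⁴ / J`. -/
lemma measureReal_not_isGood_le (hε : 0 < ε) (hL : Real.log (ε ^ (-5 : ℤ)) = 5 * L) (hL0 : 0 ≤ L)
    (hp : ∀ j ∈ Finset.Icc 1 B.J, penalty B ε j ≤ 10⁻¹ ^ 8) (hΛ : 0 ≤ Λ)
    (hΛL : 9.6 * L ≤ Λ ^ 2) :
    noiseLaw.real {x | ¬ IsGood B ε c x Λ} ≤ (6 * B.J + 4) * Real.exp (-(4.8 * L)) := by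
  let E : ℕ → Set (ℕ × Bool → ℝ) := fun j =>
    ({x | 2 * penalty B ε j * √(blockNoise B ε j * blockSignal B c j)
      < |∑ k ∈ B.block j, 2 * ε * (wt k * c k * x (k, true))|}
    ∪ {x | 0.99 * penalty B ε j * blockNoise B ε j
      < |∑ k ∈ B.block j, ε ^ 2 * (wt k * (x (k, true) ^ 2 + x (k, false) ^ 2 - 2))|})
    ∪ {x | penalty B ε j * blockNoise B ε j
      < |∑ k ∈ B.block j, ε ^ 2 * (wt k * (x (k, true) ^ 2 - 1))|}
  have hE : ∀ j ∈ Finset.Icc 1 B.J, noiseLaw.real (E j) ≤ 6 * Real.exp (-(4.8 * L)) := by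
    intro j hj
    have h1 := measureReal_cross_le (c := c) hε hL hL0 hj
    have h2 := measureReal_both_le hε hL hL0 (hp j hj) hj
    have h3 := measureReal_re_le hε hL hL0 (hp j hj) hj
    refine (measureReal_union_le _ _).trans ?_
    have h4 := measureReal_union_le (μ := noiseLaw)
      {x | 2 * penalty B ε j * √(blockNoise B ε j * blockSignal B c j)
        < |∑ k ∈ B.block j, 2 * ε * (wt k * c k * x (k, true))|}
      {x | 0.99 * penalty B ε j * blockNoise B ε j
        < |∑ k ∈ B.block j, ε ^ 2 * (wt k * (x (k, true) ^ 2 + x (k, false) ^ 2 - 2))|}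
    linarith
  have hsub : {x | ¬ IsGood B ε c x Λ} ⊆ ((⋃ j ∈ Finset.Icc 1 B.J, E j)
      ∪ {x | Λ < |x (1, true)|}) ∪ {x | Λ < |x (1, false)|} := by
    intro x hx
    by_contra hcon
    simp only [Set.mem_union, Set.mem_iUnion, not_or, not_exists, E, Set.mem_ofPred_eq,
      not_lt] at hcon
    obtain ⟨⟨h1, h2⟩, h3⟩ := hcon
    exact hx ⟨fun j hj => (h1 j hj).1.1, fun j hj => (h1 j hj).1.2, fun j hj => (h1 j hj).2, h2, h3⟩
  have h1 := measureReal_mono (μ := noiseLaw) hsub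
  have h2 := measureReal_union_le (μ := noiseLaw) ((⋃ j ∈ Finset.Icc 1 B.J, E j)
      ∪ {x | Λ < |x (1, true)|}) {x | Λ < |x (1, false)|}
  have h3 := measureReal_union_le (μ := noiseLaw) (⋃ j ∈ Finset.Icc 1 B.J, E j)
    {x | Λ < |x (1, true)|}
  have h4 : noiseLaw.real (⋃ j ∈ Finset.Icc 1 B.J, E j) ≤ B.J * (6 * Real.exp (-(4.8 * L))) := by
    refine (measureReal_biUnion_finset_le _ _).trans ((Finset.sum_le_sum hE).trans (le_of_eq ?_))
    rw [Finset.sum_const, Nat.card_Icc, nsmul_eq_mul, Nat.add_sub_cancel]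
  have h5 := measureReal_first_le hΛ hΛL true
  have h6 := measureReal_first_le hΛ hΛL false
  linarith

end Model

end ShiftModel

namespace ShiftModel

/-! ### The estimator in terms of the noise coordinates -/

section Path

variable {N : ℕ} {B : Blocks N} {ρ ε θ : ℝ} {f : ℝ → ℝ} {b : ℝ≥0 → ℝ} {k : ℕ}

lemma IsSignal.rotCos_eq_noisyRe (hf : IsSignal ρ f) (hb : Continuous b) (hk : k ≠ 0) :
    rotCos θ (obsPath ε θ f b) k = noisyRe ε (coef f) (noiseCoord θ b) k := by
  rw [hf.rotCos_obsPath hb, noisyRe, noiseCoord_true hb hk]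

lemma IsSignal.rotSin_eq_noisyIm (hf : IsSignal ρ f) (hb : Continuous b) (hk : k ≠ 0) :
    rotSin θ (obsPath ε θ f b) k = noisyIm ε (noiseCoord θ b) k := by
  rw [hf.rotSin_obsPath hb, noisyIm, noiseCoord_false hb hk]

lemma IsSignal.steinFilter_eq (hf : IsSignal ρ f) (hb : Continuous b) :
    steinFilter B ε (obsPath ε θ f b)
      = blockFilter B (steinWeight B ε (coef f) (noiseCoord θ b)) := by
  have hx := hf.continuous_obsPath (ε := ε) (θ := θ) hb
  funext k
  refine Finset.sum_congr rfl fun j hj => ?_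
  have henergy : energy B (obsPath ε θ f b) j = noisyEnergy B ε (coef f) (noiseCoord θ b) j := by
    refine Finset.sum_congr rfl fun k hk => ?_
    have hk0 := Blocks.ne_zero_of_mem_block hj hk
    rw [obsCos_sq_add_obsSin_sq hx k θ, hf.rotCos_eq_noisyRe hb hk0, hf.rotSin_eq_noisyIm hb hk0]
    rfl
  rw [steinValue, steinWeight, steinShrink, henergy, blockNoise, mul_assoc 2]

lemma IsSignal.profile_eq_trigProfile (hf : IsSignal ρ f) (hb : Continuous b) (u : ℝ) :
    profile N (obsPath ε θ f b) (steinFilter B ε (obsPath ε θ f b)) (θ + u)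
      = trigProfile N (blockFilter B (steinWeight B ε (coef f) (noiseCoord θ b)))
        (noisyRe ε (coef f) (noiseCoord θ b)) (noisyIm ε (noiseCoord θ b)) u := by
  rw [profile_eq (hf.continuous_obsPath hb), trigProfile, hf.steinFilter_eq hb]
  congr 1
  refine Finset.sum_congr rfl fun k hk => ?_
  rw [hf.rotCos_eq_noisyRe hb (ne_zero_of_mem_Icc hk), hf.rotSin_eq_noisyIm hb
    (ne_zero_of_mem_Icc hk)]

lemma abs_arctan_sub_arctan_le (x y : ℝ) : |Real.arctan x - Real.arctan y| ≤ |x - y| := by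
  have h : LipschitzWith 1 Real.arctan := by
    refine lipschitzWith_of_nnnorm_deriv_le Real.differentiable_arctan fun z => ?_
    rw [← NNReal.coe_le_coe, coe_nnnorm, Real.deriv_arctan, Real.norm_eq_abs,
      abs_of_nonneg (by positivity), NNReal.coe_one, div_le_one (by positivity)]
    linarith [sq_nonneg z]
  simpa [Real.dist_eq] using h.dist_le_mul x y

lemma abs_prelim_le (x : ℝ → ℝ) : |prelim x| ≤ 1 / 4 := by
  unfold prelim
  split_ifs
  · norm_num
  · have h : |Real.arctan (obsSin x 1 / obsCos x 1)| ≤ π / 2 := by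
      rw [abs_le]
      exact ⟨(Real.neg_pi_div_two_lt_arctan _).le, (Real.arctan_lt_pi_div_two _).le⟩
    rw [abs_mul, abs_of_pos (by positivity)]
    refine (mul_le_mul_of_nonneg_left h (by positivity)).trans (le_of_eq ?_)
    field_simp
    norm_num

lemma IsSignal.le_abs_coef_one (hf : IsSignal ρ f) : √2 * ρ ≤ |coef f 1| := by
  have h : coef f 1 = √2 * ∫ t in (-1 / 2 : ℝ)..(1 / 2), f t * Real.cos (2 * π * t) := by
    rw [coef]
    simp only [Nat.cast_one, mul_one, mul_comm (Real.cos _)]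
  rw [h, abs_mul, abs_of_nonneg (Real.sqrt_nonneg 2)]
  exact mul_le_mul_of_nonneg_left hf.le_abs_integral (Real.sqrt_nonneg 2)

/-- If the noise at the first frequency is small, then the preliminary estimator is within the
radius of the search interval. -/
lemma IsSignal.abs_prelim_sub_le {T Λ : ℝ} (hf : IsSignal ρ f) (hb : Continuous b) (hρ : 0 < ρ)
    (hT : T < 1 / 4) (hθ : |θ| ≤ T) (hε : 0 ≤ ε)
    (hre : |noiseCoord θ b (1, true)| ≤ Λ) (him : |noiseCoord θ b (1, false)| ≤ Λ)
    (hΛ : 5 * (ε * Λ) ≤ ρ * Real.cos (2 * π * T)) :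
    |prelim (obsPath ε θ f b) - θ| ≤ ε * (Λ / (ρ * Real.cos (2 * π * T) ^ 2)) := by
  set C := Real.cos (2 * π * T) with hC
  have hπ := Real.pi_pos
  have hT0 : 0 ≤ T := (abs_nonneg _).trans hθ
  have hC0 : 0 < C := Real.cos_pos_of_mem_Ioo
    ⟨by have : 0 ≤ 2 * π * T := by positivity
        linarith, by nlinarith⟩
  have hC1 : C ≤ 1 := Real.cos_le_one _
  have hx := hf.continuous_obsPath (ε := ε) (θ := θ) hb
  have hcos := obsCos_eq hx 1 θ
  have hsin := obsSin_eq hx 1 θ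
  rw [hf.rotCos_eq_noisyRe hb one_ne_zero, hf.rotSin_eq_noisyIm hb one_ne_zero] at hcos hsin
  simp only [Nat.cast_one, mul_one] at hcos hsin
  set α := 2 * π * θ with hα
  have hαabs : |α| ≤ 2 * π * T := by
    rw [hα, abs_mul, abs_of_pos (by positivity)]
    exact mul_le_mul_of_nonneg_left hθ (by positivity)
  have hαlt : |α| < π / 2 := by nlinarith
  have hcosα : C ≤ Real.cos α := by
    rw [← Real.cos_abs α, hC]
    exact Real.cos_le_cos_of_nonneg_of_le_pi (abs_nonneg _) (by nlinarith) hαabs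
  have hcosα0 : 0 < Real.cos α := hC0.trans_le hcosα
  set a := noisyRe ε (coef f) (noiseCoord θ b) 1 with ha
  set d := noisyIm ε (noiseCoord θ b) 1 with hd
  have hd_le : |d| ≤ ε * Λ := by
    rw [hd, noisyIm, abs_mul, abs_of_nonneg hε]
    exact mul_le_mul_of_nonneg_left him hε
  have hεΛ : 0 ≤ ε * Λ := (abs_nonneg _).trans hd_le
  have ha_le : √2 * ρ - ε * Λ ≤ |a| := by
    have h1 : |ε * noiseCoord θ b (1, true)| ≤ ε * Λ := by
      rw [abs_mul, abs_of_nonneg hε]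
      exact mul_le_mul_of_nonneg_left hre hε
    have h2 : |coef f 1| ≤ |a| + |ε * noiseCoord θ b (1, true)| := by
      have : coef f 1 = a - ε * noiseCoord θ b (1, true) := by rw [ha, noisyRe]; ring
      rw [this]
      exact abs_sub _ _
    linarith [hf.le_abs_coef_one]
  have hsqrt : (7 : ℝ) / 5 ≤ √2 := by
    rw [Real.le_sqrt (by norm_num) (by norm_num)]
    norm_num
  have hden : ρ * C ≤ |obsCos (obsPath ε θ f b) 1| := by
    have h1 : |a * Real.cos α| ≤ |obsCos (obsPath ε θ f b) 1| + |d * Real.sin α| := by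
      have : a * Real.cos α = obsCos (obsPath ε θ f b) 1 + d * Real.sin α := by rw [hcos]; ring
      rw [this]
      exact abs_add_le _ _
    have h2 : |d * Real.sin α| ≤ ε * Λ := by
      rw [abs_mul]
      calc |d| * |Real.sin α| ≤ ε * Λ * 1 :=
            mul_le_mul hd_le (Real.abs_sin_le_one _) (abs_nonneg _) hεΛ
        _ = _ := mul_one _
    have h3 : (√2 * ρ - ε * Λ) * C ≤ |a * Real.cos α| := by
      rw [abs_mul, abs_of_pos hcosα0]
      exact mul_le_mul ha_le hcosα hC0.le (abs_nonneg _)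
    have h4 : 7 / 5 * (ρ * C) ≤ √2 * (ρ * C) := mul_le_mul_of_nonneg_right hsqrt (by positivity)
    have h5 : ε * Λ * C ≤ ε * Λ := mul_le_of_le_one_right hεΛ hC1
    linarith
  have hne : obsCos (obsPath ε θ f b) 1 ≠ 0 := by
    intro h0
    rw [h0, abs_zero] at hden
    exact absurd hden (not_le.2 (by positivity))
  have htan : obsSin (obsPath ε θ f b) 1 / obsCos (obsPath ε θ f b) 1 - Real.tan α
      = d / (obsCos (obsPath ε θ f b) 1 * Real.cos α) := by
    rw [Real.tan_eq_sin_div_cos, div_sub_div _ _ hne hcosα0.ne']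
    congr 1
    rw [hsin, hcos]
    linear_combination d * Real.sin_sq_add_cos_sq α
  have hθα : θ = 1 / (2 * π) * Real.arctan (Real.tan α) := by
    rw [Real.arctan_tan (by linarith [(abs_lt.1 hαlt).1]) (abs_lt.1 hαlt).2, hα]
    field_simp
  have hmain : |prelim (obsPath ε θ f b) - θ|
      ≤ 1 / (2 * π) * |d / (obsCos (obsPath ε θ f b) 1 * Real.cos α)| := by
    rw [prelim, if_neg hne]
    nth_rewrite 3 [hθα]
    rw [← mul_sub, abs_mul, abs_of_pos (by positivity : 0 < 1 / (2 * π)), ← htan]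
    exact mul_le_mul_of_nonneg_left (abs_arctan_sub_arctan_le _ _) (by positivity)
  have hquot : |d / (obsCos (obsPath ε θ f b) 1 * Real.cos α)| ≤ ε * Λ / (ρ * C * C) := by
    rw [abs_div, abs_mul, abs_of_pos hcosα0]
    gcongr
  have hpi : 1 / (2 * π) ≤ 1 := by
    rw [div_le_one (by positivity)]
    linarith [Real.two_le_pi]
  calc _ ≤ _ := hmain
    _ ≤ 1 * (ε * Λ / (ρ * C * C)) :=
        mul_le_mul hpi hquot (abs_nonneg _) zero_le_one
    _ = _ := by rw [one_mul, sq, ← mul_assoc, mul_div_assoc]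

/-- The squared error of the estimator is at most the majorant `errorBound`. -/
lemma IsSignal.sq_error_le {T Λ F φ τ t : ℝ} (hf : IsSignal ρ f) (hb : Continuous b) (hρ : 0 < ρ)
    (hT : T < 1 / 4) (hθ : |θ| ≤ T) (h : IsRegular B ε (coef f) F φ τ)
    (hΛ : 5 * (ε * Λ) ≤ ρ * Real.cos (2 * π * T))
    (hΛ' : Λ / (ρ * Real.cos (2 * π * T) ^ 2) ≤ Real.log (ε ^ (-2 : ℤ)))
    (hδ : ε * Real.log (ε ^ (-2 : ℤ)) ≤ 1 / 4)
    (hK : 4 * Real.log (ε ^ (-2 : ℤ)) * remainderBound B ε (coef f) F τ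
      + 8 / 3 * Real.log (ε ^ (-2 : ℤ)) ^ 2 * remainderBound B ε (coef f) F τ ≤ F / 8)
    (ht : IsEstimate B ε (obsPath ε θ f b) t) :
    |t - θ| ≤ 1 ∧ (t - θ) ^ 2 ≤ errorBound B ε (coef f) F τ Λ (noiseCoord θ b) := by
  have hε := h.ε_pos
  obtain ⟨⟨ht1, ht2⟩, htmax⟩ := ht
  have habs : |t - θ| ≤ 1 := by
    have h1 := abs_le.1 (abs_prelim_le (obsPath ε θ f b))
    have h2 := abs_le.1 hθ
    rw [abs_le]
    constructor <;> linarith [h1.1, h1.2, h2.1, h2.2]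
  refine ⟨habs, ?_⟩
  set δ := ε * Real.log (ε ^ (-2 : ℤ)) with hδdef
  set z := noiseCoord θ b with hz
  by_cases hG : IsGood B ε (coef f) z Λ
  · have hpre : |prelim (obsPath ε θ f b) - θ| ≤ δ :=
      (hf.abs_prelim_sub_le hb hρ hT hθ hε.le hG.first_re hG.first_im hΛ).trans
        (mul_le_mul_of_nonneg_left hΛ' hε.le)
    have hpre' := abs_le.1 hpre
    have hu : |t - θ| ≤ 2 * δ := by
      rw [abs_le]
      constructor <;> linarith [hpre'.1, hpre'.2]
    have hδε : δ / ε = Real.log (ε ^ (-2 : ℤ)) := by rw [hδdef]; field_simp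
    have hmax : ∀ s ∈ Set.Icc (0 : ℝ) 1,
        trigProfile N (blockFilter B (steinWeight B ε (coef f) z)) (noisyRe ε (coef f) z)
            (noisyIm ε z) (s * (t - θ))
          ≤ trigProfile N (blockFilter B (steinWeight B ε (coef f) z)) (noisyRe ε (coef f) z)
            (noisyIm ε z) (t - θ) := by
      intro s hs
      rw [hz, ← hf.profile_eq_trigProfile hb, ← hf.profile_eq_trigProfile hb, add_sub_cancel]
      refine htmax ⟨?_, ?_⟩
      · have h1 : 0 ≤ s * (t - (prelim (obsPath ε θ f b) - δ)) :=
          mul_nonneg hs.1 (by linarith)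
        have h2 : 0 ≤ (1 - s) * (θ - (prelim (obsPath ε θ f b) - δ)) :=
          mul_nonneg (by linarith [hs.2]) (by linarith [hpre'.2])
        linarith
      · have h1 : 0 ≤ s * ((prelim (obsPath ε θ f b) + δ) - t) :=
          mul_nonneg hs.1 (by linarith)
        have h2 : 0 ≤ (1 - s) * ((prelim (obsPath ε θ f b) + δ) - θ) :=
          mul_nonneg (by linarith [hs.2]) (by linarith [hpre'.1])
        linarith
    have hmain := hG.sq_error_le h hu (by rw [hδε]; exact hK) hmax
    refine hmain.trans (le_of_eq ?_)
    rw [errorBound, goodDiv, goodInd, if_pos hG]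
    ring
  · rw [errorBound, goodDiv, goodInd, if_neg hG]
    simp only [zero_div, zero_mul, mul_zero, add_zero, sub_zero, zero_add]
    rw [← sq_abs]
    exact pow_le_one₀ (abs_nonneg _) habs

/-- The mean squared error is at most the expectation of the majorant. -/
lemma IsSignal.integral_sq_error_le {T Λ F φ τ : ℝ} (hf : IsSignal ρ f) (hρ : 0 < ρ)
    (hT : T < 1 / 4) (hθ : |θ| ≤ T) (h : IsRegular B ε (coef f) F φ τ)
    (hΛ : 5 * (ε * Λ) ≤ ρ * Real.cos (2 * π * T))
    (hΛ' : Λ / (ρ * Real.cos (2 * π * T) ^ 2) ≤ Real.log (ε ^ (-2 : ℤ)))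
    (hδ : ε * Real.log (ε ^ (-2 : ℤ)) ≤ 1 / 4)
    (hK : 4 * Real.log (ε ^ (-2 : ℤ)) * remainderBound B ε (coef f) F τ
      + 8 / 3 * Real.log (ε ^ (-2 : ℤ)) ^ 2 * remainderBound B ε (coef f) F τ ≤ F / 8)
    {Ω : Type*} [MeasurableSpace Ω] {P : Measure Ω} [IsProbabilityMeasure P]
    {W : ℝ≥0 → Ω → ℝ} (hW : IsBrownianReal W P) {θhat : Ω → ℝ} (hm : AEMeasurable θhat P)
    (hest : ∀ᵐ ω ∂P, IsEstimate B ε (obsPath ε θ f (W · ω)) (θhat ω)) :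
    Integrable (fun ω => (θhat ω - θ) ^ 2) P ∧
      ∫ ω, (θhat ω - θ) ^ 2 ∂P ≤ ∫ x, errorBound B ε (coef f) F τ Λ x ∂noiseLaw := by
  have hall : ∀ᵐ ω ∂P, |θhat ω - θ| ≤ 1 ∧
      (θhat ω - θ) ^ 2 ≤ errorBound B ε (coef f) F τ Λ (noiseCoord θ (W · ω)) := by
    filter_upwards [hest, hW.cont] with ω h1 h2
    exact hf.sq_error_le h2 hρ hT hθ h hΛ hΛ' hδ hK h1
  have hint : Integrable (fun ω => (θhat ω - θ) ^ 2) P := by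
    refine Integrable.of_bound ((hm.sub_const θ).pow_const 2).aestronglyMeasurable 1 ?_
    filter_upwards [hall] with ω hω
    rw [Real.norm_eq_abs, abs_pow]
    exact pow_le_one₀ (abs_nonneg _) hω.1
  have hlaw := hasLaw_noiseCoord hW θ
  have hE := hasMoments_errorBound (Λ := Λ) h
  refine ⟨hint, ?_⟩
  rw [← hlaw.integral_comp hE.1.aestronglyMeasurable]
  have hcomp : Integrable (errorBound B ε (coef f) F τ Λ ∘ fun ω => noiseCoord θ (W · ω)) P := by
    rw [← integrable_map_measure hE.1.aestronglyMeasurable hlaw.aemeasurable, hlaw.map_eq]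
    exact hE.integrable
  refine integral_mono_ae hint hcomp ?_
  filter_upwards [hall] with ω hω using hω.2

end Path

end ShiftModel

namespace ShiftModel

/-! ### The oracle risk -/

section Signal

variable {N : ℕ} {B : Blocks N} {β L ρ ε : ℝ} {f : ℝ → ℝ}

lemma derivSq_eq (f : ℝ → ℝ) : derivSq f = ∑' k : ℕ, wt k * coef f k ^ 2 := rfl

lemma one_le_two_pi_mul {k : ℕ} (hk : k ≠ 0) : 1 ≤ 2 * π * k := by
  have h1 : (1 : ℝ) ≤ k := by exact_mod_cast Nat.one_le_iff_ne_zero.2 hk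
  nlinarith [Real.two_le_pi]

lemma wt_le_rpow (hβ : 1 < β) (k : ℕ) : wt k ≤ (2 * π * k) ^ (2 * β) := by
  rcases eq_or_ne k 0 with rfl | hk
  · simp only [wt, Nat.cast_zero, mul_zero]
    rw [Real.zero_rpow (by linarith)]
    norm_num
  · rw [wt, ← Real.rpow_natCast]
    exact Real.rpow_le_rpow_of_exponent_le (one_le_two_pi_mul hk) (by push_cast; linarith)

lemma IsSobolevSignal.summable_wt (hf : IsSobolevSignal β L ρ f) (hβ : 1 < β) :
    Summable fun k : ℕ => wt k * coef f k ^ 2 :=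
  hf.summable.of_nonneg_of_le (fun k => mul_nonneg (wt_nonneg k) (sq_nonneg _)) fun k =>
    mul_le_mul_of_nonneg_right (wt_le_rpow hβ k) (sq_nonneg _)

lemma IsSobolevSignal.derivSq_le (hf : IsSobolevSignal β L ρ f) (hβ : 1 < β) :
    derivSq f ≤ L ^ 2 := by
  refine le_trans ?_ hf.tsum_le
  exact (hf.summable_wt hβ).tsum_le_tsum
    (fun k => mul_le_mul_of_nonneg_right (wt_le_rpow hβ k) (sq_nonneg _)) hf.summable

lemma IsSignal.le_wt_mul_coef_sq (hf : IsSignal ρ f) (hρ : 0 < ρ) :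
    ρ ^ 2 ≤ wt 1 * coef f 1 ^ 2 := by
  have h1 := hf.le_abs_coef_one
  have h2 : (√2 * ρ) ^ 2 ≤ |coef f 1| ^ 2 := by gcongr
  rw [sq_abs, mul_pow, Real.sq_sqrt (by norm_num)] at h2
  have h3 : 1 ≤ wt 1 := by
    have := one_le_two_pi_mul one_ne_zero
    rw [wt]
    exact one_le_pow₀ this
  nlinarith [sq_nonneg (coef f 1), sq_nonneg ρ]

lemma IsSobolevSignal.le_derivSq (hf : IsSobolevSignal β L ρ f) (hβ : 1 < β) (hρ : 0 < ρ) :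
    ρ ^ 2 ≤ derivSq f := by
  refine (hf.le_wt_mul_coef_sq hρ).trans ?_
  exact (hf.summable_wt hβ).le_tsum 1 fun k _ => mul_nonneg (wt_nonneg k) (sq_nonneg _)

lemma sum_blockSignal (c : ℕ → ℝ) : ∑ j ∈ Finset.Icc 1 B.J, blockSignal B c j
    = ∑ k ∈ Finset.Icc 1 N, wt k * c k ^ 2 := B.sum_block _

lemma IsSobolevSignal.sum_blockSignal_le (hf : IsSobolevSignal β L ρ f) (hβ : 1 < β) :
    ∑ j ∈ Finset.Icc 1 B.J, blockSignal B (coef f) j ≤ derivSq f := by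
  rw [sum_blockSignal]
  exact (hf.summable_wt hβ).sum_le_tsum _ fun k _ => mul_nonneg (wt_nonneg k) (sq_nonneg _)

/-- No blockwise constant filter has a smaller risk than the oracle risk. -/
lemma IsSobolevSignal.oracleRisk_le_risk (hf : IsSobolevSignal β L ρ f) (hβ : 1 < β) (hε : 0 < ε)
    {h : ℕ → ℝ} (hh : h ∈ B.filters) : oracleRisk B ε (coef f) (derivSq f) ≤ risk ε f h := by
  obtain ⟨-, hsupp, hconst⟩ := hh
  set r : ℕ → ℝ := fun k =>
    wt k * ((1 - h k) ^ 2 * coef f k ^ 2 + ε ^ 2 * h k ^ 2) - wt k * coef f k ^ 2 with hr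
  have hr0 : ∀ k ∉ Finset.Icc 1 N, r k = 0 := by
    intro k hk
    simp only [hr, hsupp k hk]
    ring
  have hrisk : risk ε f h = derivSq f + ∑ k ∈ Finset.Icc 1 N, r k := by
    have hrsum : ∑' k, r k = ∑ k ∈ Finset.Icc 1 N, r k := tsum_eq_sum hr0
    rw [derivSq_eq, ← hrsum, ← (hf.summable_wt hβ).tsum_add (summable_of_ne_finset_zero hr0)]
    refine tsum_congr fun k => ?_
    simp only [hr, wt]
    ring
  have hblock : ∀ j ∈ Finset.Icc 1 B.J,
      blockRisk B ε (coef f) j - blockSignal B (coef f) j ≤ ∑ k ∈ B.block j, r k := by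
    intro j hj
    obtain ⟨k₀, hk₀⟩ := Finset.card_pos.1 (Blocks.one_le_len hj)
    have hS := blockNoise_pos (B := B) hε hj
    have hF := blockSignal_nonneg (B := B) (c := coef f) (j := j)
    have h1 : ∑ k ∈ B.block j, r k = (1 - h k₀) ^ 2 * blockSignal B (coef f) j
        + h k₀ ^ 2 * blockNoise B ε j - blockSignal B (coef f) j := by
      rw [blockSignal, blockNoise_eq_sum, Finset.mul_sum, Finset.mul_sum,
        ← Finset.sum_add_distrib, ← Finset.sum_sub_distrib]
      refine Finset.sum_congr rfl fun k hk => ?_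
      simp only [hr, hconst j hj k hk k₀ hk₀]
      ring
    rw [h1, blockRisk]
    refine sub_le_sub_right ?_ _
    rw [div_le_iff₀ (by positivity)]
    -- the difference is a square, by completing it at the minimizer
    have h2 := sq_nonneg (blockSignal B (coef f) j
      - h k₀ * (blockSignal B (coef f) j + blockNoise B ε j))
    linarith
  have := Finset.sum_le_sum hblock
  rw [B.sum_block, Finset.sum_sub_distrib] at this
  rw [hrisk, oracleRisk]
  linarith

/-- The part of `‖f'‖²` beyond the frequency `N` decays with the smoothness of the signal. -/
lemma IsSobolevSignal.tail_le (hf : IsSobolevSignal β L ρ f) (hβ : 1 < β) {y : ℝ} (hy : 0 < y)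
    (hN : y ≤ N + 1) :
    derivSq f - ∑ j ∈ Finset.Icc 1 B.J, blockSignal B (coef f) j
      ≤ L ^ 2 * (y ^ (2 * β - 2))⁻¹ := by
  rw [sum_blockSignal]
  have hs := hf.summable_wt hβ
  have hyp : 0 < y ^ (2 * β - 2) := Real.rpow_pos_of_pos hy _
  rw [← div_eq_mul_inv, le_div_iff₀ hyp]
  set r : ℕ → ℝ := fun k => if k ∈ Finset.Icc 1 N then wt k * coef f k ^ 2 else 0 with hr
  have hr0 : ∀ k ∉ Finset.Icc 1 N, r k = 0 := fun k hk => if_neg hk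
  have hrs : Summable r := summable_of_ne_finset_zero hr0
  have h1 : derivSq f - ∑ k ∈ Finset.Icc 1 N, wt k * coef f k ^ 2
      = ∑' k, (wt k * coef f k ^ 2 - r k) := by
    rw [hs.tsum_sub hrs, tsum_eq_sum hr0, derivSq_eq]
    congr 1
    exact Finset.sum_congr rfl fun k hk => by simp only [hr, if_pos hk]
  rw [h1, ← tsum_mul_right]
  refine le_trans ?_ hf.tsum_le
  refine ((hs.sub hrs).mul_right _).tsum_le_tsum (fun k => ?_) hf.summable
  by_cases hk : k ∈ Finset.Icc 1 N
  · simp only [hr, if_pos hk, sub_self, zero_mul]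
    positivity
  · simp only [hr, if_neg hk, sub_zero]
    rcases eq_or_ne k 0 with rfl | hk0
    · simp only [wt, Nat.cast_zero, mul_zero]
      rw [Real.zero_rpow (by linarith)]
      norm_num
    · have hkN : N + 1 ≤ k := by
        rw [Finset.mem_Icc] at hk
        omega
      have hk' : (N : ℝ) + 1 ≤ k := by exact_mod_cast hkN
      have hkpos : (0 : ℝ) < k := by linarith
      have h2 : y ≤ 2 * π * k := by nlinarith [Real.two_le_pi]
      have h3 : y ^ (2 * β - 2) ≤ (2 * π * k) ^ (2 * β - 2) :=
        Real.rpow_le_rpow hy.le h2 (by linarith)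
      have h4 : (2 * π * k) ^ (2 * β) = wt k * (2 * π * k) ^ (2 * β - 2) := by
        rw [wt, ← Real.rpow_natCast, ← Real.rpow_add (by positivity)]
        congr 1
        push_cast
        ring
      rw [h4]
      have := mul_le_mul_of_nonneg_left h3 (mul_nonneg (wt_nonneg k) (sq_nonneg (coef f k)))
      linarith

lemma sum_blockNoise_le : ∑ j ∈ Finset.Icc 1 B.J, blockNoise B ε j ≤ 40 * ε ^ 2 * (N : ℝ) ^ 3 := by
  have h1 : ∑ j ∈ Finset.Icc 1 B.J, blockNoise B ε j = ε ^ 2 * ∑ k ∈ Finset.Icc 1 N, wt k := by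
    rw [← B.sum_block, Finset.mul_sum]
    rfl
  have h2 : ∑ k ∈ Finset.Icc 1 N, wt k ≤ N * wt N := by
    refine (Finset.sum_le_card_nsmul _ _ (wt N) fun k hk =>
      wt_mono (Finset.mem_Icc.1 hk).2).trans (le_of_eq ?_)
    rw [Nat.card_Icc, nsmul_eq_mul, Nat.add_sub_cancel]
  have h3 : (N : ℝ) * wt N ≤ 40 * (N : ℝ) ^ 3 := by
    have h4 : π ^ 2 ≤ 10 := by nlinarith [Real.pi_lt_d2, Real.pi_pos]
    have h5 : (0 : ℝ) ≤ (N : ℝ) ^ 3 := by positivity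
    rw [wt]
    nlinarith
  rw [h1]
  have := mul_le_mul_of_nonneg_left (h2.trans h3) (sq_nonneg ε)
  linarith

/-- The first block alone gives a lower bound of order `ε²` for the oracle risk. -/
lemma IsSobolevSignal.le_oracleRisk (hf : IsSobolevSignal β L ρ f) (hβ : 1 < β) (hρ : 0 < ρ)
    (hε : 0 < ε) (hε1 : ε ≤ 1) :
    ρ ^ 2 / (ρ ^ 2 + 1) * ε ^ 2 ≤ oracleRisk B ε (coef f) (derivSq f) := by
  have hS := blockNoise_pos (B := B) hε B.one_mem
  have hF : ρ ^ 2 ≤ blockSignal B (coef f) 1 :=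
    (hf.le_wt_mul_coef_sq hρ).trans (Finset.single_le_sum
      (f := fun k => wt k * coef f k ^ 2) (fun k _ => mul_nonneg (wt_nonneg k) (sq_nonneg _))
      B.one_mem_block)
  have hS1 : ε ^ 2 ≤ blockNoise B ε 1 := by
    rw [blockNoise_eq_sum]
    have h1 : 1 ≤ wt 1 := one_le_pow₀ (one_le_two_pi_mul one_ne_zero)
    have h2 : ε ^ 2 * wt 1 ≤ ∑ k ∈ B.block 1, ε ^ 2 * wt k :=
      Finset.single_le_sum (f := fun k => ε ^ 2 * wt k)
        (fun k _ => mul_nonneg (sq_nonneg ε) (wt_nonneg k)) B.one_mem_block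
    nlinarith [sq_nonneg ε]
  have hρ2 : 0 < ρ ^ 2 := by positivity
  have hR : ρ ^ 2 / (ρ ^ 2 + 1) * ε ^ 2 ≤ blockRisk B ε (coef f) 1 := by
    set F := blockSignal B (coef f) 1
    set S := blockNoise B ε 1
    have hF0 : 0 < F := hρ2.trans_le hF
    have h1 : ρ ^ 2 / (ρ ^ 2 + 1) * ε ^ 2 ≤ ρ ^ 2 * ε ^ 2 / (ρ ^ 2 + ε ^ 2) := by
      rw [div_mul_eq_mul_div]
      gcongr
      exact pow_le_one₀ hε.le hε1
    have h2 : ρ ^ 2 * ε ^ 2 / (ρ ^ 2 + ε ^ 2) ≤ F * S / (F + S) := by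
      rw [div_le_div_iff₀ (by positivity) (by positivity)]
      have e1 : ρ ^ 2 * F * ε ^ 2 ≤ ρ ^ 2 * F * S := by gcongr
      have e2 : ε ^ 2 * S * ρ ^ 2 ≤ ε ^ 2 * S * F := by gcongr
      linarith
    exact h1.trans h2
  have h3 : blockRisk B ε (coef f) 1 ≤ ∑ j ∈ Finset.Icc 1 B.J, blockRisk B ε (coef f) j :=
    Finset.single_le_sum (f := fun j => blockRisk B ε (coef f) j)
      (fun _ _ => blockRisk_nonneg) B.one_mem
  have h4 := hf.sum_blockSignal_le (B := B) hβ
  rw [oracleRisk]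
  linarith

lemma blockRisk_le_blockNoise {c : ℕ → ℝ} {j : ℕ} : blockRisk B ε c j ≤ blockNoise B ε j := by
  rw [blockRisk_eq]
  exact mul_le_of_le_one_left blockNoise_nonneg oracleWeight_le_one

end Signal

end ShiftModel

namespace ShiftModel

/-! ### Rates as the noise level tends to zero -/

lemma tendsto_pow_mul_exp_neg (n : ℕ) {s : ℝ} (hs : 0 < s) :
    Tendsto (fun l : ℝ => l ^ n * Real.exp (-(s * l))) atTop (𝓝 0) := by
  have h := ((Real.tendsto_pow_mul_exp_neg_atTop_nhds_zero n).comp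
    (tendsto_id.const_mul_atTop hs)).const_mul ((s ^ n)⁻¹)
  rw [mul_zero] at h
  refine h.congr fun l => ?_
  simp only [Function.comp_apply, id, mul_pow]
  field_simp

lemma tendsto_log_inv : Tendsto (fun ε : ℝ => Real.log ε⁻¹) (𝓝[>] 0) atTop :=
  Real.tendsto_log_atTop.comp tendsto_inv_nhdsGT_zero

lemma exp_neg_log_inv {ε : ℝ} (hε : 0 < ε) : Real.exp (-Real.log ε⁻¹) = ε := by
  rw [Real.log_inv, neg_neg, Real.exp_log hε]

lemma log_zpow_eq (ε : ℝ) (n : ℕ) : Real.log (ε ^ (-(n : ℤ))) = n * Real.log ε⁻¹ := by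
  rw [Real.log_zpow, Real.log_inv]
  push_cast
  ring

/-- The bound for the oracle risk as a function of `l = log ε⁻¹`: the noise up to the cut-off and
the signal beyond it. -/
noncomputable def riskRate (β L l : ℝ) : ℝ :=
  5000 * Real.exp (-(2 * (1 - 3 * (1 / (2 * β + 1))) * l))
    + L ^ 2 * (5 * l * Real.exp (-(2 * (1 / (2 * β + 1) * (2 * β - 2)) * l)))

lemma riskRate_nonneg (β L : ℝ) {l : ℝ} (hl : 0 ≤ l) : 0 ≤ riskRate β L l := by
  unfold riskRate
  positivity

lemma cutoff_exponent_lt {β : ℝ} (hβ : 1 < β) : 1 / (2 * β + 1) < 1 / 3 :=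
  one_div_lt_one_div_of_lt (by norm_num) (by linarith)

lemma tendsto_pow_mul_riskRate {β : ℝ} (hβ : 1 < β) (L : ℝ) (n : ℕ) :
    Tendsto (fun l => l ^ n * riskRate β L l) atTop (𝓝 0) := by
  have ha := cutoff_exponent_lt hβ
  have ha0 : 0 < 1 / (2 * β + 1) := by have : 0 < 2 * β + 1 := by linarith
                                       positivity
  have h1 := (tendsto_pow_mul_exp_neg n (s := 2 * (1 - 3 * (1 / (2 * β + 1))))
    (by linarith)).const_mul 5000
  have h2 := (tendsto_pow_mul_exp_neg (n + 1) (s := 2 * (1 / (2 * β + 1) * (2 * β - 2)))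
    (mul_pos two_pos (mul_pos ha0 (by linarith)))).const_mul (L ^ 2 * 5)
  have h3 := h1.add h2
  rw [mul_zero, mul_zero, add_zero] at h3
  refine h3.congr fun l => ?_
  rw [riskRate]
  ring

section Cutoff

variable {β ε l : ℝ}

lemma cutoff_eq (hl : l = Real.log ε⁻¹) (hε : 0 < ε) : cutoff β ε
    = max 5 ⌊(Real.exp (-(2 * l)) * (5 * l)) ^ (-(1 / (2 * β + 1)))⌋₊ := by
  have h1 : ε ^ 2 = Real.exp (-(2 * l)) := by
    rw [show -(2 * l) = -l + -l by ring, Real.exp_add, hl, exp_neg_log_inv hε, sq]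
  have h2 : Real.log (ε ^ (-5 : ℤ)) = 5 * l := by
    have := log_zpow_eq ε 5
    rw [hl]
    exact_mod_cast this
  rw [cutoff, h1, h2]

lemma cutoff_le (hβ : 1 < β) (hl : l = Real.log ε⁻¹) (hε : 0 < ε) (hl1 : 1 ≤ l) :
    (cutoff β ε : ℝ) ≤ 5 * Real.exp (2 * (1 / (2 * β + 1)) * l) := by
  have ha0 : 0 < 1 / (2 * β + 1) := by have : 0 < 2 * β + 1 := by linarith
                                       positivity
  have h1 : 1 ≤ Real.exp (2 * (1 / (2 * β + 1)) * l) := Real.one_le_exp (by positivity)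
  rw [cutoff_eq hl hε, Nat.cast_max]
  refine max_le ?_ ?_
  · push_cast
    linarith
  · refine (Nat.floor_le (by positivity)).trans ?_
    have h2 : (Real.exp (-(2 * l)) * (5 * l)) ^ (-(1 / (2 * β + 1)))
        ≤ Real.exp (-(2 * l)) ^ (-(1 / (2 * β + 1))) := by
      refine Real.rpow_le_rpow_of_nonpos (Real.exp_pos _) ?_ (by linarith)
      exact le_mul_of_one_le_right (Real.exp_pos _).le (by linarith)
    rw [← Real.exp_mul] at h2
    have h3 : -(2 * l) * -(1 / (2 * β + 1)) = 2 * (1 / (2 * β + 1)) * l := by ring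
    rw [h3] at h2
    linarith

lemma le_cutoff_add_one (hl : l = Real.log ε⁻¹) (hε : 0 < ε) :
    (Real.exp (-(2 * l)) * (5 * l)) ^ (-(1 / (2 * β + 1))) ≤ (cutoff β ε : ℝ) + 1 := by
  rw [cutoff_eq hl hε]
  refine (Nat.lt_floor_add_one _).le.trans ?_
  have : ⌊(Real.exp (-(2 * l)) * (5 * l)) ^ (-(1 / (2 * β + 1)))⌋₊
      ≤ max 5 ⌊(Real.exp (-(2 * l)) * (5 * l)) ^ (-(1 / (2 * β + 1)))⌋₊ := le_max_right _ _
  have h : (⌊(Real.exp (-(2 * l)) * (5 * l)) ^ (-(1 / (2 * β + 1)))⌋₊ : ℝ)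
      ≤ (max 5 ⌊(Real.exp (-(2 * l)) * (5 * l)) ^ (-(1 / (2 * β + 1)))⌋₊ : ℕ) := by
    exact_mod_cast this
  linarith

lemma noise_le_rate (hβ : 1 < β) (hl : l = Real.log ε⁻¹) (hε : 0 < ε) (hl1 : 1 ≤ l) :
    40 * ε ^ 2 * (cutoff β ε : ℝ) ^ 3
      ≤ 5000 * Real.exp (-(2 * (1 - 3 * (1 / (2 * β + 1))) * l)) := by
  have h1 := cutoff_le hβ hl hε hl1
  have h2 : ε ^ 2 = Real.exp (-(2 * l)) := by
    rw [show -(2 * l) = -l + -l by ring, Real.exp_add, hl, exp_neg_log_inv hε, sq]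
  calc 40 * ε ^ 2 * (cutoff β ε : ℝ) ^ 3
      ≤ 40 * ε ^ 2 * (5 * Real.exp (2 * (1 / (2 * β + 1)) * l)) ^ 3 := by gcongr
    _ = 5000 * (Real.exp (-(2 * l)) * Real.exp (2 * (1 / (2 * β + 1)) * l) ^ 3) := by
        rw [h2]; ring
    _ = _ := by
        rw [← Real.exp_nat_mul, ← Real.exp_add]
        congr 2
        push_cast
        ring

lemma tail_le_rate (hβ : 1 < β) (hl1 : 1 ≤ l) :
    (((Real.exp (-(2 * l)) * (5 * l)) ^ (-(1 / (2 * β + 1)))) ^ (2 * β - 2))⁻¹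
      ≤ 5 * l * Real.exp (-(2 * (1 / (2 * β + 1) * (2 * β - 2)) * l)) := by
  have hβ0 : 0 < 2 * β + 1 := by linarith
  set b := 1 / (2 * β + 1) * (2 * β - 2) with hb
  have hb1 : b ≤ 1 := by
    rw [hb, one_div, ← div_eq_inv_mul, div_le_one hβ0]
    linarith
  rw [← Real.rpow_mul (by positivity), ← Real.rpow_neg (by positivity)]
  rw [show -(-(1 / (2 * β + 1)) * (2 * β - 2)) = b by rw [hb]; ring,
    Real.mul_rpow (Real.exp_pos _).le (by positivity), ← Real.exp_mul]
  have h1 : (5 * l) ^ b ≤ 5 * l := by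
    have := Real.rpow_le_rpow_of_exponent_le (x := 5 * l) (by linarith) hb1
    rwa [Real.rpow_one] at this
  rw [show -(2 * l) * b = -(2 * b * l) by ring, mul_comm]
  exact mul_le_mul_of_nonneg_right h1 (Real.exp_pos _).le

variable {L ρ : ℝ} {f : ℝ → ℝ} {B : Blocks (cutoff β ε)}

lemma IsSobolevSignal.oracleRisk_le_riskRate (hf : IsSobolevSignal β L ρ f) (hβ : 1 < β)
    (hl : l = Real.log ε⁻¹) (hε : 0 < ε) (hl1 : 1 ≤ l) :
    oracleRisk B ε (coef f) (derivSq f) ≤ riskRate β L l := by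
  have h1 : ∑ j ∈ Finset.Icc 1 B.J, blockRisk B ε (coef f) j
      ≤ 5000 * Real.exp (-(2 * (1 - 3 * (1 / (2 * β + 1))) * l)) :=
    (Finset.sum_le_sum fun j _ => blockRisk_le_blockNoise).trans
      (sum_blockNoise_le.trans (noise_le_rate hβ hl hε hl1))
  have h2 := hf.tail_le (B := B) hβ (by positivity) (le_cutoff_add_one (β := β) hl hε)
  have h3 := mul_le_mul_of_nonneg_left (tail_le_rate hβ hl1) (sq_nonneg L)
  rw [oracleRisk, riskRate]
  linarith

end Cutoff

/-! ### Conclusion -/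

/-- The bookkeeping that turns the bound for the mean squared error into the second-order term of
the risk: every remainder carries a factor `R`, the last one because `ε²` is at most a multiple of
`R`. -/
lemma scaled_error_le {ε F R E φ τ q r m M : ℝ} (hε : 0 < ε) (hm : 0 < m) (hmF : m ≤ F)
    (hFM : F ≤ M) (hR : 0 ≤ R) (hRr : R ≤ r) (hRε : m / (m + 1) * ε ^ 2 ≤ R)
    (hq : 0 ≤ q) (hτ : 0 < τ) (hτφ : 1 / τ ≤ φ) (hτφ' : 1 / √τ ≤ φ)
    (hE : E ≤ ε ^ 2 / F * (1 + R / F * (1 + 16 * (R / F) + 10 ^ 9 * φ + 576 / τ))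
      + 216 * (1 / F ^ 4 + 1 / F ^ 5) * (2 * 10 ^ 7 * (F + 1) * R / √τ) * (28 * ε ^ 2 * (F + 1) ^ 2)
      + 34 * ε ^ 4 * q) :
    (ε ^ 2)⁻¹ * F * E ≤ 1 + (1 + (16 * (r / m) + (10 ^ 9 + 576
      + 216 * (2 * 10 ^ 7) * 28 * ((1 / m ^ 2 + 1 / m ^ 3) * (M + 1) ^ 3)) * φ
      + 34 * (M ^ 2 * ((m + 1) / m)) * q)) * (R / F) := by
  have hF : 0 < F := hm.trans_le hmF
  have hsτ : 0 < √τ := Real.sqrt_pos.2 hτ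
  have hφ : 0 ≤ φ := (by positivity : 0 ≤ 1 / τ).trans hτφ
  have h1 := mul_le_mul_of_nonneg_left hE (by positivity : 0 ≤ (ε ^ 2)⁻¹ * F)
  refine h1.trans ?_
  have e1 : (ε ^ 2)⁻¹ * F * (ε ^ 2 / F * (1 + R / F * (1 + 16 * (R / F) + 10 ^ 9 * φ + 576 / τ))
      + 216 * (1 / F ^ 4 + 1 / F ^ 5) * (2 * 10 ^ 7 * (F + 1) * R / √τ) * (28 * ε ^ 2 * (F + 1) ^ 2)
      + 34 * ε ^ 4 * q)
      = 1 + (1 + (16 * (R / F) + 10 ^ 9 * φ + 576 * (1 / τ)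
        + 216 * (2 * 10 ^ 7) * 28 * ((1 / F ^ 2 + 1 / F ^ 3) * (F + 1) ^ 3) * (1 / √τ)))
        * (R / F) + 34 * F * ε ^ 2 * q := by
    field_simp
    ring
  rw [e1]
  have h2 : R / F ≤ r / m := div_le_div₀ (hR.trans hRr) hRr hm hmF
  have h3 : (1 / F ^ 2 + 1 / F ^ 3) * (F + 1) ^ 3 ≤ (1 / m ^ 2 + 1 / m ^ 3) * (M + 1) ^ 3 := by
    gcongr
  have h4 : 216 * (2 * 10 ^ 7) * 28 * ((1 / F ^ 2 + 1 / F ^ 3) * (F + 1) ^ 3) * (1 / √τ)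
      ≤ 216 * (2 * 10 ^ 7) * 28 * ((1 / m ^ 2 + 1 / m ^ 3) * (M + 1) ^ 3) * φ := by
    have : 0 ≤ (1 / m ^ 2 + 1 / m ^ 3) * (M + 1) ^ 3 := le_trans (by positivity) h3
    gcongr
  have h5 : 34 * F * ε ^ 2 * q ≤ 34 * (M ^ 2 * ((m + 1) / m)) * q * (R / F) := by
    have h6 : ε ^ 2 ≤ (m + 1) / m * R := by
      have := mul_le_mul_of_nonneg_left hRε (by positivity : 0 ≤ (m + 1) / m)
      refine le_trans (le_of_eq ?_) this
      field_simp
    have h7 : F * ε ^ 2 ≤ M ^ 2 * ((m + 1) / m) * (R / F) := by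
      have h8 : F ^ 2 ≤ M ^ 2 := by gcongr
      calc F * ε ^ 2 ≤ F * ((m + 1) / m * R) := by gcongr
        _ = F ^ 2 * ((m + 1) / m) * (R / F) := by field_simp
        _ ≤ _ := by gcongr
    have := mul_le_mul_of_nonneg_left h7 (by positivity : 0 ≤ 34 * q)
    linarith
  have h9 : (16 * (R / F) + 10 ^ 9 * φ + 576 * (1 / τ)
        + 216 * (2 * 10 ^ 7) * 28 * ((1 / F ^ 2 + 1 / F ^ 3) * (F + 1) ^ 3) * (1 / √τ))
      ≤ 16 * (r / m) + (10 ^ 9 + 576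
      + 216 * (2 * 10 ^ 7) * 28 * ((1 / m ^ 2 + 1 / m ^ 3) * (M + 1) ^ 3)) * φ := by
    linarith
  have h10 := mul_le_mul_of_nonneg_right h9 (by positivity : 0 ≤ R / F)
  linarith

end ShiftModel

namespace ShiftModel

section Regime

variable {N : ℕ} {B : Blocks N} {ε l : ℝ} {j : ℕ}

lemma Blocks.one_le_minLen (B : Blocks N) : 1 ≤ B.minLen :=
  (Finset.le_inf'_iff _ _).2 fun _ hj => one_le_len hj

lemma penalty_pos (hl : Real.log (ε ^ (-5 : ℤ)) = 5 * l) (hl0 : 0 < l)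
    (hj : j ∈ Finset.Icc 1 B.J) : 0 < penalty B ε j := by
  have h : (0 : ℝ) < B.len j := by exact_mod_cast Blocks.one_le_len hj
  rw [penalty, hl]
  exact Real.sqrt_pos.2 (by positivity)

lemma penalty_le_sqrt (hl : Real.log (ε ^ (-5 : ℤ)) = 5 * l) (hl0 : 0 ≤ l)
    (hj : j ∈ Finset.Icc 1 B.J) : penalty B ε j ≤ √(120 * (l / B.minLen)) := by
  have h : (0 : ℝ) < B.minLen := by exact_mod_cast B.one_le_minLen
  have h1 : (B.minLen : ℝ) ≤ B.len j := by exact_mod_cast Blocks.minLen_le_len hj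
  rw [penalty, hl]
  refine Real.sqrt_le_sqrt ?_
  calc 24 * (B.len j : ℝ)⁻¹ * (5 * l) = 120 * (l / B.len j) := by ring
    _ ≤ 120 * (l / B.minLen) := by gcongr

lemma one_div_sqrt_le {τ : ℝ} (hτ : 1 ≤ τ) (hl : 1 ≤ l) : 1 / √τ ≤ √(120 * (l / τ)) := by
  rw [one_div, ← Real.sqrt_inv]
  refine Real.sqrt_le_sqrt ?_
  rw [← mul_div_assoc, inv_eq_one_div]
  gcongr
  linarith

lemma one_div_le_one_div_sqrt {τ : ℝ} (hτ : 1 ≤ τ) : 1 / τ ≤ 1 / √τ := by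
  have : 0 < √τ := Real.sqrt_pos.2 (by linarith)
  refine one_div_le_one_div_of_le this ?_
  rw [Real.sqrt_le_left (by linarith)]
  nlinarith

/-- The probability that the good event fails, for a partition into at most `5 ε^{-2/3}` blocks. -/
lemma bad_probability_le (hε : 0 < ε) (hl : l = Real.log ε⁻¹) (hl0 : 0 ≤ l)
    (hJ : (B.J : ℝ) ≤ 5 * Real.exp (2 / 3 * l)) :
    (6 * B.J + 4) * Real.exp (-(4.8 * l)) ≤ 34 * ε ^ 4 * Real.exp (-(1 / 10 * l)) := by
  have h1 : 1 ≤ Real.exp (2 / 3 * l) := Real.one_le_exp (by positivity)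
  have h2 : ε ^ 4 = Real.exp (-(4 * l)) := by
    rw [← exp_neg_log_inv hε, ← hl, ← Real.exp_nat_mul]
    congr 1
    push_cast
    ring
  calc (6 * B.J + 4) * Real.exp (-(4.8 * l))
      ≤ 34 * Real.exp (2 / 3 * l) * Real.exp (-(4.8 * l)) := by
        gcongr
        linarith
    _ = 34 * Real.exp (2 / 3 * l + -(4.8 * l)) := by rw [mul_assoc, ← Real.exp_add]
    _ ≤ 34 * Real.exp (-(4 * l) + -(1 / 10 * l)) :=
        mul_le_mul_of_nonneg_left (Real.exp_le_exp.2 (by linarith)) (by norm_num)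
    _ = _ := by rw [h2, Real.exp_add, mul_assoc]

end Regime

end ShiftModel

theorem theorem1 (β L ρ T : ℝ) (hβ : 1 < β) (hL : 0 < L) (hρ : 0 < ρ) (hT : T < 1 / 4)
    (Θ : Set ℝ) (hΘ : Θ ⊆ Set.Ioc (-T) T)
    (B : ∀ ε : ℝ, Blocks (cutoff β ε))
    (hB : (fun ε : ℝ => Real.log ε⁻¹) =o[𝓝[>] 0] fun ε : ℝ => ((B ε).minLen : ℝ)) :
    ∃ α : ℝ → ℝ, Tendsto α (𝓝[>] 0) (𝓝 0) ∧
      ∀ᶠ ε in 𝓝[>] (0 : ℝ), ∀ θ ∈ Θ, ∀ f : ℝ → ℝ, IsSobolevSignal β L ρ f →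
        ∀ hstar : ℕ → ℝ, IsOracle (B ε) ε f hstar →
        ∀ (Ω : Type*) [MeasurableSpace Ω] (P : Measure Ω) [IsProbabilityMeasure P]
          (W : ℝ≥0 → Ω → ℝ), IsBrownianReal W P →
        ∀ θhat : Ω → ℝ, AEMeasurable θhat P →
          (∀ᵐ ω ∂P, IsEstimate (B ε) ε (obsPath ε θ f (W · ω)) (θhat ω)) →
          Integrable (fun ω => (θhat ω - θ) ^ 2) P ∧
          ε ^ (-2 : ℤ) * derivSq f * ∫ ω, (θhat ω - θ) ^ 2 ∂P
            ≤ 1 + (1 + α ε) * (risk ε f hstar / derivSq f) := by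
  rcases lt_or_ge T 0 with hT0 | hT0
  · -- No shift satisfies the hypothesis.
    refine ⟨fun _ => 0, tendsto_const_nhds, Eventually.of_forall fun ε θ hθ => ?_⟩
    have := hΘ hθ
    exact absurd (this.1.trans_le this.2) (by linarith)
  have hC : 0 < Real.cos (2 * π * T) := by
    have hπ := Real.pi_pos
    have : 0 ≤ 2 * π * T := by positivity
    exact Real.cos_pos_of_mem_Ioo ⟨by linarith, by nlinarith⟩
  have hm : 0 < ρ ^ 2 := by positivity
  set lam := ρ * Real.cos (2 * π * T) ^ 2 with hlam
  have hlam0 : 0 < lam := by positivity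
  set C₁ : ℝ := 10 ^ 9 + 576
    + 216 * (2 * 10 ^ 7) * 28 * ((1 / (ρ ^ 2) ^ 2 + 1 / (ρ ^ 2) ^ 3) * (L ^ 2 + 1) ^ 3) with hC₁
  set C₂ : ℝ := 34 * ((L ^ 2) ^ 2 * ((ρ ^ 2 + 1) / ρ ^ 2)) with hC₂
  have hlog := tendsto_log_inv
  have hrate := (tendsto_pow_mul_riskRate hβ L 0).comp hlog
  have hrate2 := (tendsto_pow_mul_riskRate hβ L 2).comp hlog
  simp only [Function.comp_def, pow_zero, one_mul] at hrate hrate2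
  have hφ : Tendsto (fun ε => √(120 * (Real.log ε⁻¹ / (B ε).minLen))) (𝓝[>] 0) (𝓝 0) := by
    have h := ((hB.tendsto_div_nhds_zero).const_mul 120).sqrt
    rwa [mul_zero, Real.sqrt_zero] at h
  have hq : Tendsto (fun ε => Real.exp (-(1 / 10 * Real.log ε⁻¹))) (𝓝[>] 0) (𝓝 0) := by
    have h := (tendsto_pow_mul_exp_neg 0 (s := 1 / 10) (by norm_num)).comp hlog
    simpa only [Function.comp_def, pow_zero, one_mul] using h
  have hεl : Tendsto (fun ε => Real.log ε⁻¹ * Real.exp (-Real.log ε⁻¹)) (𝓝[>] 0) (𝓝 0) := by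
    have h := (tendsto_pow_mul_exp_neg 1 (s := 1) one_pos).comp hlog
    simpa only [Function.comp_def, pow_one, one_mul] using h
  refine ⟨fun ε => 16 * (riskRate β L (Real.log ε⁻¹) / ρ ^ 2)
    + C₁ * √(120 * (Real.log ε⁻¹ / (B ε).minLen))
    + C₂ * Real.exp (-(1 / 10 * Real.log ε⁻¹)), ?_, ?_⟩
  · have h := (((hrate.div_const (ρ ^ 2)).const_mul 16).add (hφ.const_mul C₁)).add (hq.const_mul C₂)
    simpa using h
  have hK0 : 0 < 19 * (2 * 10 ^ 7 * (L ^ 2 + 1)) := by positivity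
  filter_upwards [self_mem_nhdsWithin, Ioo_mem_nhdsGT (zero_lt_one' ℝ),
    hlog.eventually_ge_atTop 1, hlog.eventually_ge_atTop (9.6 / lam ^ 2),
    hφ.eventually_le_const (by norm_num : (0 : ℝ) < 10⁻¹ ^ 8),
    hrate.eventually_le_const zero_lt_one,
    hrate.eventually_le_const (by positivity : 0 < ρ ^ 2 / 8),
    hrate2.eventually_le_const (by positivity :
      0 < ρ ^ 2 / 8 / (19 * (2 * 10 ^ 7 * (L ^ 2 + 1)))),
    hεl.eventually_le_const (by positivity : 0 < ρ * Real.cos (2 * π * T) / (5 * lam)),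
    hεl.eventually_le_const (by norm_num : (0 : ℝ) < 1 / 8)]
    with ε hε hε1 hl1 hl2 hφs hr1 hr2 hr3 he1 he2
  replace hε : 0 < ε := hε
  intro θ hθ f hf hstar horacle Ω _ P _ W hW θhat hθhat hest
  set l := Real.log ε⁻¹ with hl
  rw [exp_neg_log_inv hε] at he1 he2
  set τ : ℝ := ((B ε).minLen : ℝ) with hτ
  have hτ1 : 1 ≤ τ := by rw [hτ]; exact_mod_cast (B ε).one_le_minLen
  have hθT : |θ| ≤ T := abs_le.2 ⟨(hΘ hθ).1.le, (hΘ hθ).2⟩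
  have hlog5 : Real.log (ε ^ (-5 : ℤ)) = 5 * l := by exact_mod_cast log_zpow_eq ε 5
  have hlog2 : Real.log (ε ^ (-2 : ℤ)) = 2 * l := by exact_mod_cast log_zpow_eq ε 2
  have hFm := hf.le_derivSq hβ hρ
  have hFM := hf.derivSq_le hβ
  set F := derivSq f with hF
  have hF0 : 0 < F := hm.trans_le hFm
  have hRr : oracleRisk (B ε) ε (coef f) F ≤ riskRate β L l :=
    hf.oracleRisk_le_riskRate hβ hl hε hl1
  have hRε := hf.le_oracleRisk (B := B ε) hβ hρ hε hε1.2.le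
  have hreg : IsRegular (B ε) ε (coef f) F (√(120 * (l / τ))) τ :=
    { ε_pos := hε
      F_pos := hF0
      penalty_pos := fun j hj => penalty_pos hlog5 (by linarith) hj
      penalty_le := fun j hj => penalty_le_sqrt hlog5 (by linarith) hj
      φ_le := hφs
      one_le_τ := hτ1
      τ_le := fun j hj => by rw [hτ]; exact_mod_cast Blocks.minLen_le_len hj
      noise_le := by
        refine sum_blockNoise_le.trans ((noise_le_rate hβ hl hε hl1).trans (le_trans ?_ hr1))
        rw [riskRate]
        exact le_add_of_nonneg_right (by positivity)
      signal_le := hf.sum_blockSignal_le hβ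
      risk_le := by linarith }
  have hR0 := hreg.oracleRisk_nonneg
  set R := oracleRisk (B ε) ε (coef f) F with hR
  have hK : 4 * Real.log (ε ^ (-2 : ℤ)) * remainderBound (B ε) ε (coef f) F τ
      + 8 / 3 * Real.log (ε ^ (-2 : ℤ)) ^ 2 * remainderBound (B ε) ε (coef f) F τ ≤ F / 8 := by
    have hKle : remainderBound (B ε) ε (coef f) F τ
        ≤ 2 * 10 ^ 7 * (L ^ 2 + 1) * riskRate β L l := by
      have h1 : 1 ≤ √τ := Real.one_le_sqrt.2 hτ1
      refine (div_le_self (by positivity) h1).trans ?_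
      gcongr
    have hK1 : 0 ≤ remainderBound (B ε) ε (coef f) F τ := by
      unfold remainderBound
      positivity
    have h2 : l ≤ l ^ 2 := by nlinarith
    rw [hlog2]
    calc _ = (8 * l + 32 / 3 * l ^ 2) * remainderBound (B ε) ε (coef f) F τ := by ring
      _ ≤ (19 * l ^ 2) * (2 * 10 ^ 7 * (L ^ 2 + 1) * riskRate β L l) := by
          gcongr
          linarith
      _ = 19 * (2 * 10 ^ 7 * (L ^ 2 + 1)) * (l ^ 2 * riskRate β L l) := by ring
      _ ≤ 19 * (2 * 10 ^ 7 * (L ^ 2 + 1))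
          * (ρ ^ 2 / 8 / (19 * (2 * 10 ^ 7 * (L ^ 2 + 1)))) := by gcongr
      _ = ρ ^ 2 / 8 := by field_simp
      _ ≤ F / 8 := by gcongr
  have hΛ : 5 * (ε * (lam * l)) ≤ ρ * Real.cos (2 * π * T) := by
    rw [le_div_iff₀ (by positivity)] at he1
    linarith
  have hΛ' : lam * l / lam ≤ Real.log (ε ^ (-2 : ℤ)) := by
    rw [hlog2, mul_div_cancel_left₀ _ hlam0.ne']
    linarith
  obtain ⟨hint, hle⟩ := hf.toIsSignal.integral_sq_error_le hρ hT hθT hreg hΛ hΛ'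
    (by rw [hlog2]; linarith) hK hW hθhat hest
  refine ⟨hint, ?_⟩
  have hbad : noiseLaw.real {x | ¬ IsGood (B ε) ε (coef f) x (lam * l)}
      ≤ 34 * ε ^ 4 * Real.exp (-(1 / 10 * l)) := by
    refine (measureReal_not_isGood_le hε hlog5 (by linarith)
      (fun j hj => (hreg.penalty_le j hj).trans hφs) (by positivity) ?_).trans
      (bad_probability_le hε hl (by linarith) ?_)
    · rw [div_le_iff₀ (by positivity)] at hl2
      have := mul_le_mul_of_nonneg_right hl2 (by linarith : 0 ≤ l)
      linarith
    · have h1 : ((B ε).J : ℝ) ≤ cutoff β ε := by exact_mod_cast (B ε).J_le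
      refine h1.trans ((cutoff_le hβ hl hε hl1).trans ?_)
      have := cutoff_exponent_lt hβ
      gcongr
      linarith
  have hE := hle.trans ((integral_errorBound_le hreg).trans (add_le_add_right hbad _))
  have hmain := scaled_error_le hε hm hFm hFM hR0 hRr hRε (Real.exp_pos _).le
    (by linarith) ((one_div_le_one_div_sqrt hτ1).trans (one_div_sqrt_le hτ1 hl1))
    (one_div_sqrt_le hτ1 hl1) hE
  have hpow : ε ^ (-2 : ℤ) = (ε ^ 2)⁻¹ := by
    rw [zpow_neg]
    norm_cast
  rw [hpow]
  refine hmain.trans ?_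
  have hrisk := hf.oracleRisk_le_risk hβ hε horacle.1
  have hr0 := riskRate_nonneg β L (by linarith : 0 ≤ l)
  gcongr
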